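/- **Theorem 2.1.** Let $0<H<\tfrac12$ and, for $0<s<t$, put $$K_{H,1}(t,s)=c_H\,t^{H-\frac12}s^{\frac12-H}(t-s)^{H-\frac12},\qquad K_{H,2}(t,s)=c_H\left(\tfrac12-H\right)s^{\frac12-H}\int_s^t u^{H-\frac32}(u-s)^{H-\frac12}\,du,$$ where $c_H=\Big(\frac{2H}{(1-2H)\,\beta(1-2H,\,H+\frac12)}\Big)^{1/2}$ and $\beta$ is Euler's beta function. For $T>0$ and $\lambda>0$ let $\mathbf C^\lambda_0$ be the space of $\lambda$-Hölder continuous functions $f:[0,T]\to\mathbb R$ with $f(0)=0$, normed by $\|f\|_\lambda=\sup_{0<s<r\le T}|f(r)-f(s)|/|r-s|^\lambda$, and put $$(\Lambda_Hf)(t)=\int_0^t[f(t)-f(s)]\,\partial_sK_{H,1}(t,s)\,ds-\int_0^t\partial_sK_{H,2}(t,s)\,f(s)\,ds,\qquad 0\le t\le T .$$ (a) For every $\lambda\in(\tfrac12-H,\tfrac12)$ there is a constant $C$, depending only on $H$ and $\lambda$, such that for all $T>0$ and $f\in\mathbf C_0^\lambda$ both integrals converge absolutely for every $t\in[0,T]$,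 $\Lambda_Hf$ is continuous on $[0,T]$, and $\sup_{0\le t\le T}|(\Lambda_Hf)(t)|\le C\,T^{H-\frac12+\lambda}\|f\|_\lambda$; moreover $\Lambda_H$ is linear on $\mathbf C_0^\lambda$. (b) Let $T>0$ and let $B_H=(B_H(t))_{0\le t\le T}$ be a fractional Brownian motion with exponent $H$ on a probability space $(\Omega,\mathcal F,\mathbb P)$, that is, a centered Gaussian process with $\mathbb E[B_H(s)B_H(t)]=\frac12\left(s^{2H}+t^{2H}-|t-s|^{2H}\right)$. Then there is a real-valued standard Brownian motion $B=(B(t))_{0\le t\le T}$ on the same probability space such that almost surely the path of $B$ lies in $\mathbf C_0^\lambda$ for every $\lambda\in(\frac12-H,\frac12)$, and for every $t\in[0,T]$ $$B_H(t)=(\Lambda_HB)(t)\quad\text{almost surely.}$$ If $B_H$ has almost surely continuous paths, then almost surely this identity holds for all $t\in[0,T]$ simultaneously. -/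

import Mathlib

open MeasureTheory ProbabilityTheory Set

noncomputable section

/-- The positive normalizing constant `c_H = (2H / ((1 - 2H) β(1 - 2H, H + 1/2)))^{1/2}` of the
Volterra kernel of fractional Brownian motion with `0 < H < 1/2`; here `β` is Euler's beta
function. -/
def volterraConst (H : ℝ) : ℝ :=
  √(2 * H / ((1 - 2 * H) * ProbabilityTheory.beta (1 - 2 * H) (H + 1 / 2)))

/-- The first part `K_{H,1}(t,s)` of the Volterra kernel, meant for `0 < s < t`. -/
def kernelOne (H t s : ℝ) : ℝ :=
  volterraConst H * t ^ (H - 1 / 2) * s ^ (1 / 2 - H) * (t - s) ^ (H - 1 / 2)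

/-- The second part `K_{H,2}(t,s)` of the Volterra kernel, meant for `0 < s < t`. -/
def kernelTwo (H t s : ℝ) : ℝ :=
  volterraConst H * (1 / 2 - H) * s ^ (1 / 2 - H) *
    ∫ u in s..t, u ^ (H - 3 / 2) * (u - s) ^ (H - 1 / 2)

/-- `(Λ_H f)(t) = ∫₀ᵗ [f(t) - f(s)] ∂ₛK_{H,1}(t,s) ds - ∫₀ᵗ ∂ₛK_{H,2}(t,s) f(s) ds`. -/
def fracOp (H : ℝ) (f : ℝ → ℝ) (t : ℝ) : ℝ :=
  (∫ s in (0 : ℝ)..t, (f t - f s) * deriv (fun r => kernelOne H t r) s) -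
    ∫ s in (0 : ℝ)..t, deriv (fun r => kernelTwo H t r) s * f s

/-- Both integrals in the definition of `(Λ_H f)(t)` converge absolutely. -/
def FracOpConverges (H : ℝ) (f : ℝ → ℝ) (t : ℝ) : Prop :=
  IntervalIntegrable (fun s => (f t - f s) * deriv (fun r => kernelOne H t r) s) volume 0 t ∧
    IntervalIntegrable (fun s => deriv (fun r => kernelTwo H t r) s * f s) volume 0 t

/-- The space `C_0^lam` of `lam`-Hölder continuous functions on `[0,T]` vanishing at `0`
(the values of `f` outside `[0,T]` are irrelevant). -/
def MemHolderZero (lam T : ℝ) (f : ℝ → ℝ) : Prop :=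
  f 0 = 0 ∧ ∃ M : ℝ, ∀ s ∈ Icc 0 T, ∀ r ∈ Icc 0 T, |f r - f s| ≤ M * |r - s| ^ lam

/-- The norm `‖f‖_lam = sup_{0 < s < r ≤ T} |f(r) - f(s)| / |r - s|^lam`. -/
def holderNorm (lam T : ℝ) (f : ℝ → ℝ) : ℝ :=
  sSup {x : ℝ | ∃ s r : ℝ, 0 < s ∧ s < r ∧ r ≤ T ∧ x = |f r - f s| / |r - s| ^ lam}

/-- `B` is a standard Brownian motion on the time interval `[0,T]`
(the values of `B` at times outside `[0,T]` are irrelevant). -/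
structure IsBrownianOn {Ω : Type*} [MeasurableSpace Ω] (T : ℝ) (B : ℝ → Ω → ℝ)
    (P : Measure Ω) : Prop where
  zero : ∀ᵐ ω ∂P, B 0 ω = 0
  indep : HasIndepIncrements (fun t : Icc (0 : ℝ) T => B t) P
  law : ∀ s ∈ Icc 0 T, ∀ t ∈ Icc 0 T, s ≤ t →
    HasLaw (fun ω => B t ω - B s ω) (gaussianReal 0 (t - s).toNNReal) P
  cont : ∀ᵐ ω ∂P, ContinuousOn (fun t => B t ω) (Icc 0 T)

/-- `X` is a fractional Brownian motion with exponent `H` on the time interval `[0,T]`: a centered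
Gaussian process with covariance `(s^{2H} + t^{2H} - |t - s|^{2H}) / 2`. Continuity of paths is not
required (the values of `X` at times outside `[0,T]` are irrelevant). -/
structure IsFracBrownianOn {Ω : Type*} [MeasurableSpace Ω] (H T : ℝ) (X : ℝ → Ω → ℝ)
    (P : Measure Ω) : Prop where
  gaussian : IsGaussianProcess (fun t : Icc (0 : ℝ) T => X t) P
  centered : ∀ t ∈ Icc 0 T, ∫ ω, X t ω ∂P = 0
  covariance : ∀ s ∈ Icc 0 T, ∀ t ∈ Icc 0 T,
    cov[X s, X t; P] = (s ^ (2 * H) + t ^ (2 * H) - |t - s| ^ (2 * H)) / 2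

end

/-! ### Truncated powers and beta integrals. -/

noncomputable section

/-! Extend $K_H=K_{H,1}+K_{H,2}$ by zero outside $0<s<t$. Two facts about this kernel drive part
(b): $\int K_H(t,u)K_H(s,u)\,du$ is the covariance of fractional Brownian motion
(`integral_volterraK_mul`), and the functions $K_H(t,\cdot)$ are total in $L^2(0,T)$
(`ae_eq_zero_of_forall_integral_volterraK`). Both are read off from a second form of the kernel, a
constant times $s^{H-1/2}\int_s^t (t-r)^{2H-1}r^{1/2-H}(r-s)^{-1/2-H}\,dr$ (`volterra_identity`). In
this form the covariance is a chain of beta integrals, and totality is the injectivity of two Abel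
operators.

Hence $K_H(t,\cdot)\mapsto B_H(t)$ extends to a linear isometry $I:L^2(0,T)\to L^2(\mathbb P)$ with
centered Gaussian values (`exists_isonormal_of_fracBrownian`). The images of the indicators of
$(0,t]$ have Brownian increments, and Kolmogorov's theorem gives a modification $B$ with Hölder
paths (`exists_brownian_of_isonormal`).

It remains to see that $\Lambda_HB(t)=I(K_H(t,\cdot))$ (`fracOp_ae_eq_isonormal`). No stochastic
integral is needed. Integrated over an event $A$, every $I(w)$ becomes $\langle w,g\rangle$ with
$g=I^*1_A$, so $B(s)$ becomes $\int_0^s g$ and the claim becomes deterministic. It is Fubini's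
theorem, because $\partial_sK_{H,1}\ge0$ integrates over $(0,u)$ to $K_{H,1}(t,u)$, and
$-\partial_sK_{H,2}\ge0$ integrates over $(u,t)$ to $K_{H,2}(t,u)$ (`integral_step_kernelDeriv`).
For continuous $B_H$, agreement on a countable dense set of times extends to all times.

Part (a) rests on homogeneity: $\partial_sK_{H,i}(t,tu)=t^{H-3/2}\partial_sK_{H,i}(1,u)$. On the
unit interval the Hölder condition supplies the factors $(1-u)^\lambda$ and $u^\lambda$, which make
the singularities of order $H-\frac32$ integrable since $\lambda>\frac12-H$. The bound follows at
once, and continuity by dominated convergence. -/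

/-- The truncated power `x₊ ^ a` on the real line, vanishing for `x ≤ 0`. -/
def posRpow (a x : ℝ) : ℝ := if 0 < x then x ^ a else 0

/-- The truncated power `x₊ ^ a` with values in `[0, ∞]`. -/
def posPow (a x : ℝ) : ENNReal := ENNReal.ofReal (posRpow a x)

lemma posRpow_nonneg (a x : ℝ) : 0 ≤ posRpow a x := by
  unfold posRpow; split_ifs with h
  · exact Real.rpow_nonneg h.le a
  · exact le_rfl

lemma posRpow_of_pos {a x : ℝ} (hx : 0 < x) : posRpow a x = x ^ a := if_pos hx

lemma posRpow_of_nonpos {a x : ℝ} (hx : x ≤ 0) : posRpow a x = 0 := if_neg hx.not_gt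

lemma posPow_of_pos {a x : ℝ} (hx : 0 < x) : posPow a x = ENNReal.ofReal (x ^ a) := by
  rw [posPow, posRpow_of_pos hx]

lemma posPow_of_nonpos {a x : ℝ} (hx : x ≤ 0) : posPow a x = 0 := by
  rw [posPow, posRpow_of_nonpos hx, ENNReal.ofReal_zero]

lemma posPow_ne_top (a x : ℝ) : posPow a x ≠ ⊤ := ENNReal.ofReal_ne_top

@[fun_prop]
lemma measurable_posRpow (a : ℝ) : Measurable (posRpow a) :=
  Measurable.ite measurableSet_Ioi (by fun_prop) (by fun_prop)

@[fun_prop]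
lemma measurable_posPow (a : ℝ) : Measurable (posPow a) :=
  (measurable_posRpow a).ennreal_ofReal

lemma posPow_mul_posPow (a b x : ℝ) : posPow a x * posPow b x = posPow (a + b) x := by
  rcases le_or_gt x 0 with h | h
  · simp [posPow_of_nonpos h]
  · rw [posPow_of_pos h, posPow_of_pos h, posPow_of_pos h,
      ← ENNReal.ofReal_mul (Real.rpow_nonneg h.le _), Real.rpow_add h]

lemma posPow_zero_of_pos {x : ℝ} (hx : 0 < x) : posPow 0 x = 1 := by
  simp [posPow_of_pos hx]

lemma beta_comm (a b : ℝ) : beta a b = beta b a := by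
  simp [beta, mul_comm, add_comm]

/-- Affine change of variables in the Lebesgue integral over the real line. -/
lemma lintegral_comp_affine (F : ℝ → ENNReal) (s : ℝ) {c : ℝ} (hc : c ≠ 0) :
    ∫⁻ r, F r = ENNReal.ofReal |c| * ∫⁻ v, F (s + c * v) := by
  have h := lintegral_image_eq_lintegral_abs_deriv_mul (s := univ) (f := fun v => s + c * v)
    (f' := fun _ => c) MeasurableSet.univ
    (fun x _ => by
      simpa using ((hasDerivAt_id x).const_mul c).const_add s)
    (fun x _ y _ hxy => by simpa [hc] using hxy) F
  have him : (fun v => s + c * v) '' univ = univ := by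
    rw [image_univ, range_eq_univ]
    intro y
    exact ⟨(y - s) / c, by field_simp; ring⟩
  rw [him] at h
  simp only [Measure.restrict_univ] at h
  rw [h, lintegral_const_mul']
  exact ENNReal.ofReal_ne_top

/-- This is the normalization of the beta density with parameters $(b,a)$: here $a$ belongs to $1-v$
and $b$ to $v$. -/
lemma lintegral_beta_unit {a b : ℝ} (ha : 0 < a) (hb : 0 < b) :
    ∫⁻ v, posPow (a - 1) (1 - v) * posPow (b - 1) v = ENNReal.ofReal (beta a b) := by
  have h1 := lintegral_betaPDF_eq_one hb ha
  have hB := beta_pos hb ha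
  have : ∀ v, posPow (a - 1) (1 - v) * posPow (b - 1) v
      = ENNReal.ofReal (beta b a) * betaPDF b a v := by
    intro v
    rw [betaPDF_eq]
    split_ifs with h
    · rw [posPow_of_pos (by linarith), posPow_of_pos h.1,
        ← ENNReal.ofReal_mul (Real.rpow_nonneg (by linarith) _), ← ENNReal.ofReal_mul hB.le]
      congr 1
      field_simp
    · rw [ENNReal.ofReal_zero, mul_zero]
      by_cases h0 : 0 < v
      · rw [posPow_of_nonpos (a := a - 1), zero_mul]
        by_contra h'
        exact h ⟨h0, by linarith⟩
      · rw [posPow_of_nonpos (a := b - 1) (not_lt.1 h0), mul_zero]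
  simp_rw [this]
  rw [lintegral_const_mul' _ _ ENNReal.ofReal_ne_top, h1, mul_one, beta_comm]

/-- Euler's beta integral over an arbitrary interval, as a convolution of truncated powers. -/
lemma lintegral_beta {a b : ℝ} (ha : 0 < a) (hb : 0 < b) (s t : ℝ) :
    ∫⁻ r, posPow (a - 1) (t - r) * posPow (b - 1) (r - s)
      = ENNReal.ofReal (beta a b) * posPow (a + b - 1) (t - s) := by
  rcases le_or_gt t s with h | h
  · rw [posPow_of_nonpos (x := t - s) (by linarith), mul_zero]
    have : ∀ r, posPow (a - 1) (t - r) * posPow (b - 1) (r - s) = 0 := by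
      intro r
      rcases le_or_gt t r with h' | h'
      · rw [posPow_of_nonpos (by linarith), zero_mul]
      · rw [posPow_of_nonpos (a := b - 1) (by linarith), mul_zero]
    simp [this]
  · have hc : 0 < t - s := by linarith
    rw [lintegral_comp_affine _ s hc.ne', ← lintegral_beta_unit ha hb]
    have : ∀ v, posPow (a - 1) (t - (s + (t - s) * v)) * posPow (b - 1) (s + (t - s) * v - s)
        = ENNReal.ofReal ((t - s) ^ (a + b - 2)) *
          (posPow (a - 1) (1 - v) * posPow (b - 1) v) := by
      intro v
      have e1 : t - (s + (t - s) * v) = (t - s) * (1 - v) := by ring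
      have e2 : s + (t - s) * v - s = (t - s) * v := by ring
      rw [e1, e2]
      rcases le_or_gt v 0 with hv | hv
      · rw [posPow_of_nonpos (a := b - 1) hv, posPow_of_nonpos (a := b - 1)
          (mul_nonpos_of_nonneg_of_nonpos hc.le hv)]
        simp
      rcases le_or_gt (1 - v) 0 with hv' | hv'
      · rw [posPow_of_nonpos (a := a - 1) hv', posPow_of_nonpos (a := a - 1)
          (mul_nonpos_of_nonneg_of_nonpos hc.le hv')]
        simp
      rw [posPow_of_pos hv, posPow_of_pos hv', posPow_of_pos (mul_pos hc hv),
        posPow_of_pos (mul_pos hc hv'), ← ENNReal.ofReal_mul (by positivity),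
        ← ENNReal.ofReal_mul (by positivity), ← ENNReal.ofReal_mul (by positivity),
        Real.mul_rpow hc.le hv.le, Real.mul_rpow hc.le hv'.le,
        show a + b - 2 = (a - 1) + (b - 1) by ring, Real.rpow_add hc]
      congr 1
      ring
    simp_rw [this]
    rw [lintegral_const_mul' _ _ ENNReal.ofReal_ne_top, ← mul_assoc, mul_comm, posPow_of_pos hc,
      abs_of_pos hc, ← ENNReal.ofReal_mul hc.le]
    congr 3
    rw [show a + b - 1 = 1 + (a + b - 2) by ring, Real.rpow_add hc, Real.rpow_one]

/-- The three-factor beta integral, in the case where the exponents add up to `-2`. -/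
lemma lintegral_beta_three {a b : ℝ} (ha : 0 < a) (hb : 0 < b) {r r' : ℝ} (hr : 0 < r)
    (hrr' : r < r') :
    ∫⁻ u, posPow (a - 1) u * posPow (b - 1) (r - u) * posPow (-(a + b)) (r' - u)
      = ENNReal.ofReal (beta a b) *
        ENNReal.ofReal (r ^ (a + b - 1) * (r' - r) ^ (-a) * r' ^ (-b)) := by
  have hd : 0 < r' - r := by linarith
  have hr' : 0 < r' := by linarith
  -- The Möbius map $w=u(r'-r)/(r'-u)$ fixes $0$ and $r$. Its Jacobian carries $(r'-u)^{-2}$ and the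
  -- powers of $w$ and $r-w$ carry $(r'-u)^{2-a-b}$; together they are the third factor, so a
  -- two-factor beta integral in $w$ remains.
  have hderiv : ∀ u ∈ Ioo 0 r, HasDerivWithinAt (fun u => u * (r' - r) / (r' - u))
      ((r' - r) * r' / (r' - u) ^ 2) (Ioo 0 r) u := by
    intro u hu
    have hu' : r' - u ≠ 0 := by have := hu.2; linarith
    have h := ((hasDerivAt_id u).mul_const (r' - r)).div ((hasDerivAt_id u).const_sub r') hu'
    refine (h.congr_deriv ?_).hasDerivWithinAt
    simp only [id]
    ring
  have hinj : InjOn (fun u => u * (r' - r) / (r' - u)) (Ioo 0 r) := by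
    intro x hx y hy hxy
    have hx' : r' - x ≠ 0 := by have := hx.2; linarith
    have hy' : r' - y ≠ 0 := by have := hy.2; linarith
    simp only at hxy
    rw [div_eq_div_iff hx' hy'] at hxy
    have : (r' - r) * r' * (x - y) = 0 := by linear_combination hxy
    have h0 : (r' - r) * r' ≠ 0 := by positivity
    have := (mul_eq_zero.1 this).resolve_left h0
    linarith
  have himg : (fun u => u * (r' - r) / (r' - u)) '' Ioo 0 r = Ioo 0 r := by
    ext w
    constructor
    · rintro ⟨u, hu, rfl⟩
      have hu' : 0 < r' - u := by have := hu.2; linarith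
      refine ⟨div_pos (mul_pos hu.1 hd) hu', ?_⟩
      simp only
      rw [div_lt_iff₀ hu']
      nlinarith [hu.2, hu.1]
    · intro hw
      have h1 : 0 < r' - r + w := by have := hw.1; linarith
      refine ⟨w * r' / (r' - r + w), ⟨div_pos (mul_pos hw.1 hr') h1, ?_⟩, ?_⟩
      · rw [div_lt_iff₀ h1]
        nlinarith [hw.2, hw.1]
      · simp only
        have h2 : r' - w * r' / (r' - r + w) = r' * (r' - r) / (r' - r + w) := by
          field_simp; ring
        rw [h2]
        field_simp
  have key := lintegral_image_eq_lintegral_abs_deriv_mul measurableSet_Ioo hderiv hinj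
    (fun w => posPow (a - 1) w * posPow (b - 1) (r - w))
  rw [himg] at key
  have hL : ∫⁻ w in Ioo 0 r, posPow (a - 1) w * posPow (b - 1) (r - w)
      = ENNReal.ofReal (beta a b) * ENNReal.ofReal (r ^ (a + b - 1)) := by
    have h := lintegral_beta hb ha 0 r
    simp only [sub_zero] at h
    rw [← posPow_of_pos hr, beta_comm, show a + b = b + a by ring, ← h,
      ← lintegral_indicator measurableSet_Ioo]
    congr 1; ext w
    by_cases hw : w ∈ Ioo 0 r
    · rw [indicator_of_mem hw, mul_comm]
    · rw [indicator_of_notMem hw]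
      by_cases h0 : 0 < w
      · rw [posPow_of_nonpos (x := r - w), zero_mul]
        by_contra h'
        exact hw ⟨h0, by linarith⟩
      · rw [posPow_of_nonpos (x := w) (not_lt.1 h0), mul_zero]
  have hR : ∫⁻ u, posPow (a - 1) u * posPow (b - 1) (r - u) * posPow (-(a + b)) (r' - u)
      = ENNReal.ofReal ((r' - r) ^ (-a) * r' ^ (-b)) *
      ∫⁻ u in Ioo 0 r, ENNReal.ofReal |(r' - r) * r' / (r' - u) ^ 2| *
        (posPow (a - 1) (u * (r' - r) / (r' - u)) *
          posPow (b - 1) (r - u * (r' - r) / (r' - u))) := by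
    rw [← lintegral_const_mul' _ _ ENNReal.ofReal_ne_top, ← lintegral_indicator measurableSet_Ioo]
    congr 1; ext u
    by_cases hu : u ∈ Ioo 0 r
    · rw [indicator_of_mem hu]
      have hu0 := hu.1
      have hur : 0 < r - u := by have := hu.2; linarith
      have hu' : 0 < r' - u := by have := hu.2; linarith
      have e1 : r - u * (r' - r) / (r' - u) = r' * (r - u) / (r' - u) := by
        field_simp; ring
      rw [e1, posPow_of_pos hu0, posPow_of_pos hur, posPow_of_pos hu', posPow_of_pos (by positivity),
        posPow_of_pos (by positivity), abs_of_pos (by positivity)]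
      rw [← ENNReal.ofReal_mul (by positivity), ← ENNReal.ofReal_mul (by positivity),
        ← ENNReal.ofReal_mul (by positivity), ← ENNReal.ofReal_mul (by positivity),
        ← ENNReal.ofReal_mul (by positivity)]
      congr 1
      rw [Real.div_rpow (by positivity) hu'.le, Real.div_rpow (by positivity) hu'.le,
        Real.mul_rpow hu0.le hd.le, Real.mul_rpow hr'.le hur.le,
        Real.rpow_neg hu'.le, Real.rpow_neg hd.le, Real.rpow_neg hr'.le, Real.rpow_add hu',
        Real.rpow_sub_one hu'.ne', Real.rpow_sub_one hu'.ne', Real.rpow_sub_one hd.ne',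
        Real.rpow_sub_one hr'.ne']
      field_simp
    · rw [indicator_of_notMem hu]
      by_cases h0 : 0 < u
      · rw [posPow_of_nonpos (x := r - u), mul_zero, zero_mul]
        by_contra h'
        exact hu ⟨h0, by linarith⟩
      · rw [posPow_of_nonpos (x := u) (not_lt.1 h0), zero_mul, zero_mul]
  rw [hR, ← key, hL, mul_comm, mul_assoc, ← ENNReal.ofReal_mul (by positivity), mul_assoc]

end

/-! ### The fractional-integral form of the kernel and its covariance. -/

noncomputable section

/-- The unnormalized Volterra kernel of fractional Brownian motion in its fractional-integral
form `s^{H-1/2} ∫ₛᵗ (t-r)^{2H-1} r^{1/2-H} (r-s)^{-1/2-H} dr`. -/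
def volterraE (H t s : ℝ) : ENNReal :=
  posPow (H - 1 / 2) s *
    ∫⁻ r, posPow (2 * H - 1) (t - r) * posPow (1 / 2 - H) r * posPow (-1 / 2 - H) (r - s)

@[fun_prop]
lemma measurable_volterraE (H t : ℝ) : Measurable (volterraE H t) := by
  unfold volterraE
  refine (measurable_posPow _).mul ?_
  exact Measurable.lintegral_prod_right' (f := fun p : ℝ × ℝ =>
    posPow (2 * H - 1) (t - p.2) * posPow (1 / 2 - H) p.2 * posPow (-1 / 2 - H) (p.2 - p.1))
    (by fun_prop)

/-- The exponents add up to $-2$, so `lintegral_beta_three` applies with $a=2H$, $b=\frac12-H$. The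
weight $u^{2H-1}$ is the square of the prefactor in `volterraE`, and the last sum is $|r-r'|^{-2H}$.
-/
lemma lintegral_posPow_three {H : ℝ} (hH0 : 0 < H) (hH1 : H < 1 / 2) {r r' : ℝ} (h : r ≠ r') :
    ∫⁻ u, posPow (2 * H - 1) u * posPow (-1 / 2 - H) (r - u) * posPow (-1 / 2 - H) (r' - u)
      = ENNReal.ofReal (beta (2 * H) (1 / 2 - H)) * (posPow (H - 1 / 2) r * posPow (H - 1 / 2) r' *
        (posPow (-(2 * H)) (r - r') + posPow (-(2 * H)) (r' - r))) := by
  wlog hlt : r < r' generalizing r r'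
  · rw [add_comm, mul_comm (posPow (H - 1 / 2) r), ← this h.symm (by grind)]
    simp only [mul_assoc]
    congr 1; ext u
    rw [mul_comm (posPow (-1 / 2 - H) (r - u))]
  rw [posPow_of_nonpos (x := r - r') (by linarith), zero_add]
  rcases le_or_gt r 0 with hr | hr
  · rw [posPow_of_nonpos hr]
    have : ∀ u, posPow (2 * H - 1) u * posPow (-1 / 2 - H) (r - u) * posPow (-1 / 2 - H) (r' - u)
        = 0 := by
      intro u
      rcases le_or_gt u 0 with hu | hu
      · rw [posPow_of_nonpos hu]; simp
      · rw [posPow_of_nonpos (x := r - u) (by linarith)]; simp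
    simp [this]
  · have := lintegral_beta_three (a := 2 * H) (b := 1 / 2 - H) (by linarith) (by linarith) hr hlt
    rw [show (1 / 2 - H - 1 : ℝ) = -1 / 2 - H by ring,
      show (-(2 * H + (1 / 2 - H)) : ℝ) = -1 / 2 - H by ring,
      show (2 * H + (1 / 2 - H) - 1 : ℝ) = H - 1 / 2 by ring,
      show (-(1 / 2 - H) : ℝ) = H - 1 / 2 by ring] at this
    have hr' := hr.trans hlt
    have hd : 0 < r' - r := by linarith
    rw [this, posPow_of_pos hr, posPow_of_pos hr', posPow_of_pos hd]
    congr 1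
    rw [← ENNReal.ofReal_mul (by positivity), ← ENNReal.ofReal_mul (by positivity)]
    congr 1
    ring

lemma beta_one_right {a : ℝ} (ha : 0 < a) : beta a 1 = 1 / a := by
  rw [beta, Real.Gamma_one, Real.Gamma_add_one ha.ne']
  have := (Real.Gamma_pos_of_pos ha).ne'
  field_simp

lemma lintegral_posPow_tail {a : ℝ} (ha : 0 < a) (s t : ℝ) :
    ∫⁻ r, posPow (a - 1) (t - r) * posPow 0 (r - s)
      = ENNReal.ofReal (1 / a) * posPow a (t - s) := by
  have := lintegral_beta ha one_pos s t
  rw [sub_self, beta_one_right ha, show a + 1 - 1 = a by ring] at this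
  exact this

lemma ae_ne_real (x : ℝ) : ∀ᵐ r : ℝ, r ≠ x := by
  simp [ae_iff]

/-- The double integral of `(t-r)^{a-1} (s-r')^{a-1} |r-r'|^{-a}` over `[0,t] × [0,s]`. -/
lemma lintegral_double_riesz {a : ℝ} (ha0 : 0 < a) (ha1 : a < 1) {s t : ℝ} (hs : 0 ≤ s)
    (hst : s ≤ t) :
    ∫⁻ r, ∫⁻ r', posPow (a - 1) (t - r) * posPow 0 r * (posPow (a - 1) (s - r') * posPow 0 r') *
        (posPow (-a) (r - r') + posPow (-a) (r' - r))
      = ENNReal.ofReal (beta a (1 - a)) *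
        ENNReal.ofReal ((s ^ a + t ^ a - (t - s) ^ a) / a) := by
  have hB : 0 ≤ beta a (1 - a) := (beta_pos ha0 (by linarith)).le
  have hbeta : ∀ x y, ∫⁻ r, posPow (a - 1) (x - r) * posPow (-a) (r - y)
      = ENNReal.ofReal (beta a (1 - a)) * posPow 0 (x - y) := by
    intro x y
    have := lintegral_beta (b := 1 - a) ha0 (by linarith) y x
    rwa [show 1 - a - 1 = -a by ring, show a + (1 - a) - 1 = 0 by ring] at this
  -- Where $x>y$, positivity of $y$ implies that of $x$. Dropping the cutoff at the larger variable
  -- turns the inner integral into a complete beta integral.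
  have hred : ∀ x y, posPow 0 x * posPow 0 y * posPow (-a) (x - y)
      = posPow 0 y * posPow (-a) (x - y) := by
    intro x y
    rcases le_or_gt x y with h | h
    · rw [posPow_of_nonpos (x := x - y) (by linarith)]; simp
    · rcases le_or_gt y 0 with h' | h'
      · rw [posPow_of_nonpos (x := y) h']; simp
      · rw [posPow_zero_of_pos (h'.trans h), one_mul]
  -- On $r'<r$, integrating the larger variable $r$ first gives a constant, which leaves
  -- $\int_0^s(s-r')^{a-1}dr'$.
  have h1 : ∫⁻ r, ∫⁻ r', posPow (a - 1) (t - r) * posPow 0 r *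
      (posPow (a - 1) (s - r') * posPow 0 r') * posPow (-a) (r - r')
      = ENNReal.ofReal (beta a (1 - a)) * ENNReal.ofReal (s ^ a / a) := by
    rw [lintegral_lintegral_swap (by fun_prop)]
    have : ∀ r', ∫⁻ r, posPow (a - 1) (t - r) * posPow 0 r *
      (posPow (a - 1) (s - r') * posPow 0 r') * posPow (-a) (r - r')
      = ENNReal.ofReal (beta a (1 - a)) * (posPow (a - 1) (s - r') * posPow 0 (r' - 0)) := by
      intro r'
      have : ∀ r, posPow (a - 1) (t - r) * posPow 0 r *
          (posPow (a - 1) (s - r') * posPow 0 r') * posPow (-a) (r - r')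
          = posPow (a - 1) (s - r') * posPow 0 r' *
            (posPow (a - 1) (t - r) * posPow (-a) (r - r')) := by
        intro r
        calc _ = posPow (a - 1) (t - r) * posPow (a - 1) (s - r') *
              (posPow 0 r * posPow 0 r' * posPow (-a) (r - r')) := by ring
          _ = _ := by rw [hred]; ring
      simp_rw [this]
      rw [lintegral_const_mul _ (by fun_prop), hbeta, sub_zero]
      rcases le_or_gt s r' with h | h
      · rw [posPow_of_nonpos (x := s - r') (by linarith)]; simp
      · rw [posPow_zero_of_pos (x := t - r') (by linarith)]; ring
    simp_rw [this]
    rw [lintegral_const_mul _ (by fun_prop), lintegral_posPow_tail ha0, sub_zero]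
    congr 1
    rcases hs.eq_or_lt with h | h
    · rw [← h, posPow_of_nonpos le_rfl, Real.zero_rpow ha0.ne']; simp
    · rw [posPow_of_pos h, ← ENNReal.ofReal_mul (by positivity)]
      congr 1
      ring
  -- On $r<r'$, integrating $r'$ first gives a constant for $r<s$, which leaves
  -- $\int_0^s(t-r)^{a-1}dr$.
  have h2 : ∫⁻ r, ∫⁻ r', posPow (a - 1) (t - r) * posPow 0 r *
      (posPow (a - 1) (s - r') * posPow 0 r') * posPow (-a) (r' - r)
      = ENNReal.ofReal (beta a (1 - a)) * ENNReal.ofReal ((t ^ a - (t - s) ^ a) / a) := by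
    have : ∀ r, ∫⁻ r', posPow (a - 1) (t - r) * posPow 0 r *
      (posPow (a - 1) (s - r') * posPow 0 r') * posPow (-a) (r' - r)
      = ENNReal.ofReal (beta a (1 - a)) *
        (posPow (a - 1) (t - r) * posPow 0 r * posPow 0 (s - r)) := by
      intro r
      have : ∀ r', posPow (a - 1) (t - r) * posPow 0 r *
          (posPow (a - 1) (s - r') * posPow 0 r') * posPow (-a) (r' - r)
          = posPow (a - 1) (t - r) * posPow 0 r *
            (posPow (a - 1) (s - r') * posPow (-a) (r' - r)) := by
        intro r'
        calc _ = posPow (a - 1) (t - r) * posPow (a - 1) (s - r') *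
              (posPow 0 r' * posPow 0 r * posPow (-a) (r' - r)) := by ring
          _ = _ := by rw [hred]; ring
      simp_rw [this]
      rw [lintegral_const_mul _ (by fun_prop), hbeta]
      ring
    simp_rw [this]
    rw [lintegral_const_mul _ (by fun_prop)]
    congr 1
    have hadd : (∫⁻ r, posPow (a - 1) (t - r) * posPow 0 r * posPow 0 (s - r))
        + ENNReal.ofReal ((t - s) ^ a / a) = ENNReal.ofReal (t ^ a / a) := by
      have e : ∀ x : ℝ, 0 ≤ x → ENNReal.ofReal (1 / a) * posPow a x
          = ENNReal.ofReal (x ^ a / a) := by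
        intro x hx
        rcases hx.eq_or_lt with h | h
        · rw [← h, posPow_of_nonpos le_rfl, Real.zero_rpow ha0.ne']; simp
        · rw [posPow_of_pos h, ← ENNReal.ofReal_mul (by positivity)]
          congr 1
          ring
      have e1 := lintegral_posPow_tail ha0 s t
      have e2 := lintegral_posPow_tail ha0 0 t
      rw [sub_zero, e _ (hs.trans hst)] at e2
      rw [e _ (by linarith)] at e1
      rw [← e1, ← e2, ← lintegral_add_right _ (by fun_prop)]
      refine lintegral_congr_ae ?_
      filter_upwards [ae_ne_real s] with r hr
      rw [sub_zero]
      rcases lt_or_gt_of_ne hr with h | h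
      · rw [posPow_zero_of_pos (x := s - r) (by linarith), posPow_of_nonpos (x := r - s) (by linarith)]
        simp
      · rw [posPow_zero_of_pos (x := r - s) (by linarith), posPow_of_nonpos (x := s - r) (by linarith),
          posPow_zero_of_pos (x := r) (by linarith)]
        simp
    have h3 : 0 ≤ (t - s) ^ a / a := div_nonneg (Real.rpow_nonneg (by linarith) _) ha0.le
    rw [sub_div, ENNReal.ofReal_sub _ h3, ← hadd, ENNReal.add_sub_cancel_right ENNReal.ofReal_ne_top]
  simp_rw [mul_add]
  have hm : ∀ r, ∫⁻ r', posPow (a - 1) (t - r) * posPow 0 r *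
      (posPow (a - 1) (s - r') * posPow 0 r') * posPow (-a) (r - r') +
      posPow (a - 1) (t - r) * posPow 0 r *
      (posPow (a - 1) (s - r') * posPow 0 r') * posPow (-a) (r' - r)
      = (∫⁻ r', posPow (a - 1) (t - r) * posPow 0 r *
      (posPow (a - 1) (s - r') * posPow 0 r') * posPow (-a) (r - r')) +
      ∫⁻ r', posPow (a - 1) (t - r) * posPow 0 r *
      (posPow (a - 1) (s - r') * posPow 0 r') * posPow (-a) (r' - r) := by
    intro r
    exact lintegral_add_left (by fun_prop) _
  simp_rw [hm]
  rw [lintegral_add_left, h1, h2, ← mul_add, ← ENNReal.ofReal_add]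
  · congr 2; ring
  · positivity
  · refine div_nonneg (sub_nonneg.2 (Real.rpow_le_rpow (by linarith) (by linarith) ha0.le)) ha0.le
  · exact Measurable.lintegral_prod_right' (f := fun p : ℝ × ℝ =>
      posPow (a - 1) (t - p.1) * posPow 0 p.1 *
      (posPow (a - 1) (s - p.2) * posPow 0 p.2) * posPow (-a) (p.1 - p.2)) (by fun_prop)

/-- The kernel `volterraE` reproduces the covariance of fractional Brownian motion. -/
lemma lintegral_volterraE_mul {H : ℝ} (hH0 : 0 < H) (hH1 : H < 1 / 2) {s t : ℝ} (hs : 0 ≤ s)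
    (ht : 0 ≤ t) :
    ∫⁻ u, volterraE H t u * volterraE H s u
      = ENNReal.ofReal (beta (2 * H) (1 / 2 - H)) * (ENNReal.ofReal (beta (2 * H) (1 - 2 * H)) *
        ENNReal.ofReal ((s ^ (2 * H) + t ^ (2 * H) - |t - s| ^ (2 * H)) / (2 * H))) := by
  wlog hst : s ≤ t generalizing s t
  · simp_rw [mul_comm (volterraE H t _)]
    rw [this ht hs (by linarith), abs_sub_comm, add_comm (t ^ (2 * H))]
  rw [abs_of_nonneg (by linarith), ← lintegral_double_riesz (by linarith) (by linarith) hs hst]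
  set A : ℝ → ℝ → ENNReal := fun t r => posPow (2 * H - 1) (t - r) * posPow (1 / 2 - H) r with hA
  have hAm : ∀ t, Measurable (A t) := fun t => by simp only [hA]; fun_prop
  -- Everything is nonnegative, so the product becomes a triple integral in which $u$ may be
  -- integrated first by Tonelli.
  have hexp : ∀ u, volterraE H t u * volterraE H s u = ∫⁻ r, ∫⁻ r', A t r * A s r' *
      (posPow (2 * H - 1) u * posPow (-1 / 2 - H) (r - u) * posPow (-1 / 2 - H) (r' - u)) := by
    intro u
    have : ∀ r, ∫⁻ r', A t r * A s r' *
      (posPow (2 * H - 1) u * posPow (-1 / 2 - H) (r - u) * posPow (-1 / 2 - H) (r' - u))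
      = posPow (2 * H - 1) u * (A t r * posPow (-1 / 2 - H) (r - u)) *
        ∫⁻ r', A s r' * posPow (-1 / 2 - H) (r' - u) := by
      intro r
      rw [← lintegral_const_mul _ (by fun_prop)]
      congr 1; ext r'; ring
    simp_rw [this]
    have e : posPow (2 * H - 1) u = posPow (H - 1 / 2) u * posPow (H - 1 / 2) u := by
      rw [posPow_mul_posPow]; congr 1; ring
    rw [lintegral_mul_const _ (by fun_prop), lintegral_const_mul _ (by fun_prop), e]
    simp only [volterraE, hA]
    ring
  simp_rw [hexp]
  rw [lintegral_lintegral_swap]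
  swap
  · refine Measurable.aemeasurable ?_
    exact Measurable.lintegral_prod_right' (f := fun p : (ℝ × ℝ) × ℝ => A t p.1.2 * A s p.2 *
      (posPow (2 * H - 1) p.1.1 * posPow (-1 / 2 - H) (p.1.2 - p.1.1) *
        posPow (-1 / 2 - H) (p.2 - p.1.1))) (by fun_prop)
  rw [← lintegral_const_mul]
  swap
  · exact Measurable.lintegral_prod_right' (f := fun p : ℝ × ℝ =>
      posPow (2 * H - 1) (t - p.1) * posPow 0 p.1 *
      (posPow (2 * H - 1) (s - p.2) * posPow 0 p.2) *
        (posPow (-(2 * H)) (p.1 - p.2) + posPow (-(2 * H)) (p.2 - p.1))) (by fun_prop)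
  congr 1; ext r
  rw [lintegral_lintegral_swap (by fun_prop), ← lintegral_const_mul _ (by fun_prop)]
  refine lintegral_congr_ae ?_
  filter_upwards [ae_ne_real r] with r' hr'
  rw [lintegral_const_mul _ (by fun_prop), lintegral_posPow_three hH0 hH1 hr'.symm]
  -- The weights $r^{1/2-H}$ in the kernel cancel the powers $r^{H-1/2}$ produced by the
  -- $u$-integral; only the cutoff survives, and the Riesz double integral remains.
  have h0 : ∀ x, posPow 0 x = posPow (1 / 2 - H) x * posPow (H - 1 / 2) x := by
    intro x; rw [posPow_mul_posPow]; congr 1; ring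
  rw [h0 r, h0 r']
  simp only [hA]
  ring

end

/-! ### Beta weights and parameter integrals over the unit interval. -/

noncomputable section
/-- The unnormalized beta density `(1 - v)^{a-1} v^{b-1}` on `(0,1)`, extended by zero. -/
def betaWeight (a b v : ℝ) : ℝ := posRpow (a - 1) (1 - v) * posRpow (b - 1) v

lemma betaWeight_nonneg (a b v : ℝ) : 0 ≤ betaWeight a b v :=
  mul_nonneg (posRpow_nonneg _ _) (posRpow_nonneg _ _)

lemma betaWeight_eq_zero {a b v : ℝ} (hv : v ∉ Ioo (0 : ℝ) 1) : betaWeight a b v = 0 := by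
  unfold betaWeight
  by_cases h0 : 0 < v
  · rw [posRpow_of_nonpos (x := 1 - v), zero_mul]
    by_contra h'
    exact hv ⟨h0, by linarith⟩
  · rw [posRpow_of_nonpos (x := v) (not_lt.1 h0), mul_zero]

@[fun_prop]
lemma measurable_betaWeight (a b : ℝ) : Measurable (betaWeight a b) := by
  unfold betaWeight; fun_prop

lemma ofReal_betaWeight (a b v : ℝ) :
    ENNReal.ofReal (betaWeight a b v) = posPow (a - 1) (1 - v) * posPow (b - 1) v := by
  rw [betaWeight, ENNReal.ofReal_mul (posRpow_nonneg _ _), posPow, posPow]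

lemma lintegral_betaWeight {a b : ℝ} (ha : 0 < a) (hb : 0 < b) :
    ∫⁻ v, ENNReal.ofReal (betaWeight a b v) = ENNReal.ofReal (beta a b) := by
  simp_rw [ofReal_betaWeight]
  exact lintegral_beta_unit ha hb

lemma integrable_betaWeight {a b : ℝ} (ha : 0 < a) (hb : 0 < b) :
    Integrable (betaWeight a b) := by
  refine ⟨(measurable_betaWeight a b).aestronglyMeasurable, ?_⟩
  rw [hasFiniteIntegral_iff_ofReal (.of_forall (betaWeight_nonneg a b)), lintegral_betaWeight ha hb]
  exact ENNReal.ofReal_lt_top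

lemma integral_betaWeight {a b : ℝ} (ha : 0 < a) (hb : 0 < b) :
    ∫ v, betaWeight a b v = beta a b := by
  rw [integral_eq_lintegral_of_nonneg_ae (.of_forall (betaWeight_nonneg a b))
    (measurable_betaWeight a b).aestronglyMeasurable, lintegral_betaWeight ha hb,
    ENNReal.toReal_ofReal (beta_pos ha hb).le]

lemma integrable_betaWeight_mul {a b : ℝ} (ha : 0 < a) (hb : 0 < b) {q : ℝ → ℝ}
    (hq : Measurable q) {C : ℝ} (hC : ∀ v ∈ Ioo (0 : ℝ) 1, |q v| ≤ C) :
    Integrable (fun v => betaWeight a b v * q v) := by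
  refine ((integrable_betaWeight ha hb).mul_const C).mono'
    ((measurable_betaWeight a b).mul hq).aestronglyMeasurable (.of_forall fun v => ?_)
  by_cases hv : v ∈ Ioo (0 : ℝ) 1
  · rw [Real.norm_eq_abs, abs_mul, abs_of_nonneg (betaWeight_nonneg a b v)]
    exact mul_le_mul_of_nonneg_left (hC v hv) (betaWeight_nonneg a b v)
  · simp [betaWeight_eq_zero hv]

/-- The integral of a beta weight against a power of an affine function, in the case where the
exponents add up to `-2`. -/
lemma integral_betaWeight_affine {a b s x : ℝ} (ha : 0 < a) (hb : 0 < b) (hs : 0 < s)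
    (hx : 0 < x) :
    ∫ v, betaWeight a b v * (s + x * v) ^ (-(a + b)) = beta a b * (s + x) ^ (-b) * s ^ (-a) := by
  -- After the reflection $v=1-u$ one has $s+xv=x\left(\frac{s+x}{x}-u\right)$, which dictates $r=1$
  -- and $r'=(s+x)/x$.
  have h3 := lintegral_beta_three ha hb (r := 1) (r' := (s + x) / x) one_pos
    (by rw [lt_div_iff₀ hx]; linarith)
  have hrefl : ∫⁻ v, ENNReal.ofReal (betaWeight a b v * (s + x * v) ^ (-(a + b)))
      = ENNReal.ofReal (x ^ (-(a + b))) * ∫⁻ u, posPow (a - 1) u * posPow (b - 1) (1 - u) *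
        posPow (-(a + b)) ((s + x) / x - u) := by
    rw [lintegral_comp_affine _ 1 (c := -1) (by norm_num)]
    simp only [abs_neg, abs_one, ENNReal.ofReal_one, one_mul]
    rw [← lintegral_const_mul' _ _ ENNReal.ofReal_ne_top]
    refine lintegral_congr fun u => ?_
    by_cases hu : u ∈ Ioo (0 : ℝ) 1
    · have hu0 := hu.1
      have hu1 : 0 < 1 - u := by have := hu.2; linarith
      have hp : 0 < (s + x) / x - u := by
        rw [sub_pos, lt_div_iff₀ hx]; nlinarith
      have e : s + x * (1 + -1 * u) = x * ((s + x) / x - u) := by field_simp; ring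
      rw [e, Real.mul_rpow hx.le hp.le, ENNReal.ofReal_mul (betaWeight_nonneg _ _ _),
        ofReal_betaWeight, posPow_of_pos hp, ENNReal.ofReal_mul (by positivity)]
      ring_nf
    · rw [betaWeight_eq_zero (fun h => hu ⟨by linarith [h.2], by linarith [h.1]⟩)]
      simp only [zero_mul, ENNReal.ofReal_zero]
      by_cases h0 : 0 < u
      · rw [posPow_of_nonpos (x := 1 - u)]
        · simp
        · by_contra h'
          exact hu ⟨h0, by linarith⟩
      · rw [posPow_of_nonpos (x := u) (not_lt.1 h0)]
        simp
  rw [integral_eq_lintegral_of_nonneg_ae, hrefl, h3]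
  · have hB := beta_pos ha hb
    have hsx : 0 < s + x := by linarith
    have e : (s + x) / x - 1 = s / x := by field_simp; ring
    rw [← ENNReal.ofReal_mul hB.le, ← ENNReal.ofReal_mul (by positivity), e,
      ENNReal.toReal_ofReal (by positivity), Real.one_rpow, Real.div_rpow hs.le hx.le,
      Real.div_rpow hsx.le hx.le, neg_add, Real.rpow_add hx]
    have := Real.rpow_pos_of_pos hx (-a)
    have := Real.rpow_pos_of_pos hx (-b)
    field_simp
  · refine .of_forall fun v => ?_
    by_cases hv : v ∈ Ioo (0 : ℝ) 1
    · have := hv.1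
      exact mul_nonneg (betaWeight_nonneg _ _ _) (by positivity)
    · simp [betaWeight_eq_zero hv]
  · exact Measurable.aestronglyMeasurable (by fun_prop)

/-- The fractional-integral kernel after the substitution `r = s + (t - s) v`. -/
lemma volterraE_eq_integral {H : ℝ} (hH0 : 0 < H) (hH1 : H < 1 / 2) {s t : ℝ} (hs : 0 < s)
    (hst : s < t) :
    volterraE H t s = ENNReal.ofReal (s ^ (H - 1 / 2) * ((t - s) ^ (H - 1 / 2) *
      ∫ v, betaWeight (2 * H) (1 / 2 - H) v * (s + (t - s) * v) ^ (1 / 2 - H))) := by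
  have hx : 0 < t - s := by linarith
  have hnn : ∀ v, 0 ≤ betaWeight (2 * H) (1 / 2 - H) v * (s + (t - s) * v) ^ (1 / 2 - H) := by
    intro v
    by_cases hv : v ∈ Ioo (0 : ℝ) 1
    · have := hv.1
      exact mul_nonneg (betaWeight_nonneg _ _ _) (by positivity)
    · simp [betaWeight_eq_zero hv]
  have hint : Integrable
      (fun v => betaWeight (2 * H) (1 / 2 - H) v * (s + (t - s) * v) ^ (1 / 2 - H)) := by
    refine integrable_betaWeight_mul (by linarith) (by linarith) (by fun_prop)
      (C := t ^ (1 / 2 - H)) fun v hv => ?_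
    have h0 : 0 ≤ s + (t - s) * v := by have := hv.1; positivity
    rw [abs_of_nonneg (Real.rpow_nonneg h0 _)]
    exact Real.rpow_le_rpow h0 (by nlinarith [hv.2]) (by linarith)
  rw [volterraE, posPow_of_pos hs, ENNReal.ofReal_mul (by positivity),
    ENNReal.ofReal_mul (by positivity), ofReal_integral_eq_lintegral_ofReal hint (.of_forall hnn),
    lintegral_comp_affine _ s hx.ne', abs_of_pos hx]
  congr 1
  rw [← lintegral_const_mul' _ _ ENNReal.ofReal_ne_top,
    ← lintegral_const_mul' _ _ ENNReal.ofReal_ne_top]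
  refine lintegral_congr fun v => ?_
  by_cases hv : v ∈ Ioo (0 : ℝ) 1
  · have hv0 := hv.1
    have hv1 : 0 < 1 - v := by have := hv.2; linarith
    have h0 : 0 < s + (t - s) * v := by positivity
    have e1 : t - (s + (t - s) * v) = (t - s) * (1 - v) := by ring
    have e2 : s + (t - s) * v - s = (t - s) * v := by ring
    rw [e1, e2, betaWeight, posRpow_of_pos hv0, posRpow_of_pos hv1, posPow_of_pos h0,
      posPow_of_pos (by positivity), posPow_of_pos (by positivity),
      ← ENNReal.ofReal_mul (by positivity), ← ENNReal.ofReal_mul (by positivity),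
      ← ENNReal.ofReal_mul (by positivity), ← ENNReal.ofReal_mul (by positivity),
      Real.mul_rpow hx.le hv1.le, Real.mul_rpow hx.le hv0.le]
    congr 1
    rw [show (1 / 2 - H - 1 : ℝ) = -1 / 2 - H by ring]
    -- The bare factor $t-s$ is the Jacobian of the substitution.
    have : (t - s) ^ (H - 1 / 2) = (t - s) * (t - s) ^ (2 * H - 1) * (t - s) ^ (-1 / 2 - H) := by
      nth_rw 2 [← Real.rpow_one (t - s)]
      rw [← Real.rpow_add hx, ← Real.rpow_add hx]
      congr 1
      ring
    rw [this]
    ring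
  · rw [betaWeight_eq_zero hv]
    simp only [zero_mul, ENNReal.ofReal_zero, mul_zero]
    have : posPow (2 * H - 1) (t - (s + (t - s) * v)) * posPow (-1 / 2 - H) (s + (t - s) * v - s)
        = 0 := by
      by_cases h0 : 0 < v
      · have h1 : 1 ≤ v := by
          by_contra h'
          exact hv ⟨h0, by linarith⟩
        rw [posPow_of_nonpos, zero_mul]
        nlinarith
      · rw [posPow_of_nonpos (a := -1 / 2 - H), mul_zero]
        nlinarith
    rw [mul_right_comm, this]
    simp

/-- Differentiation under the integral. The case $x=0$ is included because `volterra_identity` needs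
differentiability at the diagonal $t=s$. -/
lemma hasDerivAt_integral_betaWeight {H : ℝ} (hH0 : 0 < H) (hH1 : H < 1 / 2) {s x : ℝ}
    (hs : 0 < s) (hx : 0 ≤ x) :
    HasDerivAt (fun x => ∫ v, betaWeight (2 * H) (1 / 2 - H) v * (s + x * v) ^ (1 / 2 - H))
      (∫ v, betaWeight (2 * H) (1 / 2 - H) v *
        ((1 / 2 - H) * (s + x * v) ^ (-1 / 2 - H) * v)) x := by
  -- For $y>-s/2$ and $v\in(0,1)$ the base $s+yv$ stays above $s/2$, so the negative power in the
  -- derivative is bounded uniformly.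
  have hball : Ioi (-(s / 2)) ∈ nhds x := Ioi_mem_nhds (by linarith)
  have hlow : ∀ y ∈ Ioi (-(s / 2)), ∀ v ∈ Ioo (0 : ℝ) 1, s / 2 ≤ s + y * v := by
    intro y hy v hv
    have hy' : -(s / 2) < y := hy
    nlinarith [hv.1, hv.2]
  refine (hasDerivAt_integral_of_dominated_loc_of_deriv_le
    (F := fun x v => betaWeight (2 * H) (1 / 2 - H) v * (s + x * v) ^ (1 / 2 - H))
    (F' := fun x v => betaWeight (2 * H) (1 / 2 - H) v *
        ((1 / 2 - H) * (s + x * v) ^ (-1 / 2 - H) * v))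
    (bound := fun v => betaWeight (2 * H) (1 / 2 - H) v *
      ((1 / 2 - H) * (s / 2) ^ (-1 / 2 - H))) hball ?_ ?_ ?_ ?_ ?_ ?_).2
  · exact .of_forall fun x => Measurable.aestronglyMeasurable (by fun_prop)
  · refine integrable_betaWeight_mul (by linarith) (by linarith) (by fun_prop)
      (C := (s + x) ^ (1 / 2 - H)) fun v hv => ?_
    have h0 : 0 ≤ s + x * v := by have := hv.1; positivity
    rw [abs_of_nonneg (Real.rpow_nonneg h0 _)]
    exact Real.rpow_le_rpow h0 (by nlinarith [hv.2]) (by linarith)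
  · exact Measurable.aestronglyMeasurable (by fun_prop)
  · refine .of_forall fun v y hy => ?_
    by_cases hv : v ∈ Ioo (0 : ℝ) 1
    · have h1 := hlow y hy v hv
      have h2 : 0 < s / 2 := by linarith
      rw [Real.norm_eq_abs, abs_mul, abs_of_nonneg (betaWeight_nonneg _ _ v)]
      refine mul_le_mul_of_nonneg_left ?_ (betaWeight_nonneg _ _ v)
      have h3 : (s + y * v) ^ (-1 / 2 - H) ≤ (s / 2) ^ (-1 / 2 - H) :=
        Real.rpow_le_rpow_of_nonpos h2 h1 (by linarith)
      have h4 : 0 ≤ (s + y * v) ^ (-1 / 2 - H) := Real.rpow_nonneg (by linarith) _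
      have h5 : 0 ≤ 1 / 2 - H := by linarith
      rw [abs_of_nonneg (mul_nonneg (mul_nonneg h5 h4) hv.1.le)]
      calc (1 / 2 - H) * (s + y * v) ^ (-1 / 2 - H) * v
          ≤ (1 / 2 - H) * (s + y * v) ^ (-1 / 2 - H) * 1 :=
            mul_le_mul_of_nonneg_left hv.2.le (mul_nonneg h5 h4)
        _ ≤ _ := by rw [mul_one]; exact mul_le_mul_of_nonneg_left h3 h5
    · simp [betaWeight_eq_zero hv]
  · exact (integrable_betaWeight (by linarith) (by linarith)).mul_const _
  · refine .of_forall fun v y hy => ?_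
    by_cases hv : v ∈ Ioo (0 : ℝ) 1
    · have h1 := hlow y hy v hv
      have h2 : s + y * v ≠ 0 := by linarith
      have h := ((((hasDerivAt_id y).mul_const v).const_add s).rpow_const (p := 1 / 2 - H)
        (.inl h2)).const_mul (betaWeight (2 * H) (1 / 2 - H) v)
      refine h.congr_deriv ?_
      simp only [id]
      rw [show (1 / 2 - H - 1 : ℝ) = -1 / 2 - H by ring]
      ring
    · simp only [betaWeight_eq_zero hv, zero_mul]
      exact hasDerivAt_const _ _

end

/-! ### Equality of the two forms of the kernel, and the covariance factorization. -/

noncomputable section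

lemma intervalIntegrable_kernelTwo_integrand {H : ℝ} (hH0 : 0 < H) {s t : ℝ} (hs : 0 < s)
    (hst : s ≤ t) :
    IntervalIntegrable (fun u : ℝ => u ^ (H - 3 / 2) * (u - s) ^ (H - 1 / 2)) volume s t := by
  refine IntervalIntegrable.continuousOn_mul ?_ ?_
  · have h := (intervalIntegral.intervalIntegrable_rpow' (a := 0) (b := t - s)
      (r := H - 1 / 2) (by linarith)).comp_sub_right s
    simpa using h
  · intro u hu
    rw [uIcc_of_le hst] at hu
    exact (Real.continuousAt_rpow_const u _ (.inl (by linarith [hu.1]))).continuousWithinAt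

lemma hasDerivAt_integral_kernelTwo {H : ℝ} (hH0 : 0 < H) {s t : ℝ} (hs : 0 < s)
    (hst : s < t) :
    HasDerivAt (fun t => ∫ u in s..t, u ^ (H - 3 / 2) * (u - s) ^ (H - 1 / 2))
      (t ^ (H - 3 / 2) * (t - s) ^ (H - 1 / 2)) t := by
  refine intervalIntegral.integral_hasDerivAt_right
    (intervalIntegrable_kernelTwo_integrand hH0 hs hst.le) ?_ ?_
  · exact (Measurable.stronglyMeasurable (by fun_prop)).stronglyMeasurableAtFilter
  · refine (Real.continuousAt_rpow_const t _ (.inl (by linarith))).mul ?_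
    exact ContinuousAt.rpow_const (by fun_prop) (.inl (by linarith))

lemma tendsto_integral_kernelTwo {H : ℝ} (hH0 : 0 < H) {s : ℝ} (hs : 0 < s) :
    Filter.Tendsto (fun t => ∫ u in s..t, u ^ (H - 3 / 2) * (u - s) ^ (H - 1 / 2))
      (nhdsWithin s (Ioi s)) (nhds 0) := by
  have h := intervalIntegral.continuousOn_primitive_interval
    (μ := volume) (f := fun u : ℝ => u ^ (H - 3 / 2) * (u - s) ^ (H - 1 / 2)) (a := s) (b := s + 1)
    (by
      rw [uIcc_of_le (by linarith), ← intervalIntegrable_iff_integrableOn_Icc_of_le (by linarith)]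
      exact intervalIntegrable_kernelTwo_integrand hH0 hs (by linarith))
  have h1 := h s left_mem_uIcc
  rw [uIcc_of_le (by linarith)] at h1
  have h2 : Filter.Tendsto (fun t => ∫ u in s..t, u ^ (H - 3 / 2) * (u - s) ^ (H - 1 / 2))
      (nhdsWithin s (Icc s (s + 1))) (nhds 0) := by
    simpa [ContinuousWithinAt] using h1
  refine h2.mono_left ?_
  rw [← nhdsWithin_Ioo_eq_nhdsGT (show s < s + 1 by linarith)]
  exact nhdsWithin_mono _ Ioo_subset_Icc_self

/-- The Volterra kernel in its fractional-integral form, up to normalization. -/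
lemma volterra_identity {H : ℝ} (hH0 : 0 < H) (hH1 : H < 1 / 2) {s t : ℝ} (hs : 0 < s)
    (hst : s < t) :
    beta (2 * H) (1 / 2 - H) * (t ^ (H - 1 / 2) * s ^ (1 / 2 - H) * (t - s) ^ (H - 1 / 2) +
      (1 / 2 - H) * s ^ (1 / 2 - H) * ∫ u in s..t, u ^ (H - 3 / 2) * (u - s) ^ (H - 1 / 2))
    = s ^ (H - 1 / 2) * ((t - s) ^ (H - 1 / 2) *
      ∫ v, betaWeight (2 * H) (1 / 2 - H) v * (s + (t - s) * v) ^ (1 / 2 - H)) := by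
  set β := beta (2 * H) (1 / 2 - H) with hβ
  set N : ℝ → ℝ := fun x => ∫ v, betaWeight (2 * H) (1 / 2 - H) v * (s + x * v) ^ (1 / 2 - H)
    with hN
  set J : ℝ → ℝ := fun t => ∫ u in s..t, u ^ (H - 3 / 2) * (u - s) ^ (H - 1 / 2) with hJ
  -- The difference of the two sides as a function of $t$: its derivative vanishes on $(s,\infty)$
  -- and its limit at $s+$ is zero.
  set D : ℝ → ℝ := fun t => β * (t ^ (H - 1 / 2) * s ^ (1 / 2 - H) * (t - s) ^ (H - 1 / 2) +
      (1 / 2 - H) * s ^ (1 / 2 - H) * J t) - s ^ (H - 1 / 2) * ((t - s) ^ (H - 1 / 2) * N (t - s))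
    with hD
  have hDderiv : ∀ t, s < t → HasDerivAt D 0 t := by
    intro t hst
    have ht : 0 < t := hs.trans hst
    have hx : 0 < t - s := by linarith
    have hN' : HasDerivAt (fun t => N (t - s)) _ t :=
      (hasDerivAt_integral_betaWeight hH0 hH1 hs hx.le).comp_sub_const t s
    have hJ' := hasDerivAt_integral_kernelTwo hH0 hs hst
    have hp1 : HasDerivAt (fun t : ℝ => t ^ (H - 1 / 2)) _ t :=
      (hasDerivAt_id t).rpow_const (p := H - 1 / 2) (.inl ht.ne')
    have hp2 : HasDerivAt (fun t : ℝ => (t - s) ^ (H - 1 / 2)) _ t :=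
      ((hasDerivAt_id t).sub_const s).rpow_const (p := H - 1 / 2) (.inl hx.ne')
    have h := ((((hp1.mul_const (s ^ (1 / 2 - H))).mul hp2).add
      (hJ'.const_mul ((1 / 2 - H) * s ^ (1 / 2 - H)))).const_mul β).sub
      ((hp2.mul hN').const_mul (s ^ (H - 1 / 2)))
    refine h.congr_deriv ?_
    simp only [id]
    have hM := integral_betaWeight_affine (a := 2 * H) (b := 1 / 2 - H) (x := t - s)
      (by linarith) (by linarith) hs hx
    rw [show (-(2 * H + (1 / 2 - H)) : ℝ) = -1 / 2 - H by ring] at hM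
    have hb : ∀ p : ℝ, ∃ C, ∀ v ∈ Ioo (0 : ℝ) 1, |(s + (t - s) * v) ^ p| ≤ C := by
      intro p
      refine ⟨s ^ p + t ^ p, fun v hv => ?_⟩
      have h0 : s ≤ s + (t - s) * v := by nlinarith [hv.1]
      have h1 : s + (t - s) * v ≤ t := by nlinarith [hv.2]
      have h2 : 0 < s + (t - s) * v := by linarith
      rw [abs_of_nonneg (Real.rpow_nonneg h2.le _)]
      rcases le_or_gt 0 p with hp | hp
      · have := Real.rpow_le_rpow h2.le h1 hp
        have := Real.rpow_nonneg hs.le p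
        linarith
      · have := Real.rpow_le_rpow_of_nonpos hs h0 hp.le
        have := Real.rpow_nonneg ht.le p
        linarith
    have hI1 : Integrable (fun v => betaWeight (2 * H) (1 / 2 - H) v *
        (s + (t - s) * v) ^ (1 / 2 - H)) := by
      obtain ⟨C, hC⟩ := hb (1 / 2 - H)
      exact integrable_betaWeight_mul (by linarith) (by linarith) (by fun_prop) hC
    have hI2 : Integrable (fun v => betaWeight (2 * H) (1 / 2 - H) v *
        (s + (t - s) * v) ^ (-1 / 2 - H)) := by
      obtain ⟨C, hC⟩ := hb (-1 / 2 - H)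
      exact integrable_betaWeight_mul (by linarith) (by linarith) (by fun_prop) hC
    -- Writing $(t-s)v=(s+(t-s)v)-s$ expresses the derivative of `N` through `N` itself and the
    -- integral evaluated in closed form by `integral_betaWeight_affine`.
    have hcomb : (t - s) * (∫ v, betaWeight (2 * H) (1 / 2 - H) v *
        ((1 / 2 - H) * (s + (t - s) * v) ^ (-1 / 2 - H) * v))
        = (1 / 2 - H) * (N (t - s) - s * (β * t ^ (H - 1 / 2) * s ^ (-(2 * H)))) := by
      have e : β * t ^ (H - 1 / 2) * s ^ (-(2 * H)) = ∫ v, betaWeight (2 * H) (1 / 2 - H) v *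
        (s + (t - s) * v) ^ (-1 / 2 - H) := by
        rw [hM, show s + (t - s) = t by ring, show (-(1 / 2 - H) : ℝ) = H - 1 / 2 by ring]
      rw [e]
      simp only [hN]
      rw [← integral_const_mul, ← integral_const_mul, ← integral_sub hI1 (hI2.const_mul s),
        ← integral_const_mul]
      refine integral_congr_ae (.of_forall fun v => ?_)
      simp only
      by_cases hv : v ∈ Ioo (0 : ℝ) 1
      · have h2 : 0 < s + (t - s) * v := by have := hv.1; positivity
        have : (s + (t - s) * v) ^ (1 / 2 - H) =
            (s + (t - s) * v) * (s + (t - s) * v) ^ (-1 / 2 - H) := by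
          nth_rw 2 [← Real.rpow_one (s + (t - s) * v)]
          rw [← Real.rpow_add h2]
          congr 1; ring
        rw [this]
        ring
      · simp [betaWeight_eq_zero hv]
    have e1 : t ^ (H - 1 / 2) = t * t ^ (H - 1 / 2 - 1) := by
      nth_rw 2 [← Real.rpow_one t]
      rw [← Real.rpow_add ht]; congr 1; ring
    have e2 : (t - s) ^ (H - 1 / 2) = (t - s) * (t - s) ^ (H - 1 / 2 - 1) := by
      nth_rw 2 [← Real.rpow_one (t - s)]
      rw [← Real.rpow_add hx]; congr 1; ring
    have e3 : s ^ (1 / 2 - H) = s * (s ^ (H - 1 / 2) * s ^ (-(2 * H))) := by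
      nth_rw 2 [← Real.rpow_one s]
      rw [← Real.rpow_add hs, ← Real.rpow_add hs]; congr 1; ring
    rw [show (H - 3 / 2 : ℝ) = H - 1 / 2 - 1 by ring]
    rw [e1] at hcomb
    rw [e1, e2, e3]
    linear_combination (- s ^ (H - 1 / 2) * (t - s) ^ (H - 1 / 2 - 1)) * hcomb
  have hDlim : Filter.Tendsto D (nhdsWithin s (Ioi s)) (nhds 0) := by
    -- Two terms of `D` blow up like $(t-s)^{H-1/2}$. Their combined coefficient `E` is
    -- differentiable at $s$ and vanishes there, so together they are $O((t-s)^{H+1/2})$.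
    set E : ℝ → ℝ := fun t => β * (t ^ (H - 1 / 2) * s ^ (1 / 2 - H)) - s ^ (H - 1 / 2) * N (t - s)
      with hE
    have hEd : DifferentiableAt ℝ E s := by
      have hN' : HasDerivAt (fun t => N (t - s)) _ s :=
        HasDerivAt.comp_sub_const (f := N) s s (by
          rw [sub_self]; exact hasDerivAt_integral_betaWeight hH0 hH1 hs le_rfl)
      have hp1 : HasDerivAt (fun t : ℝ => t ^ (H - 1 / 2)) _ s :=
        (hasDerivAt_id s).rpow_const (p := H - 1 / 2) (.inl hs.ne')
      exact (((hp1.mul_const (s ^ (1 / 2 - H))).const_mul β).sub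
        (hN'.const_mul (s ^ (H - 1 / 2)))).differentiableAt
    have hinv : s ^ (H - 1 / 2) * s ^ (1 / 2 - H) = 1 := by
      rw [← Real.rpow_add hs]; simp
    have hE0 : E s = 0 := by
      simp only [hE, hN, sub_self, zero_mul, add_zero]
      rw [integral_mul_const, integral_betaWeight (by linarith) (by linarith), ← hβ]
      linear_combination (β - β) * hinv
    have hO := hEd.isBigO_sub
    simp only [hE0, sub_zero] at hO
    have hO' := hO.mono (nhdsWithin_le_nhds (s := Ioi s))
    have hprod : Filter.Tendsto (fun t => (t - s) ^ (H - 1 / 2) * E t) (nhdsWithin s (Ioi s))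
        (nhds 0) := by
      have h1 := (Asymptotics.isBigO_refl (fun t : ℝ => (t - s) ^ (H - 1 / 2))
        (nhdsWithin s (Ioi s))).mul hO'
      refine h1.trans_tendsto ?_
      have h2 : Filter.Tendsto (fun t : ℝ => (t - s) ^ (H + 1 / 2)) (nhdsWithin s (Ioi s))
          (nhds 0) := by
        have : ContinuousAt (fun t : ℝ => (t - s) ^ (H + 1 / 2)) s :=
          ContinuousAt.rpow_const (by fun_prop) (.inr (by linarith))
        have h3 := this.tendsto
        rw [sub_self, Real.zero_rpow (by linarith)] at h3
        exact h3.mono_left nhdsWithin_le_nhds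
      refine h2.congr' ?_
      filter_upwards [self_mem_nhdsWithin] with t ht
      have hx : 0 < t - s := by have : s < t := ht; linarith
      nth_rw 3 [← Real.rpow_one (t - s)]
      rw [← Real.rpow_add hx]; congr 1; ring
    have hJl := (tendsto_integral_kernelTwo hH0 hs).const_mul (β * ((1 / 2 - H) * s ^ (1 / 2 - H)))
    have := hprod.add hJl
    rw [mul_zero, add_zero] at this
    refine this.congr fun t => ?_
    simp only [hD, hE, hJ]
    ring
  have hconst : ∀ y ∈ Ioi s, D y = D t := fun y hy =>
    isOpen_Ioi.is_const_of_deriv_eq_zero isPreconnected_Ioi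
      (fun z hz => (hDderiv z hz).differentiableAt.differentiableWithinAt)
      (fun z hz => (hDderiv z hz).deriv) hy hst
  have hDt : D t = 0 := by
    refine tendsto_nhds_unique (f := D) (l := nhdsWithin s (Ioi s)) ?_ hDlim
    refine (tendsto_const_nhds).congr' ?_
    filter_upwards [self_mem_nhdsWithin] with y hy
    exact (hconst y hy).symm
  have := sub_eq_zero.1 hDt
  exact this

lemma volterraConst_nonneg (H : ℝ) : 0 ≤ volterraConst H := Real.sqrt_nonneg _

/-- This calibrates $c_H$: it is the relation that turns the constant of `lintegral_volterraE_mul`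
into the factor $\frac12$ of the covariance. It comes down to
$\Gamma(\frac32-H)=(\frac12-H)\Gamma(\frac12-H)$. -/
lemma volterraConst_sq {H : ℝ} (hH0 : 0 < H) (hH1 : H < 1 / 2) :
    volterraConst H ^ 2 * (beta (2 * H) (1 - 2 * H)) = H * beta (2 * H) (1 / 2 - H) := by
  have g1 := Real.Gamma_pos_of_pos (show 0 < 1 - 2 * H by linarith)
  have g2 := Real.Gamma_pos_of_pos (show 0 < H + 1 / 2 by linarith)
  have g3 := Real.Gamma_pos_of_pos (show 0 < 1 / 2 - H by linarith)
  have g4 := Real.Gamma_pos_of_pos (show 0 < 2 * H by linarith)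
  have hpos : (0 : ℝ) < 1 - 2 * H := by linarith
  have hB := beta_pos hpos (show 0 < H + 1 / 2 by linarith)
  rw [volterraConst, Real.sq_sqrt (by positivity)]
  simp only [beta]
  have e1 : Real.Gamma (1 - 2 * H + (H + 1 / 2)) = (1 / 2 - H) * Real.Gamma (1 / 2 - H) := by
    rw [← Real.Gamma_add_one (by linarith)]; congr 1; ring
  rw [e1, show 2 * H + (1 - 2 * H) = 1 by ring, Real.Gamma_one,
    show 2 * H + (1 / 2 - H) = H + 1 / 2 by ring]
  have h2 : (1 / 2 - H) ≠ 0 := by linarith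
  field_simp

/-- The Volterra kernel `K_H = K_{H,1} + K_{H,2}`, extended by zero outside `0 < s < t`. -/
def volterraK (H t s : ℝ) : ℝ :=
  if s ∈ Ioo 0 t then kernelOne H t s + kernelTwo H t s else 0

lemma kernelOne_nonneg {H s t : ℝ} (hs : 0 ≤ s) (hst : s ≤ t) : 0 ≤ kernelOne H t s := by
  have := volterraConst_nonneg H
  have h1 : 0 ≤ t - s := by linarith
  have h2 : 0 ≤ t := by linarith
  unfold kernelOne; positivity

lemma kernelTwo_nonneg {H s t : ℝ} (hH1 : H < 1 / 2) (hs : 0 ≤ s) (hst : s ≤ t) :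
    0 ≤ kernelTwo H t s := by
  have := volterraConst_nonneg H
  have h1 : 0 ≤ 1 / 2 - H := by linarith
  refine mul_nonneg (by positivity) (intervalIntegral.integral_nonneg hst fun u hu => ?_)
  have h2 : 0 ≤ u - s := by linarith [hu.1]
  have h3 : 0 ≤ u := by linarith [hu.1]
  positivity

lemma volterraK_nonneg {H : ℝ} (hH1 : H < 1 / 2) (t s : ℝ) : 0 ≤ volterraK H t s := by
  unfold volterraK
  split_ifs with h
  · exact add_nonneg (kernelOne_nonneg h.1.le h.2.le) (kernelTwo_nonneg hH1 h.1.le h.2.le)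
  · exact le_rfl

/-- Inside $0<s<t$ this is `volterra_identity`; outside, both sides vanish, since the integrand of
`volterraE` lives on $s<r<t$ and its prefactor on $s>0$. -/
lemma ofReal_volterraK {H : ℝ} (hH0 : 0 < H) (hH1 : H < 1 / 2) (t s : ℝ) :
    ENNReal.ofReal (volterraK H t s)
      = ENNReal.ofReal (volterraConst H / beta (2 * H) (1 / 2 - H)) * volterraE H t s := by
  have hB := beta_pos (show 0 < 2 * H by linarith) (show 0 < 1 / 2 - H by linarith)
  unfold volterraK
  split_ifs with h
  · rw [volterraE_eq_integral hH0 hH1 h.1 h.2, ← volterra_identity hH0 hH1 h.1 h.2,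
      ← ENNReal.ofReal_mul (div_nonneg (volterraConst_nonneg H) hB.le), kernelOne, kernelTwo]
    congr 1
    rw [← mul_assoc, div_mul_cancel₀ _ hB.ne']
    ring
  · rw [ENNReal.ofReal_zero]
    by_cases h0 : 0 < s
    · have hts : t ≤ s := by
        by_contra h'
        exact h ⟨h0, by linarith⟩
      have : ∀ r, posPow (2 * H - 1) (t - r) * posPow (1 / 2 - H) r * posPow (-1 / 2 - H) (r - s)
          = 0 := by
        intro r
        rcases le_or_gt t r with h' | h'
        · rw [posPow_of_nonpos (x := t - r) (by linarith)]; simp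
        · rw [posPow_of_nonpos (x := r - s) (by linarith)]; simp
      simp only [volterraE, this, lintegral_zero, mul_zero]
    · rw [volterraE, posPow_of_nonpos (not_lt.1 h0)]
      simp

lemma volterraK_eq_toReal {H : ℝ} (hH0 : 0 < H) (hH1 : H < 1 / 2) (t s : ℝ) :
    volterraK H t s
      = (ENNReal.ofReal (volterraConst H / beta (2 * H) (1 / 2 - H)) * volterraE H t s).toReal := by
  rw [← ofReal_volterraK hH0 hH1, ENNReal.toReal_ofReal (volterraK_nonneg hH1 t s)]

lemma measurable_volterraK {H : ℝ} (hH0 : 0 < H) (hH1 : H < 1 / 2) (t : ℝ) :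
    Measurable (volterraK H t) := by
  simp_rw [funext (volterraK_eq_toReal hH0 hH1 t)]
  fun_prop

lemma lintegral_volterraK_mul {H : ℝ} (hH0 : 0 < H) (hH1 : H < 1 / 2) {s t : ℝ} (hs : 0 ≤ s)
    (ht : 0 ≤ t) :
    ∫⁻ u, ENNReal.ofReal (volterraK H t u * volterraK H s u)
      = ENNReal.ofReal ((s ^ (2 * H) + t ^ (2 * H) - |t - s| ^ (2 * H)) / 2) := by
  have hB := beta_pos (show 0 < 2 * H by linarith) (show 0 < 1 / 2 - H by linarith)
  have hB' := beta_pos (show 0 < 2 * H by linarith) (show 0 < 1 - 2 * H by linarith)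
  have hc : 0 ≤ volterraConst H / beta (2 * H) (1 / 2 - H) :=
    div_nonneg (volterraConst_nonneg H) hB.le
  have : ∀ u, ENNReal.ofReal (volterraK H t u * volterraK H s u)
      = ENNReal.ofReal ((volterraConst H / beta (2 * H) (1 / 2 - H)) ^ 2) *
        (volterraE H t u * volterraE H s u) := by
    intro u
    rw [ENNReal.ofReal_mul (volterraK_nonneg hH1 t u), ofReal_volterraK hH0 hH1,
      ofReal_volterraK hH0 hH1, sq, ENNReal.ofReal_mul hc]
    ring
  simp_rw [this]
  rw [lintegral_const_mul' _ _ ENNReal.ofReal_ne_top, lintegral_volterraE_mul hH0 hH1 hs ht,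
    ← ENNReal.ofReal_mul hB'.le, ← ENNReal.ofReal_mul hB.le, ← ENNReal.ofReal_mul (by positivity)]
  congr 1
  have := volterraConst_sq hH0 hH1
  generalize beta (2 * H) (1 / 2 - H) = β at *
  field_simp
  linear_combination (s ^ (2 * H) + t ^ (2 * H) - |t - s| ^ (2 * H)) * this

lemma memLp_volterraK {H : ℝ} (hH0 : 0 < H) (hH1 : H < 1 / 2) {t : ℝ} (ht : 0 ≤ t) :
    MemLp (volterraK H t) 2 := by
  rw [memLp_two_iff_integrable_sq (measurable_volterraK hH0 hH1 t).aestronglyMeasurable]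
  refine ⟨((measurable_volterraK hH0 hH1 t).pow_const 2).aestronglyMeasurable, ?_⟩
  rw [hasFiniteIntegral_iff_ofReal (.of_forall fun u => sq_nonneg _)]
  simp_rw [sq]
  rw [lintegral_volterraK_mul hH0 hH1 ht ht]
  exact ENNReal.ofReal_lt_top

/-- The Volterra kernel factorizes the covariance of fractional Brownian motion. -/
lemma integral_volterraK_mul {H : ℝ} (hH0 : 0 < H) (hH1 : H < 1 / 2) {s t : ℝ} (hs : 0 ≤ s)
    (ht : 0 ≤ t) :
    ∫ u, volterraK H t u * volterraK H s u
      = (s ^ (2 * H) + t ^ (2 * H) - |t - s| ^ (2 * H)) / 2 := by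
  rw [integral_eq_lintegral_of_nonneg_ae
    (.of_forall fun u => mul_nonneg (volterraK_nonneg hH1 t u) (volterraK_nonneg hH1 s u))
    ((measurable_volterraK hH0 hH1 t).mul (measurable_volterraK hH0 hH1 s)).aestronglyMeasurable,
    lintegral_volterraK_mul hH0 hH1 hs ht, ENNReal.toReal_ofReal]
  -- Only the nonnegativity of the right-hand side is at stake, so that it survives the passage
  -- through `ENNReal.ofReal`.
  have h : |t - s| ^ (2 * H) ≤ (max s t) ^ (2 * H) := by
    refine Real.rpow_le_rpow (abs_nonneg _) ?_ (by linarith)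
    rw [abs_le]
    constructor <;> grind
  have h1 := Real.rpow_nonneg hs (2 * H)
  have h2 := Real.rpow_nonneg ht (2 * H)
  cases le_total s t with
  | inl h' => rw [max_eq_right h'] at h; linarith
  | inr h' => rw [max_eq_left h'] at h; linarith

end

/-! ### Abel inversion and totality of the kernels. -/

noncomputable section

lemma enorm_posRpow (a x : ℝ) : ‖posRpow a x‖ₑ = posPow a x :=
  Real.enorm_of_nonneg (posRpow_nonneg a x)

lemma posRpow_zero_of_pos {x : ℝ} (hx : 0 < x) : posRpow 0 x = 1 := by
  simp [posRpow_of_pos hx]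

lemma posPow_zero_le_one (x : ℝ) : posPow 0 x ≤ 1 := by
  rcases le_or_gt x 0 with h | h
  · simp [posPow_of_nonpos h]
  · rw [posPow_zero_of_pos h]

lemma integral_beta {a b : ℝ} (ha : 0 < a) (hb : 0 < b) (s t : ℝ) :
    ∫ r, posRpow (a - 1) (t - r) * posRpow (b - 1) (r - s)
      = beta a b * posRpow (a + b - 1) (t - s) := by
  rw [integral_eq_lintegral_of_nonneg_ae
    (.of_forall fun r => mul_nonneg (posRpow_nonneg _ _) (posRpow_nonneg _ _))
    (Measurable.aestronglyMeasurable (by fun_prop))]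
  simp_rw [ENNReal.ofReal_mul (posRpow_nonneg _ _)]
  have := lintegral_beta ha hb s t
  simp only [posPow] at this
  rw [this, ← ENNReal.ofReal_mul (beta_pos ha hb).le, ENNReal.toReal_ofReal
    (mul_nonneg (beta_pos ha hb).le (posRpow_nonneg _ _))]

/-- Injectivity of the Riemann–Liouville fractional integral of order `α ∈ (0,1)`. -/
lemma ae_eq_zero_of_abel {α T : ℝ} (hα0 : 0 < α) (hα1 : α < 1) {φ : ℝ → ℝ} (hφm : Measurable φ)
    (hφ : Integrable φ) (h : ∀ᵐ t, t < T → ∫ r, posRpow (α - 1) (t - r) * φ r = 0) :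
    ∀ᵐ r, r < T → φ r = 0 := by
  have hB := beta_pos (show 0 < 1 - α by linarith) hα0
  -- The complementary Abel integral of order $1-\alpha$ is applied to the hypothesis. The two
  -- kernels compose to a beta integral that is constant in $r<x$, so a nonzero multiple of the
  -- primitive of `φ` vanishes.
  have hprim : ∀ x < T, ∫ r in Iio x, φ r = 0 := by
    intro x hx
    have hint : Integrable (Function.uncurry fun t r =>
        posRpow (-α) (x - t) * (posRpow (α - 1) (t - r) * φ r)) (volume.prod volume) := by
      refine ⟨Measurable.aestronglyMeasurable (by simp only [Function.uncurry_def]; fun_prop), ?_⟩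
      rw [hasFiniteIntegral_iff_enorm, lintegral_prod_symm' _
        (by simp only [Function.uncurry_def]; fun_prop)]
      simp only [Function.uncurry, enorm_mul, enorm_posRpow]
      have : ∀ r, ∫⁻ t, posPow (-α) (x - t) * (posPow (α - 1) (t - r) * ‖φ r‖ₑ)
          = ENNReal.ofReal (beta (1 - α) α) * posPow 0 (x - r) * ‖φ r‖ₑ := by
        intro r
        simp_rw [← mul_assoc]
        rw [lintegral_mul_const _ (by fun_prop)]
        have := lintegral_beta (a := 1 - α) (by linarith) hα0 r x
        rw [show 1 - α - 1 = -α by ring, show 1 - α + α - 1 = 0 by ring] at this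
        rw [this]
      simp_rw [this]
      calc ∫⁻ r, ENNReal.ofReal (beta (1 - α) α) * posPow 0 (x - r) * ‖φ r‖ₑ
          ≤ ∫⁻ r, ENNReal.ofReal (beta (1 - α) α) * ‖φ r‖ₑ := by
            refine lintegral_mono fun r => ?_
            gcongr
            exact mul_le_of_le_one_right' (posPow_zero_le_one _)
        _ = ENNReal.ofReal (beta (1 - α) α) * ∫⁻ r, ‖φ r‖ₑ :=
            lintegral_const_mul' _ _ ENNReal.ofReal_ne_top
        _ < ⊤ := ENNReal.mul_lt_top ENNReal.ofReal_lt_top hφ.2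
    have hsw := integral_integral_swap hint
    have hL : ∫ t, ∫ r, posRpow (-α) (x - t) * (posRpow (α - 1) (t - r) * φ r) = 0 := by
      rw [← integral_zero ℝ ℝ (μ := volume)]
      refine integral_congr_ae ?_
      filter_upwards [h] with t ht
      rw [integral_const_mul]
      by_cases htx : t < T
      · rw [ht htx, mul_zero]
      · rw [posRpow_of_nonpos (by linarith), zero_mul]
    have hR : ∀ r, ∫ t, posRpow (-α) (x - t) * (posRpow (α - 1) (t - r) * φ r)
        = beta (1 - α) α * ((Iio x).indicator φ r) := by
      intro r
      simp_rw [← mul_assoc]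
      rw [integral_mul_const]
      have := integral_beta (a := 1 - α) (by linarith) hα0 r x
      rw [show 1 - α - 1 = -α by ring, show 1 - α + α - 1 = 0 by ring] at this
      rw [this]
      by_cases hr : r < x
      · rw [indicator_of_mem (show r ∈ Iio x from hr), posRpow_zero_of_pos (by linarith), mul_one]
      · rw [indicator_of_notMem (show r ∉ Iio x from hr), posRpow_of_nonpos (by linarith)]
        ring
    simp_rw [hR] at hsw
    rw [hL, integral_const_mul, integral_indicator measurableSet_Iio] at hsw
    exact (mul_eq_zero.1 hsw.symm).resolve_left hB.ne'
  -- By Lebesgue differentiation, a vanishing primitive forces `φ` to vanish almost everywhere.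
  filter_upwards [LocallyIntegrable.ae_hasDerivAt_integral hφ.locallyIntegrable] with x hx hxT
  have h1 := hx (x - 1)
  have h2 : HasDerivAt (fun x' => ∫ t in (x - 1)..x', φ t) 0 x := by
    refine (hasDerivAt_const x (0 : ℝ)).congr_of_eventuallyEq ?_
    filter_upwards [Ioo_mem_nhds (show x - 1 < x by linarith) hxT] with y hy
    have e2 := intervalIntegral.integral_Iic_sub_Iic (a := x - 1) (b := y) (f := φ) (μ := volume)
      hφ.integrableOn hφ.integrableOn
    rw [← e2, integral_Iic_eq_integral_Iio, integral_Iic_eq_integral_Iio, hprim _ hy.2,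
      hprim _ (by linarith), sub_zero]
  exact h1.unique h2

lemma volterraConst_pos {H : ℝ} (hH0 : 0 < H) (hH1 : H < 1 / 2) : 0 < volterraConst H := by
  have := beta_pos (show 0 < 1 - 2 * H by linarith) (show 0 < H + 1 / 2 by linarith)
  have h : 0 < 1 - 2 * H := by linarith
  exact Real.sqrt_pos.2 (by positivity)

lemma volterraK_eq_integral {H : ℝ} (hH0 : 0 < H) (hH1 : H < 1 / 2) (t s : ℝ) :
    volterraK H t s = volterraConst H / beta (2 * H) (1 / 2 - H) * (posRpow (H - 1 / 2) s *
      ∫ r, posRpow (2 * H - 1) (t - r) * posRpow (1 / 2 - H) r * posRpow (-1 / 2 - H) (r - s)) := by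
  have hB := beta_pos (show 0 < 2 * H by linarith) (show 0 < 1 / 2 - H by linarith)
  rw [volterraK_eq_toReal hH0 hH1, volterraE, ENNReal.toReal_mul, ENNReal.toReal_mul,
    ENNReal.toReal_ofReal (div_nonneg (volterraConst_nonneg H) hB.le), posPow,
    ENNReal.toReal_ofReal (posRpow_nonneg _ _), integral_eq_lintegral_of_nonneg_ae
    (.of_forall fun r => mul_nonneg (mul_nonneg (posRpow_nonneg _ _) (posRpow_nonneg _ _))
      (posRpow_nonneg _ _)) (Measurable.aestronglyMeasurable (by fun_prop))]
  congr 4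
  ext r
  rw [ENNReal.ofReal_mul (mul_nonneg (posRpow_nonneg _ _) (posRpow_nonneg _ _)),
    ENNReal.ofReal_mul (posRpow_nonneg _ _)]
  rfl

/-- The square is $u^{2H-1}$, integrable at $0$ since $H>0$. By Cauchy–Schwarz the product of
$s^{H-1/2}$ with a square integrable function on $(0,T)$ is then integrable. -/
lemma memLp_indicator_posRpow {H : ℝ} (hH0 : 0 < H) (T : ℝ) :
    MemLp ((Ioo 0 T).indicator (posRpow (H - 1 / 2))) 2 := by
  have hm : Measurable ((Ioo 0 T).indicator (posRpow (H - 1 / 2))) :=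
    (measurable_posRpow _).indicator measurableSet_Ioo
  rw [memLp_two_iff_integrable_sq hm.aestronglyMeasurable]
  refine ⟨(hm.pow_const 2).aestronglyMeasurable, ?_⟩
  rw [hasFiniteIntegral_iff_ofReal (.of_forall fun u => sq_nonneg _)]
  have : ∀ u, ENNReal.ofReal ((Ioo 0 T).indicator (posRpow (H - 1 / 2)) u ^ 2)
      = posPow (1 - 1) (T - u) * posPow (2 * H - 1) (u - 0) := by
    intro u
    by_cases hu : u ∈ Ioo 0 T
    · rw [indicator_of_mem hu, sub_self, posPow_zero_of_pos (by linarith [hu.2]), one_mul, sub_zero,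
        posRpow_of_pos hu.1, posPow_of_pos hu.1, sq, ← Real.rpow_add hu.1]
      congr 2; ring
    · rw [indicator_of_notMem hu]
      by_cases h0 : 0 < u
      · rw [posPow_of_nonpos (x := T - u)]
        · simp
        · by_contra h'
          exact hu ⟨h0, by linarith⟩
      · rw [posPow_of_nonpos (x := u - 0) (by linarith)]
        simp
  simp_rw [this]
  rw [lintegral_beta one_pos (by linarith)]
  exact ENNReal.mul_lt_top ENNReal.ofReal_lt_top (posPow_ne_top _ _).lt_top

/-- A square integrable function on `(0,T)` orthogonal to all the kernels `K_H(t,·)` vanishes. -/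
lemma ae_eq_zero_of_forall_integral_volterraK {H : ℝ} (hH0 : 0 < H) (hH1 : H < 1 / 2) {T : ℝ}
    {g : ℝ → ℝ} (hgm : Measurable g) (hg : MemLp g 2) (hsupp : ∀ s, s ∉ Ioo 0 T → g s = 0)
    (h : ∀ t ∈ Ioo 0 T, ∫ s, volterraK H t s * g s = 0) : g =ᵐ[volume] 0 := by
  have hB := beta_pos (show 0 < 2 * H by linarith) (show 0 < 1 / 2 - H by linarith)
  have hc := div_pos (volterraConst_pos hH0 hH1) hB
  set c := volterraConst H / beta (2 * H) (1 / 2 - H) with hcdef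
  set g0 : ℝ → ℝ := fun s => posRpow (H - 1 / 2) s * g s with hg0
  have hg0m : Measurable g0 := by fun_prop
  have hg0supp : ∀ s, s ∉ Ioo 0 T → g0 s = 0 := fun s hs => by simp [hg0, hsupp s hs]
  have hg0i : Integrable g0 := by
    refine ((memLp_indicator_posRpow hH0 T).integrable_mul hg).congr (.of_forall fun s => ?_)
    by_cases hs : s ∈ Ioo 0 T
    · simp [hg0, hs]
    · simp [hg0, hsupp s hs]
  -- Up to a constant, $\int K_H(t,s)g(s)\,ds$ is the Abel integral of order $2H$ of
  -- $r^{1/2-H}\psi(r)$, where $\psi$ is the Abel integral of order $\frac12-H$ of `g0`. Two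
  -- inversions therefore suffice.
  set ψ : ℝ → ℝ := fun r => ∫ s, posRpow (-1 / 2 - H) (r - s) * g0 s with hψ
  -- The cutoff at $T$ makes `φ` integrable on the line and does not affect its Abel integrals at
  -- times $t<T$.
  set φ : ℝ → ℝ := fun r => posRpow 0 (T - r) * posRpow (1 / 2 - H) r * ψ r with hφ
  have hψm : Measurable ψ := by
    refine StronglyMeasurable.measurable ?_
    exact StronglyMeasurable.integral_prod_right (f := fun r s => posRpow (-1 / 2 - H) (r - s) * g0 s)
      (Measurable.stronglyMeasurable (by simp only [Function.uncurry_def]; fun_prop))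
  have hφm : Measurable φ := by fun_prop
  have hφi : Integrable φ := by
    have hprod : Integrable (fun p : ℝ × ℝ => posRpow 0 (T - p.1) * posRpow (1 / 2 - H) p.1 *
        (posRpow (-1 / 2 - H) (p.1 - p.2) * g0 p.2)) (volume.prod volume) := by
      refine ⟨Measurable.aestronglyMeasurable (by fun_prop), ?_⟩
      rw [hasFiniteIntegral_iff_enorm, lintegral_prod_symm' _ (by fun_prop)]
      simp only [enorm_mul, enorm_posRpow]
      calc ∫⁻ s, ∫⁻ r, posPow 0 (T - r) * posPow (1 / 2 - H) r *
            (posPow (-1 / 2 - H) (r - s) * ‖g0 s‖ₑ)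
          ≤ ∫⁻ s, (ENNReal.ofReal (T ^ (1 / 2 - H)) * (ENNReal.ofReal (beta 1 (1 / 2 - H)) *
              ENNReal.ofReal (T ^ (1 / 2 - H)))) * ‖g0 s‖ₑ := by
            refine lintegral_mono fun s => ?_
            by_cases hs : s ∈ Ioo 0 T
            swap
            · simp [hg0supp s hs]
            have hT : 0 < T := hs.1.trans hs.2
            have hb := lintegral_beta one_pos (show 0 < 1 / 2 - H by linarith) s T
            rw [show (1 : ℝ) - 1 = 0 by ring, show 1 / 2 - H - 1 = -1 / 2 - H by ring,
              show 1 + (1 / 2 - H) - 1 = 1 / 2 - H by ring,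
              posPow_of_pos (x := T - s) (by linarith [hs.2])] at hb
            have hle : ENNReal.ofReal ((T - s) ^ (1 / 2 - H)) ≤ ENNReal.ofReal (T ^ (1 / 2 - H)) :=
              ENNReal.ofReal_le_ofReal (Real.rpow_le_rpow (by linarith [hs.2]) (by linarith [hs.1])
                (by linarith))
            calc ∫⁻ r, posPow 0 (T - r) * posPow (1 / 2 - H) r *
                  (posPow (-1 / 2 - H) (r - s) * ‖g0 s‖ₑ)
                ≤ ∫⁻ r, ENNReal.ofReal (T ^ (1 / 2 - H)) * ‖g0 s‖ₑ *
                  (posPow 0 (T - r) * posPow (-1 / 2 - H) (r - s)) := by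
                  refine lintegral_mono fun r => ?_
                  have : posPow 0 (T - r) * posPow (1 / 2 - H) r
                      ≤ posPow 0 (T - r) * ENNReal.ofReal (T ^ (1 / 2 - H)) := by
                    rcases le_or_gt T r with hr | hr
                    · simp [posPow_of_nonpos (show T - r ≤ 0 by linarith)]
                    · gcongr
                      rcases le_or_gt r 0 with hr0 | hr0
                      · simp [posPow_of_nonpos hr0]
                      · rw [posPow_of_pos hr0]
                        exact ENNReal.ofReal_le_ofReal
                          (Real.rpow_le_rpow hr0.le hr.le (by linarith))
                  calc _ ≤ posPow 0 (T - r) * ENNReal.ofReal (T ^ (1 / 2 - H)) *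
                        (posPow (-1 / 2 - H) (r - s) * ‖g0 s‖ₑ) := by gcongr
                    _ = _ := by ring
              _ = ENNReal.ofReal (T ^ (1 / 2 - H)) * ‖g0 s‖ₑ * (ENNReal.ofReal (beta 1 (1 / 2 - H)) *
                  ENNReal.ofReal ((T - s) ^ (1 / 2 - H))) := by
                  rw [lintegral_const_mul _ (by fun_prop), hb]
              _ ≤ ENNReal.ofReal (T ^ (1 / 2 - H)) * ‖g0 s‖ₑ * (ENNReal.ofReal (beta 1 (1 / 2 - H)) *
                  ENNReal.ofReal (T ^ (1 / 2 - H))) := by gcongr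
              _ = _ := by ring
        _ = (ENNReal.ofReal (T ^ (1 / 2 - H)) * (ENNReal.ofReal (beta 1 (1 / 2 - H)) *
              ENNReal.ofReal (T ^ (1 / 2 - H)))) * ∫⁻ s, ‖g0 s‖ₑ :=
            lintegral_const_mul _ (by fun_prop)
        _ < ⊤ := ENNReal.mul_lt_top (ENNReal.mul_lt_top ENNReal.ofReal_lt_top
            (ENNReal.mul_lt_top ENNReal.ofReal_lt_top ENNReal.ofReal_lt_top)) hg0i.2
    refine hprod.integral_prod_left.congr (.of_forall fun r => ?_)
    simp only [hφ, hψ]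
    rw [integral_const_mul]
  have habel : ∀ t, t < T → ∫ r, posRpow (2 * H - 1) (t - r) * φ r = 0 := by
    intro t htT
    rcases le_or_gt t 0 with ht0 | ht0
    · have : ∀ r, posRpow (2 * H - 1) (t - r) * φ r = 0 := by
        intro r
        rcases le_or_gt r 0 with hr | hr
        · simp [hφ, posRpow_of_nonpos hr]
        · simp [posRpow_of_nonpos (show t - r ≤ 0 by linarith)]
      simp [this]
    -- Integrating absolute values in $r$ first reproduces `volterraE` times $|g|$, which is
    -- integrable because both the kernel and $g$ are in $L^2$.
    have hint : Integrable (Function.uncurry fun s r => posRpow (2 * H - 1) (t - r) *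
        posRpow (1 / 2 - H) r * posRpow (-1 / 2 - H) (r - s) * g0 s) (volume.prod volume) := by
      refine ⟨Measurable.aestronglyMeasurable (by simp only [Function.uncurry_def]; fun_prop), ?_⟩
      rw [hasFiniteIntegral_iff_enorm, lintegral_prod _
        (by simp only [Function.uncurry_def]; fun_prop)]
      simp only [Function.uncurry, enorm_mul, enorm_posRpow, hg0]
      have : ∀ s, ∫⁻ r, posPow (2 * H - 1) (t - r) * posPow (1 / 2 - H) r *
          posPow (-1 / 2 - H) (r - s) * (posPow (H - 1 / 2) s * ‖g s‖ₑ)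
          = volterraE H t s * ‖g s‖ₑ := by
        intro s
        rw [lintegral_mul_const _ (by fun_prop), volterraE]
        ring
      simp_rw [this]
      have hKg := ((memLp_volterraK hH0 hH1 ht0.le).integrable_mul hg).2
      rw [hasFiniteIntegral_iff_enorm] at hKg
      have e : ∀ s, ‖(volterraK H t * g) s‖ₑ = ENNReal.ofReal c * (volterraE H t s * ‖g s‖ₑ) := by
        intro s
        rw [Pi.mul_apply, enorm_mul, Real.enorm_of_nonneg (volterraK_nonneg hH1 t s),
          ofReal_volterraK hH0 hH1, mul_assoc]
      simp_rw [e] at hKg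
      rw [lintegral_const_mul' _ _ ENNReal.ofReal_ne_top] at hKg
      exact ENNReal.lt_top_of_mul_ne_top_right hKg.ne (by simpa using hc)
    have hsw := integral_integral_swap hint
    have hL : ∀ s, c * ∫ r, posRpow (2 * H - 1) (t - r) * posRpow (1 / 2 - H) r *
        posRpow (-1 / 2 - H) (r - s) * g0 s = volterraK H t s * g s := by
      intro s
      rw [integral_mul_const, volterraK_eq_integral hH0 hH1, ← hcdef]
      simp only [hg0]
      ring
    have h0 := h t ⟨ht0, htT⟩
    simp_rw [← hL] at h0
    rw [integral_const_mul] at h0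
    rw [(mul_eq_zero.1 h0).resolve_left hc.ne'] at hsw
    rw [hsw]
    refine integral_congr_ae (.of_forall fun r => ?_)
    simp only [hφ, hψ]
    rcases le_or_gt t r with hr | hr
    · simp [posRpow_of_nonpos (show t - r ≤ 0 by linarith)]
    · rw [posRpow_zero_of_pos (by linarith), one_mul, ← mul_assoc, ← integral_const_mul]
      simp_rw [mul_assoc]
  have hφ0 := ae_eq_zero_of_abel (by linarith) (by linarith) hφm hφi (.of_forall habel)
  have hg00 := ae_eq_zero_of_abel (α := 1 / 2 - H) (T := T) (by linarith) (by linarith) hg0m hg0i (by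
    filter_upwards [hφ0] with r hr hrT
    rw [show 1 / 2 - H - 1 = -1 / 2 - H by ring]
    rcases le_or_gt r 0 with hr0 | hr0
    · have : ∀ s, posRpow (-1 / 2 - H) (r - s) * g0 s = 0 := by
        intro s
        rcases le_or_gt s 0 with hs | hs
        · simp [hg0, posRpow_of_nonpos hs]
        · simp [posRpow_of_nonpos (show r - s ≤ 0 by linarith)]
      simp [this]
    · have := hr hrT
      simp only [hφ] at this
      rw [posRpow_zero_of_pos (by linarith), one_mul] at this
      refine (mul_eq_zero.1 this).resolve_left ?_
      rw [posRpow_of_pos hr0]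
      exact (Real.rpow_pos_of_pos hr0 _).ne')
  filter_upwards [hg00] with s hs
  by_cases hsT : s ∈ Ioo 0 T
  · have := hs hsT.2
    simp only [hg0] at this
    refine (mul_eq_zero.1 this).resolve_left ?_
    rw [posRpow_of_pos hsT.1]
    exact (Real.rpow_pos_of_pos hsT.1 _).ne'
  · exact hsupp s hsT

end

/-! ### Derivatives of the two kernels, homogeneity and integrability. -/

noncomputable section

/-- The incomplete beta integral `∫_y^1 w^{-2H} (1-w)^{H-1/2} dw`. -/
def incBeta (H y : ℝ) : ℝ := ∫ w in y..1, betaWeight (H + 1 / 2) (1 - 2 * H) w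

lemma incBeta_nonneg {H y : ℝ} (hy : y ≤ 1) : 0 ≤ incBeta H y :=
  intervalIntegral.integral_nonneg hy fun _ _ => betaWeight_nonneg _ _ _

lemma incBeta_le {H y : ℝ} (hH0 : 0 < H) (hH1 : H < 1 / 2) (hy : y ≤ 1) :
    incBeta H y ≤ beta (H + 1 / 2) (1 - 2 * H) := by
  rw [incBeta, intervalIntegral.integral_of_le hy,
    ← integral_betaWeight (show 0 < H + 1 / 2 by linarith) (show 0 < 1 - 2 * H by linarith)]
  exact setIntegral_le_integral (integrable_betaWeight (by linarith) (by linarith))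
    (.of_forall fun _ => betaWeight_nonneg _ _ _)

lemma hasDerivAt_incBeta {H y : ℝ} (hH0 : 0 < H) (hH1 : H < 1 / 2) (hy : y ∈ Ioo (0 : ℝ) 1) :
    HasDerivAt (incBeta H) (-(y ^ (-(2 * H)) * (1 - y) ^ (H - 1 / 2))) y := by
  have hI := integrable_betaWeight (show 0 < H + 1 / 2 by linarith) (show 0 < 1 - 2 * H by linarith)
  have hy1 : 0 < 1 - y := by linarith [hy.2]
  have hev : (fun w => betaWeight (H + 1 / 2) (1 - 2 * H) w) =ᶠ[nhds y]
      fun w => w ^ (-(2 * H)) * (1 - w) ^ (H - 1 / 2) := by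
    filter_upwards [Ioo_mem_nhds hy.1 hy.2] with w hw
    rw [betaWeight, posRpow_of_pos hw.1, posRpow_of_pos (by linarith [hw.2]), mul_comm]
    congr 2 <;> ring
  have h := intervalIntegral.integral_hasDerivAt_left (hI.intervalIntegrable (a := y) (b := 1))
    ((measurable_betaWeight _ _).stronglyMeasurable.stronglyMeasurableAtFilter) (by
      refine ContinuousAt.congr ?_ hev.symm
      exact (Real.continuousAt_rpow_const y _ (.inl hy.1.ne')).mul
        (ContinuousAt.rpow_const (by fun_prop) (.inl hy1.ne')))
  have e : betaWeight (H + 1 / 2) (1 - 2 * H) y = y ^ (-(2 * H)) * (1 - y) ^ (H - 1 / 2) :=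
    hev.self_of_nhds
  rw [e] at h
  exact h

lemma continuous_incBeta {H : ℝ} (hH0 : 0 < H) (hH1 : H < 1 / 2) : Continuous (incBeta H) := by
  have hI := integrable_betaWeight (show 0 < H + 1 / 2 by linarith) (show 0 < 1 - 2 * H by linarith)
  have := (intervalIntegral.continuous_primitive (fun a b => hI.intervalIntegrable (a := a) (b := b)) 1).neg
  refine this.congr fun y => ?_
  rw [incBeta, intervalIntegral.integral_symm]
  rfl

/-- Homogeneity of the second kernel: it is `s^{H-1/2}` times a function of `s / t`. -/
lemma kernelTwo_eq {H s t : ℝ} (hs : 0 < s) (hst : s ≤ t) :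
    kernelTwo H t s = volterraConst H * (1 / 2 - H) * (s ^ (H - 1 / 2) * incBeta H (s / t)) := by
  have ht : 0 < t := by linarith
  have hst1 : s / t ≤ 1 := (div_le_one ht).2 hst
  have hst0 : 0 < s / t := div_pos hs ht
  -- The substitution $u=s/w$ takes $s$ out of the singular lower endpoint. Afterwards $s$ enters
  -- only through a power and through the limit $s/t$, near which the integrand is smooth for
  -- $0<s<t$.
  have hderiv : ∀ w ∈ Ioo (s / t) 1, HasDerivWithinAt (fun w => s / w) (-s / w ^ 2)
      (Ioo (s / t) 1) w := by
    intro w hw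
    have hw0 : w ≠ 0 := (hst0.trans hw.1).ne'
    have h := (hasDerivAt_const w s).div (hasDerivAt_id w) hw0
    refine (h.congr_deriv ?_).hasDerivWithinAt
    simp
  have hinj : InjOn (fun w => s / w) (Ioo (s / t) 1) := by
    intro x hx y hy hxy
    have hx0 : x ≠ 0 := (hst0.trans hx.1).ne'
    have hy0 : y ≠ 0 := (hst0.trans hy.1).ne'
    simp only at hxy
    field_simp at hxy
    exact hxy.symm
  have himg : (fun w => s / w) '' Ioo (s / t) 1 = Ioo s t := by
    ext u
    constructor
    · rintro ⟨w, hw, rfl⟩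
      have hw0 : 0 < w := hst0.trans hw.1
      have h1 := hw.1
      rw [div_lt_iff₀ ht] at h1
      refine ⟨?_, ?_⟩
      · simp only; rw [lt_div_iff₀ hw0]; nlinarith [hw.2]
      · simp only; rw [div_lt_iff₀ hw0]; linarith
    · intro hu
      have hu0 : 0 < u := hs.trans hu.1
      refine ⟨s / u, ⟨?_, ?_⟩, ?_⟩
      · exact div_lt_div_of_pos_left hs hu0 hu.2
      · rw [div_lt_one hu0]; exact hu.1
      · simp only; field_simp
  have key := integral_image_eq_integral_abs_deriv_smul measurableSet_Ioo hderiv hinj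
    (fun u => u ^ (H - 3 / 2) * (u - s) ^ (H - 1 / 2))
  rw [himg] at key
  rw [kernelTwo, incBeta, intervalIntegral.integral_of_le hst, intervalIntegral.integral_of_le hst1,
    integral_Ioc_eq_integral_Ioo, integral_Ioc_eq_integral_Ioo, key]
  have : ∀ w ∈ Ioo (s / t) 1, |(-s / w ^ 2)| • ((s / w) ^ (H - 3 / 2) * (s / w - s) ^ (H - 1 / 2))
      = s ^ (2 * H - 1) * betaWeight (H + 1 / 2) (1 - 2 * H) w := by
    intro w hw
    have hw0 : 0 < w := hst0.trans hw.1
    have hw1 : 0 < 1 - w := by linarith [hw.2]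
    have e : s / w - s = s * (1 - w) / w := by field_simp
    rw [betaWeight, posRpow_of_pos hw0, posRpow_of_pos hw1, e, neg_div, abs_neg,
      abs_of_pos (by positivity), smul_eq_mul, Real.div_rpow hs.le hw0.le,
      Real.div_rpow (by positivity) hw0.le, Real.mul_rpow hs.le hw1.le,
      show H + 1 / 2 - 1 = H - 1 / 2 by ring]
    have e1 : s ^ (2 * H - 1) = s * s ^ (H - 3 / 2) * s ^ (H - 1 / 2) := by
      nth_rw 2 [← Real.rpow_one s]
      rw [← Real.rpow_add hs, ← Real.rpow_add hs]; congr 1; ring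
    have e2 : w ^ (1 - 2 * H - 1) * (w ^ 2 * w ^ (H - 3 / 2) * w ^ (H - 1 / 2)) = 1 := by
      rw [← Real.rpow_natCast w 2, ← Real.rpow_add hw0, ← Real.rpow_add hw0, ← Real.rpow_add hw0]
      convert Real.rpow_zero w using 2; push_cast; ring
    rw [e1]
    have p1 := Real.rpow_pos_of_pos hw0 (H - 3 / 2)
    have p2 := Real.rpow_pos_of_pos hw0 (H - 1 / 2)
    generalize w ^ (1 - 2 * H - 1) = a1 at *
    generalize w ^ (H - 3 / 2) = a2 at *
    generalize w ^ (H - 1 / 2) = a3 at *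
    generalize s ^ (H - 3 / 2) = b1 at *
    generalize s ^ (H - 1 / 2) = b2 at *
    generalize (1 - w) ^ (H - 1 / 2) = b3 at *
    field_simp
    linear_combination (- b1 * b2 * b3) * e2
  rw [setIntegral_congr_fun measurableSet_Ioo this, integral_const_mul]
  have e3 : s ^ (H - 1 / 2) = s ^ (1 / 2 - H) * s ^ (2 * H - 1) := by
    rw [← Real.rpow_add hs]; congr 1; ring
  rw [e3]
  ring

/-- The derivative `∂ₛ K_{H,1}(t,s)` for `0 < s < t`. -/
def kernelOneDeriv (H t s : ℝ) : ℝ :=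
  volterraConst H * (1 / 2 - H) * t ^ (H - 1 / 2) *
    (s ^ (-1 / 2 - H) * (t - s) ^ (H - 1 / 2) + s ^ (1 / 2 - H) * (t - s) ^ (H - 3 / 2))

/-- The derivative `-∂ₛ K_{H,2}(t,s)` for `0 < s < t`. -/
def kernelTwoNegDeriv (H t s : ℝ) : ℝ :=
  volterraConst H * (1 / 2 - H) * ((1 / 2 - H) * s ^ (H - 3 / 2) * incBeta H (s / t) +
    t ^ (H - 1 / 2) * s ^ (-1 / 2 - H) * (t - s) ^ (H - 1 / 2))

/-- Together with `kernelTwoNegDeriv_nonneg` this says that $K_{H,1}$ increases and $K_{H,2}$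
decreases in $s$. The signs give integrability of the derivatives from continuity of the kernels,
and later the hypotheses of Fubini's theorem. -/
lemma kernelOneDeriv_nonneg {H s t : ℝ} (hH1 : H < 1 / 2) (hs : 0 < s) (hst : s < t) :
    0 ≤ kernelOneDeriv H t s := by
  have := volterraConst_nonneg H
  have h1 : 0 ≤ t - s := by linarith
  have h2 : 0 ≤ t := by linarith
  have h3 : 0 ≤ 1 / 2 - H := by linarith
  unfold kernelOneDeriv; positivity

lemma kernelTwoNegDeriv_nonneg {H s t : ℝ} (hH1 : H < 1 / 2) (hs : 0 < s) (hst : s < t) :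
    0 ≤ kernelTwoNegDeriv H t s := by
  have := volterraConst_nonneg H
  have h1 : 0 ≤ t - s := by linarith
  have h2 : 0 ≤ t := by linarith
  have h3 : 0 ≤ 1 / 2 - H := by linarith
  have h4 : 0 ≤ incBeta H (s / t) := incBeta_nonneg ((div_le_one (hs.trans hst)).2 hst.le)
  unfold kernelTwoNegDeriv; positivity

@[fun_prop]
lemma measurable_kernelOneDeriv (H t : ℝ) : Measurable (kernelOneDeriv H t) := by
  unfold kernelOneDeriv; fun_prop

lemma measurable_kernelTwoNegDeriv {H : ℝ} (hH0 : 0 < H) (hH1 : H < 1 / 2) (t : ℝ) :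
    Measurable (kernelTwoNegDeriv H t) := by
  have := (continuous_incBeta hH0 hH1).measurable
  unfold kernelTwoNegDeriv; fun_prop

lemma hasDerivAt_kernelOne {H s t : ℝ} (hs : 0 < s) (hst : s < t) :
    HasDerivAt (kernelOne H t) (kernelOneDeriv H t s) s := by
  have h1 : HasDerivAt (fun s : ℝ => s ^ (1 / 2 - H)) _ s :=
    (hasDerivAt_id s).rpow_const (p := 1 / 2 - H) (.inl hs.ne')
  have h2 : HasDerivAt (fun s : ℝ => (t - s) ^ (H - 1 / 2)) _ s :=
    ((hasDerivAt_id s).const_sub t).rpow_const (p := H - 1 / 2)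
      (.inl (by simp only [id]; linarith))
  have h := (h1.const_mul (volterraConst H * t ^ (H - 1 / 2))).mul h2
  refine h.congr_deriv ?_
  simp only [id, kernelOneDeriv]
  rw [show 1 / 2 - H - 1 = -1 / 2 - H by ring, show H - 1 / 2 - 1 = H - 3 / 2 by ring]
  ring

/-- The product rule applied to the homogeneous form `kernelTwo_eq`; the original integral is not
differentiated at its singular endpoint. -/
lemma hasDerivAt_kernelTwo {H s t : ℝ} (hH0 : 0 < H) (hH1 : H < 1 / 2) (hs : 0 < s)
    (hst : s < t) : HasDerivAt (kernelTwo H t) (-kernelTwoNegDeriv H t s) s := by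
  have ht : 0 < t := hs.trans hst
  have h1 : HasDerivAt (fun s : ℝ => s ^ (H - 1 / 2)) _ s :=
    (hasDerivAt_id s).rpow_const (p := H - 1 / 2) (.inl hs.ne')
  have h2 : HasDerivAt (fun s => incBeta H (s / t)) _ s :=
    HasDerivAt.comp (h₂ := incBeta H) (h := fun s => s / t) s
      (hasDerivAt_incBeta hH0 hH1 ⟨div_pos hs ht, (div_lt_one ht).2 hst⟩)
      ((hasDerivAt_id s).div_const t)
  have h := (h1.mul h2).const_mul (volterraConst H * (1 / 2 - H))
  have hev : kernelTwo H t =ᶠ[nhds s]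
      fun s => volterraConst H * (1 / 2 - H) * (s ^ (H - 1 / 2) * incBeta H (s / t)) := by
    filter_upwards [Ioo_mem_nhds hs hst] with r hr
    exact kernelTwo_eq hr.1 hr.2.le
  refine (h.congr_of_eventuallyEq hev).congr_deriv ?_
  simp only [id, kernelTwoNegDeriv]
  have hts : 0 < t - s := by linarith
  have e0 : 1 - s / t = (t - s) / t := by field_simp
  rw [e0, Real.div_rpow hs.le ht.le, Real.div_rpow hts.le ht.le,
    show H - 1 / 2 - 1 = H - 3 / 2 by ring]
  have e1 : s ^ (-1 / 2 - H) = s ^ (H - 1 / 2) * s ^ (-(2 * H)) := by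
    rw [← Real.rpow_add hs]; congr 1; ring
  have e2 : t ^ (H - 1 / 2) * (t ^ (-(2 * H)) * t ^ (H - 1 / 2) * t) = 1 := by
    nth_rw 4 [← Real.rpow_one t]
    rw [← Real.rpow_add ht, ← Real.rpow_add ht, ← Real.rpow_add ht]
    convert Real.rpow_zero t using 2; ring
  rw [e1]
  have p1 := Real.rpow_pos_of_pos ht (-(2 * H))
  have p2 := Real.rpow_pos_of_pos ht (H - 1 / 2)
  generalize t ^ (-(2 * H)) = a1 at *
  generalize t ^ (H - 1 / 2) = a2 at *
  generalize s ^ (-(2 * H)) = b1 at *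
  generalize s ^ (H - 1 / 2) = b2 at *
  generalize s ^ (H - 3 / 2) = b3 at *
  generalize (t - s) ^ (H - 1 / 2) = b4 at *
  generalize incBeta H (s / t) = b5 at *
  field_simp
  linear_combination (-volterraConst H * b1 * b2 * b4 * 2 * (2 * H - 1)) * e2

/-- Both kernels are homogeneous of degree $H-\frac12$ in $(t,s)$, so their $s$-derivatives have
degree $H-\frac32$. -/
lemma kernelOneDeriv_scale {H t u : ℝ} (ht : 0 < t) (hu : u ∈ Ioo (0 : ℝ) 1) :
    kernelOneDeriv H t (t * u) = t ^ (H - 3 / 2) * kernelOneDeriv H 1 u := by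
  have hu1 : 0 < 1 - u := by linarith [hu.2]
  unfold kernelOneDeriv
  rw [show t - t * u = t * (1 - u) by ring, Real.mul_rpow ht.le hu.1.le, Real.mul_rpow ht.le hu.1.le,
    Real.mul_rpow ht.le hu1.le, Real.mul_rpow ht.le hu1.le, Real.one_rpow]
  have e1 : t ^ (H - 1 / 2) * t ^ (-1 / 2 - H) * t ^ (H - 1 / 2) = t ^ (H - 3 / 2) := by
    rw [← Real.rpow_add ht, ← Real.rpow_add ht]; congr 1; ring
  have e2 : t ^ (H - 1 / 2) * t ^ (1 / 2 - H) = 1 := by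
    rw [← Real.rpow_add ht]; convert Real.rpow_zero t using 2; ring
  linear_combination (volterraConst H * (1 / 2 - H) * u ^ (-1 / 2 - H) * (1 - u) ^ (H - 1 / 2)) * e1
    + (volterraConst H * (1 / 2 - H) * t ^ (H - 3 / 2) * u ^ (1 / 2 - H) *
      (1 - u) ^ (H - 3 / 2)) * e2

lemma kernelTwoNegDeriv_scale {H t u : ℝ} (ht : 0 < t) (hu : u ∈ Ioo (0 : ℝ) 1) :
    kernelTwoNegDeriv H t (t * u) = t ^ (H - 3 / 2) * kernelTwoNegDeriv H 1 u := by
  have hu1 : 0 < 1 - u := by linarith [hu.2]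
  unfold kernelTwoNegDeriv
  rw [show t - t * u = t * (1 - u) by ring, Real.mul_rpow ht.le hu.1.le, Real.mul_rpow ht.le hu.1.le,
    Real.mul_rpow ht.le hu1.le, Real.one_rpow, mul_div_cancel_left₀ _ ht.ne', div_one]
  have e1 : t ^ (H - 1 / 2) * t ^ (-1 / 2 - H) * t ^ (H - 1 / 2) = t ^ (H - 3 / 2) := by
    rw [← Real.rpow_add ht, ← Real.rpow_add ht]; congr 1; ring
  linear_combination (volterraConst H * (1 / 2 - H) * u ^ (-1 / 2 - H) * (1 - u) ^ (H - 1 / 2)) * e1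

/-- The function is a sum of two beta weights. The critical singularity is $(1-u)^{\lambda+H-3/2}$
at $u=1$, integrable because $\lambda>\frac12-H$. -/
lemma integrableOn_kernelOneDeriv_unit {H lam : ℝ} (hH0 : 0 < H) (hH1 : H < 1 / 2)
    (hlam : 1 / 2 - H < lam) :
    IntegrableOn (fun u => (1 - u) ^ lam * kernelOneDeriv H 1 u) (Ioo 0 1) := by
  have h := ((integrable_betaWeight (a := H + 1 / 2 + lam) (b := 1 / 2 - H) (by linarith)
    (by linarith)).add (integrable_betaWeight (a := H - 1 / 2 + lam) (b := 3 / 2 - H) (by linarith)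
    (by linarith))).const_mul (volterraConst H * (1 / 2 - H))
  refine (h.integrableOn (s := Ioo 0 1)).congr_fun (fun u hu => ?_) measurableSet_Ioo
  have hu1 : 0 < 1 - u := by linarith [hu.2]
  simp only [Pi.add_apply, betaWeight, kernelOneDeriv]
  rw [posRpow_of_pos hu.1, posRpow_of_pos hu.1, posRpow_of_pos hu1, posRpow_of_pos hu1,
    Real.one_rpow, show H + 1 / 2 + lam - 1 = lam + (H - 1 / 2) by ring,
    show H - 1 / 2 + lam - 1 = lam + (H - 3 / 2) by ring, Real.rpow_add hu1, Real.rpow_add hu1,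
    show 1 / 2 - H - 1 = -1 / 2 - H by ring, show 3 / 2 - H - 1 = 1 / 2 - H by ring]
  ring

/-- The critical singularity is now $u^{\lambda+H-3/2}$ at $u=0$. The incomplete beta factor is
bounded by the complete one, so two beta weights dominate. -/
lemma integrableOn_kernelTwoNegDeriv_unit {H lam : ℝ} (hH0 : 0 < H) (hH1 : H < 1 / 2)
    (hlam : 1 / 2 - H < lam) :
    IntegrableOn (fun u => u ^ lam * kernelTwoNegDeriv H 1 u) (Ioo 0 1) := by
  have h := (((integrable_betaWeight (a := 1) (b := H - 1 / 2 + lam) (by linarith)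
    (by linarith)).const_mul ((1 / 2 - H) * beta (H + 1 / 2) (1 - 2 * H))).add
    (integrable_betaWeight (a := H + 1 / 2) (b := 1 / 2 - H + lam) (by linarith)
    (by linarith))).const_mul (volterraConst H * (1 / 2 - H))
  refine (h.integrableOn (s := Ioo 0 1)).mono' (((by fun_prop : Measurable fun u : ℝ =>
    u ^ lam).mul (measurable_kernelTwoNegDeriv hH0 hH1 1)).aestronglyMeasurable) ?_
  refine (ae_restrict_iff' measurableSet_Ioo).2 (.of_forall fun u hu => ?_)
  have hu0 := hu.1
  have hu1 : 0 < 1 - u := by linarith [hu.2]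
  have hn := kernelTwoNegDeriv_nonneg (H := H) hH1 hu.1 hu.2
  have hle := incBeta_le (y := u) hH0 hH1 hu.2.le
  have hc : 0 ≤ volterraConst H * (1 / 2 - H) :=
    mul_nonneg (volterraConst_nonneg H) (by linarith)
  have hh : 0 ≤ 1 / 2 - H := by linarith
  rw [Real.norm_of_nonneg (by positivity)]
  simp only [Pi.add_apply, betaWeight, kernelTwoNegDeriv]
  rw [posRpow_of_pos hu.1, posRpow_of_pos hu.1, posRpow_of_pos hu1, posRpow_of_pos hu1,
    Real.one_rpow, sub_self, Real.rpow_zero, div_one,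
    show H - 1 / 2 + lam - 1 = lam + (H - 3 / 2) by ring,
    show H + 1 / 2 - 1 = H - 1 / 2 by ring,
    show 1 / 2 - H + lam - 1 = lam + (-1 / 2 - H) by ring, Real.rpow_add hu0, Real.rpow_add hu0]
  have p : 0 ≤ volterraConst H * (1 / 2 - H) * (1 / 2 - H) * (u ^ lam * u ^ (H - 3 / 2)) := by
    positivity
  nlinarith [mul_le_mul_of_nonneg_left hle p]

/-- Scaling an integral over `(0,t)` to the unit interval. -/
lemma setIntegral_Ioo_scale {t : ℝ} (ht : 0 < t) (F : ℝ → ℝ) :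
    ∫ s in Ioo 0 t, F s = t * ∫ u in Ioo 0 1, F (t * u) := by
  have := intervalIntegral.smul_integral_comp_mul_left (a := 0) (b := 1) F t
  rw [mul_zero, mul_one, intervalIntegral.integral_of_le ht.le,
    intervalIntegral.integral_of_le zero_le_one, integral_Ioc_eq_integral_Ioo,
    integral_Ioc_eq_integral_Ioo, smul_eq_mul] at this
  exact this.symm

lemma integrableOn_Ioo_scale {t : ℝ} (ht : 0 < t) {F : ℝ → ℝ}
    (hF : IntegrableOn (fun u => F (t * u)) (Ioo 0 1)) : IntegrableOn F (Ioo 0 t) := by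
  rw [← intervalIntegrable_iff_integrableOn_Ioo_of_le zero_le_one] at hF
  rw [← intervalIntegrable_iff_integrableOn_Ioo_of_le ht.le]
  have := (IntervalIntegrable.comp_mul_left_iff (a := 0) (b := t) (f := F) ht.ne').1
    (by simpa [ht.ne'] using hF)
  exact this

lemma integrableOn_kernelOneDeriv {H lam t : ℝ} (hH0 : 0 < H) (hH1 : H < 1 / 2)
    (hlam : 1 / 2 - H < lam) (ht : 0 < t) :
    IntegrableOn (fun s => (t - s) ^ lam * kernelOneDeriv H t s) (Ioo 0 t) := by
  refine integrableOn_Ioo_scale ht ?_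
  refine IntegrableOn.congr_fun ((integrableOn_kernelOneDeriv_unit hH0 hH1 hlam).const_mul
    (t ^ lam * t ^ (H - 3 / 2))) (fun u hu => ?_) measurableSet_Ioo
  have hu1 : 0 < 1 - u := by linarith [hu.2]
  rw [kernelOneDeriv_scale ht hu, show t - t * u = t * (1 - u) by ring, Real.mul_rpow ht.le hu1.le]
  ring

lemma integrableOn_kernelTwoNegDeriv {H lam t : ℝ} (hH0 : 0 < H) (hH1 : H < 1 / 2)
    (hlam : 1 / 2 - H < lam) (ht : 0 < t) :
    IntegrableOn (fun s => s ^ lam * kernelTwoNegDeriv H t s) (Ioo 0 t) := by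
  refine integrableOn_Ioo_scale ht ?_
  refine IntegrableOn.congr_fun ((integrableOn_kernelTwoNegDeriv_unit hH0 hH1 hlam).const_mul
    (t ^ lam * t ^ (H - 3 / 2))) (fun u hu => ?_) measurableSet_Ioo
  rw [kernelTwoNegDeriv_scale ht hu, Real.mul_rpow ht.le hu.1.le]
  ring

end

/-! ### The operator on Hölder functions. -/

noncomputable section

lemma fracOp_zero (H : ℝ) (f : ℝ → ℝ) : fracOp H f 0 = 0 := by simp [fracOp]

lemma fracOpConverges_zero (H : ℝ) (f : ℝ → ℝ) : FracOpConverges H f 0 := by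
  simp [FracOpConverges]

lemma fracOp_eq {H t : ℝ} (hH0 : 0 < H) (hH1 : H < 1 / 2) (ht : 0 < t) (f : ℝ → ℝ) :
    fracOp H f t = (∫ s in Ioo 0 t, (f t - f s) * kernelOneDeriv H t s) +
      ∫ s in Ioo 0 t, kernelTwoNegDeriv H t s * f s := by
  rw [fracOp, intervalIntegral.integral_of_le ht.le, intervalIntegral.integral_of_le ht.le,
    integral_Ioc_eq_integral_Ioo, integral_Ioc_eq_integral_Ioo, sub_eq_add_neg, ← integral_neg]
  congr 1
  · refine setIntegral_congr_fun measurableSet_Ioo fun s hs => ?_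
    simp only [(hasDerivAt_kernelOne (H := H) hs.1 hs.2).deriv]
  · refine setIntegral_congr_fun measurableSet_Ioo fun s hs => ?_
    simp only [(hasDerivAt_kernelTwo hH0 hH1 hs.1 hs.2).deriv]
    ring

lemma fracOpConverges_iff {H t : ℝ} (hH0 : 0 < H) (hH1 : H < 1 / 2) (ht : 0 < t) (f : ℝ → ℝ) :
    FracOpConverges H f t ↔ IntegrableOn (fun s => (f t - f s) * kernelOneDeriv H t s) (Ioo 0 t) ∧
      IntegrableOn (fun s => kernelTwoNegDeriv H t s * f s) (Ioo 0 t) := by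
  rw [FracOpConverges, intervalIntegrable_iff_integrableOn_Ioo_of_le ht.le,
    intervalIntegrable_iff_integrableOn_Ioo_of_le ht.le]
  refine and_congr (integrableOn_congr_fun (fun s hs => ?_) measurableSet_Ioo) ?_
  · simp only [(hasDerivAt_kernelOne (H := H) hs.1 hs.2).deriv]
  · rw [IntegrableOn, ← integrable_neg_iff]
    refine integrableOn_congr_fun (fun s hs => ?_) measurableSet_Ioo
    simp only [Pi.neg_apply, (hasDerivAt_kernelTwo hH0 hH1 hs.1 hs.2).deriv]
    ring

/-- The prefactor is the Jacobian $t$ times the homogeneity factor $t^{H-3/2}$. The singular kernels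
and the domain no longer depend on $t$, so the norm bound and continuity both follow by domination.
-/
lemma fracOp_eq_scaled {H t : ℝ} (hH0 : 0 < H) (hH1 : H < 1 / 2) (ht : 0 < t) (f : ℝ → ℝ) :
    fracOp H f t = t ^ (H - 1 / 2) *
      ((∫ u in Ioo 0 1, (f t - f (t * u)) * kernelOneDeriv H 1 u) +
        ∫ u in Ioo 0 1, kernelTwoNegDeriv H 1 u * f (t * u)) := by
  have e : t ^ (H - 1 / 2) = t * t ^ (H - 3 / 2) := by
    nth_rw 2 [← Real.rpow_one t]
    rw [← Real.rpow_add ht]; congr 1; ring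
  rw [fracOp_eq hH0 hH1 ht, setIntegral_Ioo_scale ht, setIntegral_Ioo_scale ht, e, ← mul_add,
    mul_assoc]
  congr 1
  rw [mul_add, ← integral_const_mul, ← integral_const_mul]
  congr 1
  · refine setIntegral_congr_fun measurableSet_Ioo fun u hu => ?_
    simp only [kernelOneDeriv_scale ht hu]
    ring
  · refine setIntegral_congr_fun measurableSet_Ioo fun u hu => ?_
    simp only [kernelTwoNegDeriv_scale ht hu]
    ring

lemma continuousOn_of_holder {lam T M : ℝ} (hlam : 0 < lam) {f : ℝ → ℝ}
    (hf : ∀ s ∈ Icc 0 T, ∀ r ∈ Icc 0 T, |f r - f s| ≤ M * |r - s| ^ lam) :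
    ContinuousOn f (Icc 0 T) := by
  intro s hs
  rw [ContinuousWithinAt, tendsto_iff_dist_tendsto_zero]
  refine squeeze_zero' (g := fun r => M * |r - s| ^ lam) (.of_forall fun r => dist_nonneg) ?_ ?_
  · filter_upwards [self_mem_nhdsWithin] with r hr
    rw [Real.dist_eq]
    exact hf s hs r hr
  · have : ContinuousAt (fun r => M * |r - s| ^ lam) s := by
      refine continuousAt_const.mul (ContinuousAt.rpow_const (by fun_prop) (.inr hlam.le))
    have h := this.tendsto
    rw [sub_self, abs_zero, Real.zero_rpow hlam.ne', mul_zero] at h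
    exact h.mono_left nhdsWithin_le_nhds

/-- The Hölder seminorm over `0 < s < r ≤ T` controls all increments on `[0,T]`. -/
lemma abs_sub_le_holderNorm {lam T : ℝ} (hlam : 0 < lam) {f : ℝ → ℝ} (hf : MemHolderZero lam T f) :
    ∀ s ∈ Icc 0 T, ∀ r ∈ Icc 0 T, |f r - f s| ≤ holderNorm lam T f * |r - s| ^ lam := by
  obtain ⟨-, M, hM⟩ := hf
  -- Boundedness ensures that `sSup` is the true supremum rather than its default value $0$.
  have hbdd : BddAbove {x : ℝ | ∃ s r : ℝ, 0 < s ∧ s < r ∧ r ≤ T ∧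
      x = |f r - f s| / |r - s| ^ lam} := by
    refine ⟨M, ?_⟩
    rintro x ⟨s, r, hs, hsr, hr, rfl⟩
    have : 0 < |r - s| := abs_pos.2 (by linarith)
    rw [div_le_iff₀ (by positivity)]
    exact hM s ⟨hs.le, by linarith⟩ r ⟨by linarith, hr⟩
  have hpos : ∀ s r : ℝ, 0 < s → s < r → r ≤ T →
      |f r - f s| ≤ holderNorm lam T f * |r - s| ^ lam := by
    intro s r hs hsr hr
    have : 0 < |r - s| := abs_pos.2 (by linarith)
    rw [← div_le_iff₀ (by positivity)]
    exact le_csSup hbdd ⟨s, r, hs, hsr, hr, rfl⟩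
  have hlt : ∀ s r : ℝ, 0 ≤ s → s < r → r ≤ T →
      |f r - f s| ≤ holderNorm lam T f * |r - s| ^ lam := by
    intro s r hs hsr hr
    rcases hs.eq_or_lt with h0 | h0
    swap
    · exact hpos s r h0 hsr hr
    subst h0
    have hT : 0 < T := by linarith
    -- The supremum in the norm omits $s=0$; that case is recovered by letting $s\downarrow0$.
    have hne : (nhdsWithin (0 : ℝ) (Ioo 0 r)).NeBot := by
      rw [nhdsWithin_Ioo_eq_nhdsGT hsr]; infer_instance
    have hc := continuousOn_of_holder hlam hM 0 ⟨le_rfl, hT.le⟩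
    have hc' : Filter.Tendsto f (nhdsWithin 0 (Ioo 0 r)) (nhds (f 0)) :=
      hc.mono_left (nhdsWithin_mono _ fun x hx => ⟨hx.1.le, by linarith [hx.2]⟩)
    have hR : ContinuousAt (fun s => holderNorm lam T f * |r - s| ^ lam) 0 :=
      continuousAt_const.mul (ContinuousAt.rpow_const (by fun_prop) (.inr hlam.le))
    refine le_of_tendsto_of_tendsto (hc'.const_sub (f r)).abs
      (hR.tendsto.mono_left nhdsWithin_le_nhds) ?_
    filter_upwards [self_mem_nhdsWithin] with s hs'
    exact hpos s r hs'.1 hs'.2 hr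
  intro s hs r hr
  rcases lt_trichotomy s r with h | h | h
  · exact hlt s r hs.1 h hr.2
  · subst h
    simp [Real.zero_rpow hlam.ne']
  · rw [abs_sub_comm, abs_sub_comm r s]
    exact hlt r s hr.1 h hs.2

section Holder

variable {H lam T M : ℝ} {f : ℝ → ℝ}

/-- Comparison with the two weighted kernels: $|f(t)-f(s)|\le M(t-s)^\lambda$ handles the
singularity at $s=t$, and $|f(s)|\le Ms^\lambda$, from $f(0)=0$, the one at $s=0$. -/
lemma fracOpConverges_of_holder (hH0 : 0 < H) (hH1 : H < 1 / 2) (hlam : 1 / 2 - H < lam)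
    (hf0 : f 0 = 0) (hf : ∀ s ∈ Icc 0 T, ∀ r ∈ Icc 0 T, |f r - f s| ≤ M * |r - s| ^ lam)
    {t : ℝ} (ht : t ∈ Icc 0 T) : FracOpConverges H f t := by
  rcases ht.1.eq_or_lt with h0 | h0
  · rw [← h0]; exact fracOpConverges_zero H f
  have hc := continuousOn_of_holder (by linarith) hf
  have hcm : AEStronglyMeasurable f (volume.restrict (Ioo 0 t)) :=
    (hc.mono fun s hs => ⟨hs.1.le, by linarith [hs.2, ht.2]⟩).aestronglyMeasurable measurableSet_Ioo
  rw [fracOpConverges_iff hH0 hH1 h0]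
  constructor
  · refine ((integrableOn_kernelOneDeriv hH0 hH1 hlam h0).const_mul M).mono'
      ((aestronglyMeasurable_const.sub hcm).mul (measurable_kernelOneDeriv H t).aestronglyMeasurable)
      ((ae_restrict_iff' measurableSet_Ioo).2 (.of_forall fun s hs => ?_))
    have h1 := hf s ⟨hs.1.le, by linarith [hs.2, ht.2]⟩ t ht
    have h2 := kernelOneDeriv_nonneg hH1 hs.1 hs.2
    rw [abs_of_pos (show 0 < t - s by linarith [hs.2])] at h1
    rw [Real.norm_eq_abs, abs_mul, abs_of_nonneg h2, ← mul_assoc]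
    exact mul_le_mul_of_nonneg_right h1 h2
  · refine ((integrableOn_kernelTwoNegDeriv hH0 hH1 hlam h0).const_mul M).mono'
      ((measurable_kernelTwoNegDeriv hH0 hH1 t).aestronglyMeasurable.mul hcm)
      ((ae_restrict_iff' measurableSet_Ioo).2 (.of_forall fun s hs => ?_))
    have h1 := hf 0 ⟨le_rfl, by linarith [ht.2]⟩ s ⟨hs.1.le, by linarith [hs.2, ht.2]⟩
    have h2 := kernelTwoNegDeriv_nonneg hH1 hs.1 hs.2
    rw [hf0, sub_zero, sub_zero, abs_of_pos hs.1] at h1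
    rw [Real.norm_eq_abs, abs_mul, abs_of_nonneg h2, ← mul_assoc, mul_comm]
    exact mul_le_mul_of_nonneg_right h1 h2

/-- The norm bound of the operator from Hölder functions to bounded functions. -/
def fracOpBound (H lam : ℝ) : ℝ :=
  (∫ u in Ioo 0 1, (1 - u) ^ lam * kernelOneDeriv H 1 u) +
    ∫ u in Ioo 0 1, u ^ lam * kernelTwoNegDeriv H 1 u

lemma fracOpBound_nonneg (hH1 : H < 1 / 2) : 0 ≤ fracOpBound H lam := by
  refine add_nonneg (setIntegral_nonneg measurableSet_Ioo fun u hu => ?_)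
    (setIntegral_nonneg measurableSet_Ioo fun u hu => ?_)
  · exact mul_nonneg (Real.rpow_nonneg (by linarith [hu.2]) _) (kernelOneDeriv_nonneg hH1 hu.1 hu.2)
  · exact mul_nonneg (Real.rpow_nonneg hu.1.le _) (kernelTwoNegDeriv_nonneg hH1 hu.1 hu.2)

lemma abs_fracOp_integrand_one_le (hH1 : H < 1 / 2)
    (hf : ∀ s ∈ Icc 0 T, ∀ r ∈ Icc 0 T, |f r - f s| ≤ M * |r - s| ^ lam)
    {t u : ℝ} (ht0 : 0 < t) (ht : t ≤ T) (hu : u ∈ Ioo (0 : ℝ) 1) :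
    ‖(f t - f (t * u)) * kernelOneDeriv H 1 u‖
      ≤ M * t ^ lam * ((1 - u) ^ lam * kernelOneDeriv H 1 u) := by
  have hu1 : 0 < 1 - u := by linarith [hu.2]
  have htu : t * u ≤ t := by nlinarith [hu.2]
  have h1 := hf (t * u) ⟨(mul_pos ht0 hu.1).le, by linarith⟩ t ⟨ht0.le, ht⟩
  have h2 := kernelOneDeriv_nonneg hH1 hu.1 hu.2
  rw [show t - t * u = t * (1 - u) by ring, abs_of_pos (a := t * (1 - u)) (by positivity),
    Real.mul_rpow ht0.le hu1.le, ← mul_assoc] at h1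
  rw [Real.norm_eq_abs, abs_mul, abs_of_nonneg h2, ← mul_assoc]
  exact mul_le_mul_of_nonneg_right h1 h2

lemma abs_fracOp_integrand_two_le (hH1 : H < 1 / 2) (hf0 : f 0 = 0)
    (hf : ∀ s ∈ Icc 0 T, ∀ r ∈ Icc 0 T, |f r - f s| ≤ M * |r - s| ^ lam)
    {t u : ℝ} (ht0 : 0 < t) (ht : t ≤ T) (hu : u ∈ Ioo (0 : ℝ) 1) :
    ‖kernelTwoNegDeriv H 1 u * f (t * u)‖
      ≤ M * t ^ lam * (u ^ lam * kernelTwoNegDeriv H 1 u) := by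
  have htu : t * u ≤ t := by nlinarith [hu.2]
  have h1 := hf 0 ⟨le_rfl, by linarith⟩ (t * u) ⟨(mul_pos ht0 hu.1).le, by linarith⟩
  have h2 := kernelTwoNegDeriv_nonneg hH1 hu.1 hu.2
  rw [hf0, sub_zero, sub_zero, abs_of_pos (mul_pos ht0 hu.1),
    Real.mul_rpow ht0.le hu.1.le, ← mul_assoc] at h1
  rw [Real.norm_eq_abs, abs_mul, abs_of_nonneg h2, ← mul_assoc, mul_comm]
  exact mul_le_mul_of_nonneg_right h1 h2

lemma abs_fracOp_le (hH0 : 0 < H) (hH1 : H < 1 / 2) (hlam : 1 / 2 - H < lam)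
    (hf0 : f 0 = 0) (hf : ∀ s ∈ Icc 0 T, ∀ r ∈ Icc 0 T, |f r - f s| ≤ M * |r - s| ^ lam)
    {t : ℝ} (ht : t ∈ Icc 0 T) :
    |fracOp H f t| ≤ fracOpBound H lam * t ^ (H - 1 / 2 + lam) * M := by
  rcases ht.1.eq_or_lt with h0 | h0
  · rw [← h0, fracOp_zero, Real.zero_rpow (by linarith)]
    simp
  rw [fracOp_eq_scaled hH0 hH1 h0, abs_mul, abs_of_nonneg (Real.rpow_nonneg h0.le _),
    Real.rpow_add h0]
  have h1 : ‖∫ u in Ioo 0 1, (f t - f (t * u)) * kernelOneDeriv H 1 u‖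
      ≤ M * t ^ lam * ∫ u in Ioo 0 1, (1 - u) ^ lam * kernelOneDeriv H 1 u := by
    rw [← integral_const_mul]
    refine norm_integral_le_of_norm_le ((integrableOn_kernelOneDeriv_unit hH0 hH1 hlam).const_mul _)
      ((ae_restrict_iff' measurableSet_Ioo).2 (.of_forall fun u hu => ?_))
    exact abs_fracOp_integrand_one_le hH1 hf h0 ht.2 hu
  have h2 : ‖∫ u in Ioo 0 1, kernelTwoNegDeriv H 1 u * f (t * u)‖
      ≤ M * t ^ lam * ∫ u in Ioo 0 1, u ^ lam * kernelTwoNegDeriv H 1 u := by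
    rw [← integral_const_mul]
    refine norm_integral_le_of_norm_le
      ((integrableOn_kernelTwoNegDeriv_unit hH0 hH1 hlam).const_mul _)
      ((ae_restrict_iff' measurableSet_Ioo).2 (.of_forall fun u hu => ?_))
    exact abs_fracOp_integrand_two_le hH1 hf0 hf h0 ht.2 hu
  rw [Real.norm_eq_abs] at h1 h2
  have h3 := (abs_add_le (∫ u in Ioo 0 1, (f t - f (t * u)) * kernelOneDeriv H 1 u)
    (∫ u in Ioo 0 1, kernelTwoNegDeriv H 1 u * f (t * u))).trans (add_le_add h1 h2)
  calc _ ≤ t ^ (H - 1 / 2) * _ := mul_le_mul_of_nonneg_left h3 (Real.rpow_nonneg h0.le _)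
    _ = _ := by unfold fracOpBound; ring

/-- For $t>0$, dominated convergence in the scaled formula. At $t=0$ the prefactor $t^{H-1/2}$ is
singular, and the bound by a multiple of $t^{H-1/2+\lambda}$ is used instead. -/
lemma continuousOn_fracOp (hH0 : 0 < H) (hH1 : H < 1 / 2) (hlam : 1 / 2 - H < lam)
    (hf0 : f 0 = 0) (hf : ∀ s ∈ Icc 0 T, ∀ r ∈ Icc 0 T, |f r - f s| ≤ M * |r - s| ^ lam) :
    ContinuousOn (fracOp H f) (Icc 0 T) := by
  have hc := continuousOn_of_holder (by linarith) hf
  intro t ht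
  rcases ht.1.eq_or_lt with h0 | h0
  · subst h0
    rw [ContinuousWithinAt, fracOp_zero]
    refine squeeze_zero_norm' (a := fun t => fracOpBound H lam * t ^ (H - 1 / 2 + lam) * M) ?_ ?_
    · filter_upwards [self_mem_nhdsWithin] with t ht
      exact abs_fracOp_le hH0 hH1 hlam hf0 hf ht
    · have : ContinuousAt (fun t : ℝ => fracOpBound H lam * t ^ (H - 1 / 2 + lam) * M) 0 :=
        (continuousAt_const.mul (Real.continuousAt_rpow_const _ _ (.inr (by linarith)))).mul
          continuousAt_const
      have h := this.tendsto
      rw [Real.zero_rpow (by linarith), mul_zero, zero_mul] at h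
      exact h.mono_left nhdsWithin_le_nhds
  have hM : 0 ≤ M := by
    have h1 := (abs_nonneg _).trans (hf 0 ⟨le_rfl, by linarith [ht.2]⟩ t ht)
    rw [sub_zero, abs_of_pos h0] at h1
    exact nonneg_of_mul_nonneg_left h1 (Real.rpow_pos_of_pos h0 _)
  have hmem : Ioc 0 T ∈ nhdsWithin t (Icc 0 T) := by
    have : Ioi 0 ∩ Icc 0 T ⊆ Ioc 0 T := fun x hx => ⟨hx.1, hx.2.2⟩
    exact Filter.mem_of_superset (Filter.inter_mem (mem_nhdsWithin_of_mem_nhds (Ioi_mem_nhds h0))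
      self_mem_nhdsWithin) this
  have hmaps : ∀ u ∈ Ioo (0 : ℝ) 1, ContinuousWithinAt (fun t => f (t * u)) (Icc 0 T) t := by
    intro u hu
    have hm : MapsTo (fun t => t * u) (Icc 0 T) (Icc 0 T) := fun x hx =>
      ⟨mul_nonneg hx.1 hu.1.le, by nlinarith [hx.1, hx.2, hu.2]⟩
    exact (hc.comp (by fun_prop) hm) t ht
  have hmeas : ∀ t ∈ Ioc 0 T, AEStronglyMeasurable (fun u => f (t * u))
      (volume.restrict (Ioo 0 1)) := by
    intro t ht
    refine ContinuousOn.aestronglyMeasurable ?_ measurableSet_Ioo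
    exact hc.comp (by fun_prop) fun u hu =>
      ⟨(mul_pos ht.1 hu.1).le, by nlinarith [ht.1, ht.2, hu.2]⟩
  have hpow : ∀ t ∈ Ioc 0 T, t ^ lam ≤ T ^ lam := fun t ht =>
    Real.rpow_le_rpow ht.1.le ht.2 (by linarith)
  have hI1 : ContinuousWithinAt
      (fun t => ∫ u in Ioo 0 1, (f t - f (t * u)) * kernelOneDeriv H 1 u) (Icc 0 T) t := by
    refine continuousWithinAt_of_dominated
      (bound := fun u => M * T ^ lam * ((1 - u) ^ lam * kernelOneDeriv H 1 u)) ?_ ?_ ?_ ?_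
    · filter_upwards [hmem] with t ht
      exact (aestronglyMeasurable_const.sub (hmeas t ht)).mul
        (measurable_kernelOneDeriv H 1).aestronglyMeasurable
    · filter_upwards [hmem] with t ht
      refine (ae_restrict_iff' measurableSet_Ioo).2 (.of_forall fun u hu => ?_)
      refine (abs_fracOp_integrand_one_le hH1 hf ht.1 ht.2 hu).trans ?_
      refine mul_le_mul_of_nonneg_right (mul_le_mul_of_nonneg_left (hpow t ht) hM) ?_
      exact mul_nonneg (Real.rpow_nonneg (by linarith [hu.2]) _)
        (kernelOneDeriv_nonneg hH1 hu.1 hu.2)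
    · exact (integrableOn_kernelOneDeriv_unit hH0 hH1 hlam).const_mul _
    · refine (ae_restrict_iff' measurableSet_Ioo).2 (.of_forall fun u hu => ?_)
      exact ((hc t ht).sub (hmaps u hu)).mul continuousWithinAt_const
  have hI2 : ContinuousWithinAt
      (fun t => ∫ u in Ioo 0 1, kernelTwoNegDeriv H 1 u * f (t * u)) (Icc 0 T) t := by
    refine continuousWithinAt_of_dominated
      (bound := fun u => M * T ^ lam * (u ^ lam * kernelTwoNegDeriv H 1 u)) ?_ ?_ ?_ ?_
    · filter_upwards [hmem] with t ht
      exact (measurable_kernelTwoNegDeriv hH0 hH1 1).aestronglyMeasurable.mul (hmeas t ht)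
    · filter_upwards [hmem] with t ht
      refine (ae_restrict_iff' measurableSet_Ioo).2 (.of_forall fun u hu => ?_)
      refine (abs_fracOp_integrand_two_le hH1 hf0 hf ht.1 ht.2 hu).trans ?_
      refine mul_le_mul_of_nonneg_right (mul_le_mul_of_nonneg_left (hpow t ht) hM) ?_
      exact mul_nonneg (Real.rpow_nonneg hu.1.le _) (kernelTwoNegDeriv_nonneg hH1 hu.1 hu.2)
    · exact (integrableOn_kernelTwoNegDeriv_unit hH0 hH1 hlam).const_mul _
    · refine (ae_restrict_iff' measurableSet_Ioo).2 (.of_forall fun u hu => ?_)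
      exact continuousWithinAt_const.mul (hmaps u hu)
  have hp : ContinuousWithinAt (fun t : ℝ => t ^ (H - 1 / 2)) (Icc 0 T) t :=
    (Real.continuousAt_rpow_const _ _ (.inl h0.ne')).continuousWithinAt
  refine (hp.mul (hI1.add hI2)).congr_of_eventuallyEq ?_ (fracOp_eq_scaled hH0 hH1 h0 f)
  filter_upwards [hmem] with t ht
  exact fracOp_eq_scaled hH0 hH1 ht.1 f

end Holder

lemma fracOp_linear {H t : ℝ} {f g : ℝ → ℝ} (hf : FracOpConverges H f t)
    (hg : FracOpConverges H g t) (a b : ℝ) :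
    fracOp H (fun s => a * f s + b * g s) t = a * fracOp H f t + b * fracOp H g t := by
  unfold fracOp
  have e1 : ∀ s, (a * f t + b * g t - (a * f s + b * g s)) * deriv (fun r => kernelOne H t r) s
      = a * ((f t - f s) * deriv (fun r => kernelOne H t r) s) +
        b * ((g t - g s) * deriv (fun r => kernelOne H t r) s) := fun s => by ring
  have e2 : ∀ s, deriv (fun r => kernelTwo H t r) s * (a * f s + b * g s)
      = a * (deriv (fun r => kernelTwo H t r) s * f s) +
        b * (deriv (fun r => kernelTwo H t r) s * g s) := fun s => by ring
  simp_rw [e1, e2]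
  rw [intervalIntegral.integral_add (hf.1.const_mul a) (hg.1.const_mul b),
    intervalIntegral.integral_add (hf.2.const_mul a) (hg.2.const_mul b)]
  simp_rw [intervalIntegral.integral_const_mul]
  ring

/-- `Λ_H` is a bounded linear operator from Hölder functions to continuous functions. -/
theorem fracOp_bounded_linear {H lam : ℝ} (hH0 : 0 < H) (hH1 : H < 1 / 2)
    (hlam : 1 / 2 - H < lam) :
    ∃ C : ℝ, ∀ T : ℝ, 0 < T → ∀ f : ℝ → ℝ, MemHolderZero lam T f →
      (∀ t ∈ Icc 0 T, FracOpConverges H f t) ∧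
      ContinuousOn (fracOp H f) (Icc 0 T) ∧
      (∀ t ∈ Icc 0 T, |fracOp H f t| ≤ C * T ^ (H - 1 / 2 + lam) * holderNorm lam T f) ∧
      (∀ g : ℝ → ℝ, MemHolderZero lam T g → ∀ a b : ℝ, ∀ t ∈ Icc 0 T,
        fracOp H (fun s => a * f s + b * g s) t = a * fracOp H f t + b * fracOp H g t) := by
  have hl : 0 < lam := by linarith
  refine ⟨fracOpBound H lam, fun T hT f hf => ?_⟩
  have hf' := abs_sub_le_holderNorm hl hf
  refine ⟨fun t ht => fracOpConverges_of_holder hH0 hH1 hlam hf.1 hf' ht,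
    continuousOn_fracOp hH0 hH1 hlam hf.1 hf', fun t ht => ?_, fun g hg a b t ht => ?_⟩
  · refine (abs_fracOp_le hH0 hH1 hlam hf.1 hf' ht).trans ?_
    have hN : 0 ≤ holderNorm lam T f := by
      have h := (abs_nonneg _).trans (hf' 0 ⟨le_rfl, hT.le⟩ T ⟨hT.le, le_rfl⟩)
      rw [sub_zero, abs_of_pos hT] at h
      exact nonneg_of_mul_nonneg_left h (Real.rpow_pos_of_pos hT _)
    have hp : t ^ (H - 1 / 2 + lam) ≤ T ^ (H - 1 / 2 + lam) :=
      Real.rpow_le_rpow ht.1 ht.2 (by linarith)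
    exact mul_le_mul_of_nonneg_right
      (mul_le_mul_of_nonneg_left hp (fracOpBound_nonneg hH1)) hN
  · exact fracOp_linear (fracOpConverges_of_holder hH0 hH1 hlam hf.1 hf' ht)
      (fracOpConverges_of_holder hH0 hH1 hlam hg.1 (abs_sub_le_holderNorm hl hg) ht) a b

end

/-! ### Kolmogorov's continuity theorem by dyadic increments. -/

noncomputable section

/-- The largest multiple of `2⁻ⁿ` below `t ≥ 0`. -/
def dyadicFloor (n : ℕ) (t : ℝ) : ℝ := (⌊2 ^ n * t⌋₊ : ℝ) / 2 ^ n

lemma dyadicFloor_le {t : ℝ} (ht : 0 ≤ t) (n : ℕ) : dyadicFloor n t ≤ t := by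
  rw [dyadicFloor, div_le_iff₀ (by positivity), mul_comm]
  exact Nat.floor_le (by positivity)

lemma lt_dyadicFloor_add (t : ℝ) (n : ℕ) : t < dyadicFloor n t + 1 / 2 ^ n := by
  rw [dyadicFloor, ← add_div, lt_div_iff₀ (by positivity), mul_comm]
  exact Nat.lt_floor_add_one _

section Path

variable {y : ℝ → ℝ} {C ρ : ℝ}

lemma abs_sub_le_of_floor_succ {n : ℕ}
    (hC : ∀ k : ℕ, k < 2 ^ n → |y ((k + 1) / 2 ^ n) - y (k / 2 ^ n)| ≤ C)
    (hC0 : 0 ≤ C) {j k : ℕ} (hjk : j ≤ k) (hkj : k ≤ j + 1) (hk : k ≤ 2 ^ n) :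
    |y (k / 2 ^ n) - y (j / 2 ^ n)| ≤ C := by
  rcases Nat.eq_or_lt_of_le hjk with h | h
  · subst h; simpa using hC0
  · have : k = j + 1 := by omega
    subst this
    have := hC j (by omega)
    push_cast
    exact this

lemma floor_le_two_pow {t : ℝ} (ht : t ≤ 1) (n : ℕ) : ⌊2 ^ n * t⌋₊ ≤ 2 ^ n := by
  have : ⌊2 ^ n * t⌋₊ ≤ ⌊((2 ^ n : ℕ) : ℝ)⌋₊ := by
    refine Nat.floor_le_floor ?_
    push_cast
    have : (0 : ℝ) < 2 ^ n := by positivity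
    nlinarith
  rwa [Nat.floor_natCast] at this

/-- Halving the mesh moves the floor by zero or one step of the finer grid. -/
lemma abs_dyadicFloor_succ_sub_le
    (hC : ∀ n k : ℕ, k < 2 ^ n → |y ((k + 1) / 2 ^ n) - y (k / 2 ^ n)| ≤ C * ρ ^ n)
    (hC0 : 0 ≤ C) (hρ0 : 0 ≤ ρ) {t : ℝ} (ht : t ∈ Icc (0 : ℝ) 1) (n : ℕ) :
    |y (dyadicFloor (n + 1) t) - y (dyadicFloor n t)| ≤ C * ρ ^ (n + 1) := by
  have e : dyadicFloor n t = ((2 * ⌊2 ^ n * t⌋₊ : ℕ) : ℝ) / 2 ^ (n + 1) := by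
    rw [dyadicFloor, pow_succ]; push_cast; field_simp
  have ht0 : (0 : ℝ) ≤ 2 ^ n * t := mul_nonneg (by positivity) ht.1
  have h1 : 2 * ⌊2 ^ n * t⌋₊ ≤ ⌊2 ^ (n + 1) * t⌋₊ := by
    refine Nat.le_floor ?_
    push_cast
    have := Nat.floor_le ht0
    rw [pow_succ]; nlinarith
  have h2 : ⌊2 ^ (n + 1) * t⌋₊ ≤ 2 * ⌊2 ^ n * t⌋₊ + 1 := by
    refine Nat.le_of_lt_succ ((Nat.floor_lt (mul_nonneg (by positivity) ht.1)).2 ?_)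
    push_cast
    have := Nat.lt_floor_add_one (2 ^ n * t)
    rw [pow_succ]; nlinarith
  rw [e, dyadicFloor]
  exact abs_sub_le_of_floor_succ (hC (n + 1)) (by positivity) h1 h2 (floor_le_two_pow ht.2 _)

/-- Points at distance at most one mesh width have equal or adjacent floors. -/
lemma abs_dyadicFloor_sub_le {n : ℕ}
    (hC : ∀ k : ℕ, k < 2 ^ n → |y ((k + 1) / 2 ^ n) - y (k / 2 ^ n)| ≤ C) (hC0 : 0 ≤ C)
    {s r : ℝ} (hs : 0 ≤ s) (hr : r ≤ 1) (hsr : s ≤ r) (h : r - s ≤ 1 / 2 ^ n) :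
    |y (dyadicFloor n r) - y (dyadicFloor n s)| ≤ C := by
  refine abs_sub_le_of_floor_succ hC hC0 (Nat.floor_le_floor (by gcongr)) ?_
    (floor_le_two_pow hr _)
  rw [← Nat.floor_add_one (by positivity)]
  refine Nat.floor_le_floor ?_
  rw [le_div_iff₀ (by positivity)] at h
  linarith

/-- A function whose dyadic increments decay geometrically converges along dyadic floors to a
Hölder continuous function. -/
lemma holder_of_dyadic {γ : ℝ} (hγ : 0 < γ) (hC0 : 0 ≤ C)
    (hC : ∀ n k : ℕ, k < 2 ^ n →
      |y ((k + 1) / 2 ^ n) - y (k / 2 ^ n)| ≤ C * ((2 : ℝ) ^ (-γ)) ^ n) :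
    ∃ b : ℝ → ℝ, (∀ t ∈ Icc (0 : ℝ) 1,
      Filter.Tendsto (fun n => y (dyadicFloor n t)) Filter.atTop (nhds (b t))) ∧
      ∃ M, ∀ s ∈ Icc (0 : ℝ) 1, ∀ r ∈ Icc (0 : ℝ) 1, |b r - b s| ≤ M * |r - s| ^ γ := by
  set ρ : ℝ := (2 : ℝ) ^ (-γ) with hρ
  have hρ0 : 0 < ρ := by positivity
  have hρ1 : ρ < 1 := Real.rpow_lt_one_of_one_lt_of_neg (by norm_num) (by linarith)
  have hdist : ∀ t ∈ Icc (0 : ℝ) 1, ∀ n,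
      dist (y (dyadicFloor n t)) (y (dyadicFloor (n + 1) t)) ≤ C * ρ * ρ ^ n := by
    intro t ht n
    rw [dist_comm, Real.dist_eq]
    refine (abs_dyadicFloor_succ_sub_le hC hC0 hρ0.le ht n).trans (le_of_eq ?_)
    ring
  have hcauchy : ∀ t ∈ Icc (0 : ℝ) 1, ∃ l,
      Filter.Tendsto (fun n => y (dyadicFloor n t)) Filter.atTop (nhds l) := fun t ht =>
    cauchySeq_tendsto_of_complete (cauchySeq_of_le_geometric ρ (C * ρ) hρ1 (hdist t ht))
  choose! b hb using hcauchy
  have hbd : ∀ t ∈ Icc (0 : ℝ) 1, ∀ n, |y (dyadicFloor n t) - b t| ≤ C * ρ * ρ ^ n / (1 - ρ) := by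
    intro t ht n
    rw [← Real.dist_eq]
    exact dist_le_of_le_geometric_of_tendsto ρ (C * ρ) hρ1 (hdist t ht) (hb t ht) n
  -- Two geometric tails join $s$ and $r$ to their dyadic floors, $C$ pays for one grid step between
  -- the floors, and $2^\gamma$ for rounding $r-s$ up to a power of $\frac12$.
  refine ⟨b, hb, (2 * (C * ρ / (1 - ρ)) + C) * 2 ^ γ, ?_⟩
  have hlt : ∀ s ∈ Icc (0 : ℝ) 1, ∀ r ∈ Icc (0 : ℝ) 1, s < r →
      |b r - b s| ≤ (2 * (C * ρ / (1 - ρ)) + C) * 2 ^ γ * |r - s| ^ γ := by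
    intro s hs r hr hsr
    have hd : 0 < r - s := by linarith
    -- The level with $2^{-(n+1)}<r-s\le2^{-n}$.
    obtain ⟨n, hn1, hn2⟩ := exists_nat_pow_near_of_lt_one hd (by linarith [hs.1, hr.2])
      (show (0 : ℝ) < 1 / 2 by norm_num) (by norm_num)
    rw [one_div_pow] at hn1 hn2
    have h1 := hbd r hr n
    have h2 := hbd s hs n
    have h3 := abs_dyadicFloor_sub_le (hC n) (by positivity) hs.1 hr.2 hsr.le hn2
    have h4 : ρ ^ n ≤ 2 ^ γ * |r - s| ^ γ := by
      rw [abs_of_pos hd, ← Real.mul_rpow (by norm_num) hd.le, hρ, ← Real.rpow_natCast,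
        ← Real.rpow_mul (by norm_num)]
      have : (2 : ℝ) ^ (-γ * n) = (1 / 2 ^ n) ^ γ := by
        rw [one_div, Real.inv_rpow (by positivity), ← Real.rpow_natCast 2 n,
          ← Real.rpow_mul (by norm_num), ← Real.rpow_neg (by norm_num)]
        congr 1; ring
      rw [this]
      refine Real.rpow_le_rpow (by positivity) ?_ hγ.le
      rw [pow_succ] at hn1
      have h5 : (1 : ℝ) / (2 ^ n * 2) = 1 / 2 ^ n / 2 := by rw [div_div]
      rw [h5] at hn1
      linarith
    have h6 : |b r - b s| ≤ |y (dyadicFloor n r) - b r| + |y (dyadicFloor n s) - b s| +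
        |y (dyadicFloor n r) - y (dyadicFloor n s)| := by
      have : b r - b s = -(y (dyadicFloor n r) - b r) + (y (dyadicFloor n s) - b s) +
        (y (dyadicFloor n r) - y (dyadicFloor n s)) := by ring
      rw [this]
      refine (abs_add_le _ _).trans (add_le_add_left ((abs_add_le _ _).trans ?_) _)
      rw [abs_neg]
    have hK : 0 ≤ 2 * (C * ρ / (1 - ρ)) + C := by
      have : 0 < 1 - ρ := by linarith
      positivity
    calc |b r - b s| ≤ _ := h6
      _ ≤ C * ρ * ρ ^ n / (1 - ρ) + C * ρ * ρ ^ n / (1 - ρ) + C * ρ ^ n :=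
        add_le_add (add_le_add h1 h2) h3
      _ = (2 * (C * ρ / (1 - ρ)) + C) * ρ ^ n := by ring
      _ ≤ _ := by rw [mul_assoc]; exact mul_le_mul_of_nonneg_left h4 hK
  intro s hs r hr
  rcases lt_trichotomy s r with h | h | h
  · exact hlt s hs r hr h
  · subst h
    simp [Real.zero_rpow hγ.ne']
  · rw [abs_sub_comm, abs_sub_comm r s]
    exact hlt r hr s hs h

end Path

/-- The weighted sum of the `2m`-th powers of all dyadic increments on `[0,1]`. -/
def dyadicSum {Ω : Type*} (Y : ℝ → Ω → ℝ) (m : ℕ) (ω : Ω) : ENNReal :=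
  ∑' n : ℕ, ∑ k ∈ Finset.range (2 ^ n),
    -- The power of the increment is $2(m+2)$. Brownian moments then bound the expected level-$n$
    -- sum by a multiple of $2^n2^{nm}2^{-n(m+2)}=2^{-n}$, which is summable.
    (2 ^ n : ENNReal) ^ m * ‖Y ((k + 1) / 2 ^ n) ω - Y (k / 2 ^ n) ω‖ₑ ^ (2 * (m + 2))

/-- Each single term is at most the whole sum; the root of order $2(m+2)$ yields the Hölder exponent
$m/(2(m+2))$, which tends to $\frac12$ as $m$ grows. -/
lemma dyadic_bound_of_dyadicSum {Ω : Type*} {Y : ℝ → Ω → ℝ} {m : ℕ} {ω : Ω} (h : dyadicSum Y m ω ≠ ⊤) :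
    ∃ C, 0 ≤ C ∧ ∀ n k : ℕ, k < 2 ^ n → |Y ((k + 1) / 2 ^ n) ω - Y (k / 2 ^ n) ω|
      ≤ C * ((2 : ℝ) ^ (-((m : ℝ) / (2 * (m + 2))))) ^ n := by
  set S := (dyadicSum Y m ω).toReal with hS
  have hS0 : 0 ≤ S := ENNReal.toReal_nonneg
  set p : ℕ := 2 * (m + 2) with hp
  have hp0 : p ≠ 0 := by omega
  refine ⟨S ^ (1 / (p : ℝ)), by positivity, fun n k hk => ?_⟩
  set x := |Y ((k + 1) / 2 ^ n) ω - Y (k / 2 ^ n) ω| with hx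
  have h1 : (2 ^ n : ENNReal) ^ m * ‖Y ((k + 1) / 2 ^ n) ω - Y (k / 2 ^ n) ω‖ₑ ^ p
      ≤ dyadicSum Y m ω := by
    refine le_trans ?_ (ENNReal.le_tsum n)
    exact Finset.single_le_sum (f := fun k : ℕ => (2 ^ n : ENNReal) ^ m *
      ‖Y ((k + 1) / 2 ^ n) ω - Y (k / 2 ^ n) ω‖ₑ ^ p) (fun _ _ => by positivity)
      (Finset.mem_range.2 hk)
  have h2 : ((2 : ℝ) ^ n) ^ m * x ^ p ≤ S := by
    have := ENNReal.toReal_mono h h1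
    simpa [ENNReal.toReal_mul, ENNReal.toReal_pow, hx] using this
  have hx0 : 0 ≤ x := abs_nonneg _
  refine le_of_pow_le_pow_left₀ hp0 (by positivity) ?_
  rw [mul_pow, ← Real.rpow_natCast (S ^ (1 / (p : ℝ))), ← Real.rpow_mul hS0,
    one_div_mul_cancel (by exact_mod_cast hp0), Real.rpow_one]
  have e : (((2 : ℝ) ^ (-((m : ℝ) / (2 * (m + 2))))) ^ n) ^ p = (((2 : ℝ) ^ n) ^ m)⁻¹ := by
    rw [← pow_mul, ← pow_mul, ← Real.rpow_natCast, ← Real.rpow_mul (by norm_num),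
      ← Real.rpow_natCast, ← Real.rpow_neg (by norm_num)]
    congr 1
    rw [hp]
    push_cast
    field_simp
  rw [e, ← div_eq_mul_inv, le_div_iff₀ (by positivity), mul_comm]
  exact h2

section Modification

variable {Ω : Type*} [MeasurableSpace Ω] {P : Measure Ω} {Y : ℝ → Ω → ℝ}

lemma measurable_dyadicSum (hY : ∀ t, Measurable (Y t)) (m : ℕ) :
    Measurable (dyadicSum Y m) := by
  unfold dyadicSum
  refine Measurable.tsum fun n => Finset.measurable_sum _ fun k _ => ?_
  exact (((hY _).sub (hY _)).enorm.pow_const _).const_mul _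

lemma ofReal_abs_dyadic (n k : ℕ) :
    ENNReal.ofReal |((k : ℝ) + 1) / 2 ^ n - k / 2 ^ n| = (2 ^ n : ENNReal)⁻¹ := by
  have : ((k : ℝ) + 1) / 2 ^ n - k / 2 ^ n = (2 ^ n)⁻¹ := by field_simp; ring
  rw [this, abs_of_pos (by positivity), ENNReal.ofReal_inv_of_pos (by positivity),
    ENNReal.ofReal_pow (by norm_num)]
  simp

lemma lintegral_dyadicSum_lt_top (hY : ∀ t, Measurable (Y t)) {m : ℕ} {c : ENNReal} (hc : c ≠ ⊤)
    (h : ∀ s t, ∫⁻ ω, ‖Y t ω - Y s ω‖ₑ ^ (2 * (m + 2)) ∂P ≤ c * ENNReal.ofReal |t - s| ^ (m + 2)) :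
    ∫⁻ ω, dyadicSum Y m ω ∂P < ⊤ := by
  have hmeas : ∀ n k : ℕ, Measurable fun ω => (2 ^ n : ENNReal) ^ m *
      ‖Y ((k + 1) / 2 ^ n) ω - Y (k / 2 ^ n) ω‖ₑ ^ (2 * (m + 2)) := fun n k =>
    (((hY _).sub (hY _)).enorm.pow_const _).const_mul _
  unfold dyadicSum
  rw [lintegral_tsum fun n => (Finset.measurable_sum _ fun k _ => hmeas n k).aemeasurable]
  calc ∑' n : ℕ, ∫⁻ ω, ∑ k ∈ Finset.range (2 ^ n), (2 ^ n : ENNReal) ^ m *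
          ‖Y ((k + 1) / 2 ^ n) ω - Y (k / 2 ^ n) ω‖ₑ ^ (2 * (m + 2)) ∂P
      ≤ ∑' n : ℕ, c * (2⁻¹ : ENNReal) ^ n := by
        refine ENNReal.tsum_le_tsum fun n => ?_
        rw [lintegral_finsetSum _ fun k _ => hmeas n k]
        calc ∑ k ∈ Finset.range (2 ^ n), ∫⁻ ω, (2 ^ n : ENNReal) ^ m *
              ‖Y ((k + 1) / 2 ^ n) ω - Y (k / 2 ^ n) ω‖ₑ ^ (2 * (m + 2)) ∂P
            ≤ ∑ k ∈ Finset.range (2 ^ n), (2 ^ n : ENNReal) ^ m *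
              (c * ((2 ^ n : ENNReal)⁻¹) ^ (m + 2)) := by
              refine Finset.sum_le_sum fun k _ => ?_
              rw [lintegral_const_mul' _ _ (by finiteness)]
              gcongr
              rw [← ofReal_abs_dyadic n k]
              exact h _ _
          _ = c * (2⁻¹ : ENNReal) ^ n := by
              rw [Finset.sum_const, Finset.card_range, nsmul_eq_mul, pow_add, sq]
              have h2 : (2 ^ n : ENNReal) * (2 ^ n : ENNReal)⁻¹ = 1 :=
                ENNReal.mul_inv_cancel (by simp) (by simp)
              push_cast
              calc (2 ^ n : ENNReal) * ((2 ^ n) ^ m * (c * ((2 ^ n : ENNReal)⁻¹ ^ m *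
                    ((2 ^ n : ENNReal)⁻¹ * (2 ^ n : ENNReal)⁻¹))))
                  = c * ((2 ^ n : ENNReal) * (2 ^ n : ENNReal)⁻¹) ^ (m + 1) * (2 ^ n : ENNReal)⁻¹ := by
                    rw [mul_pow, pow_succ, pow_succ]; ring
                _ = _ := by rw [h2, one_pow, mul_one, ENNReal.inv_pow]
    _ = c * ∑' n : ℕ, (2⁻¹ : ENNReal) ^ n := ENNReal.tsum_mul_left
    _ < ⊤ := by
        rw [ENNReal.tsum_geometric]
        refine ENNReal.mul_lt_top hc.lt_top ?_
        simp

/-- The second moments are at most $c\,2^{-n}$, so the sum of the squares is almost surely finite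
and its terms tend to zero. This identifies the dyadic limit with the original process. -/
lemma ae_tendsto_dyadicFloor (hY : ∀ t, Measurable (Y t)) {c : ENNReal} (hc : c ≠ ⊤)
    (h : ∀ s t, ∫⁻ ω, ‖Y t ω - Y s ω‖ₑ ^ 2 ∂P ≤ c * ENNReal.ofReal |t - s|) {t : ℝ} (ht : 0 ≤ t) :
    ∀ᵐ ω ∂P, Filter.Tendsto (fun n => Y (dyadicFloor n t) ω) Filter.atTop (nhds (Y t ω)) := by
  have hmeas : ∀ n, Measurable fun ω => ‖Y (dyadicFloor n t) ω - Y t ω‖ₑ ^ 2 := fun n =>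
    ((hY _).sub (hY _)).enorm.pow_const _
  have hfin : ∫⁻ ω, ∑' n, ‖Y (dyadicFloor n t) ω - Y t ω‖ₑ ^ 2 ∂P ≠ ⊤ := by
    rw [lintegral_tsum fun n => (hmeas n).aemeasurable]
    refine ne_top_of_le_ne_top (b := ∑' n : ℕ, c * (2⁻¹ : ENNReal) ^ n) ?_ ?_
    · rw [ENNReal.tsum_mul_left, ENNReal.tsum_geometric]
      exact ENNReal.mul_ne_top hc (by simp)
    · refine ENNReal.tsum_le_tsum fun n => (h _ _).trans ?_
      gcongr
      have h1 := dyadicFloor_le ht n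
      have h2 := lt_dyadicFloor_add t n
      refine (ENNReal.ofReal_le_ofReal (q := 1 / 2 ^ n) ?_).trans (le_of_eq ?_)
      · rw [abs_sub_comm, abs_of_nonneg (by linarith)]; linarith
      · rw [one_div, ENNReal.ofReal_inv_of_pos (by positivity), ENNReal.ofReal_pow (by norm_num),
          ← ENNReal.inv_pow]
        simp
  filter_upwards [ae_lt_top (Measurable.tsum hmeas) hfin] with ω hω
  have h0 := ENNReal.tendsto_atTop_zero_of_tsum_ne_top hω.ne
  rw [tendsto_iff_edist_tendsto_0]
  have h1 := ((ENNReal.continuous_rpow_const (y := 1 / 2)).tendsto 0).comp h0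
  rw [ENNReal.zero_rpow_of_pos (by norm_num)] at h1
  refine h1.congr fun n => ?_
  simp only [Function.comp]
  rw [edist_eq_enorm_sub, ← ENNReal.rpow_natCast, ← ENNReal.rpow_mul]
  norm_num

/-- **Kolmogorov continuity**: a process on the unit interval whose increments have Brownian moment
bounds has a modification all of whose paths are Hölder continuous of every order below `1/2`. -/
theorem exists_holder_modification_unit (hY : ∀ t, Measurable (Y t))
    (h : ∀ m : ℕ, ∃ c : ENNReal, c ≠ ⊤ ∧ ∀ s t,
      ∫⁻ ω, ‖Y t ω - Y s ω‖ₑ ^ (2 * m) ∂P ≤ c * ENNReal.ofReal |t - s| ^ m) :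
    ∃ B : ℝ → Ω → ℝ, (∀ t, Measurable (B t)) ∧ (∀ t ∈ Icc (0 : ℝ) 1, B t =ᵐ[P] Y t) ∧
      (∀ ω, ∀ γ : ℝ, 0 < γ → γ < 1 / 2 → ∃ M, 0 ≤ M ∧ ∀ s r, |B r ω - B s ω| ≤ M * |r - s| ^ γ) := by
  classical
  -- One event of full measure serves all Hölder orders. Off it the process is replaced by zero, so
  -- the path bounds hold for every `ω`.
  set G : Set Ω := {ω | ∀ m, dyadicSum Y m ω ≠ ⊤} with hG
  have hGm : MeasurableSet G := by
    rw [hG, Set.ofPred_forall]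
    exact MeasurableSet.iInter fun m =>
      (measurable_dyadicSum hY m) (measurableSet_singleton _).compl
  have hGae : ∀ᵐ ω ∂P, ω ∈ G := by
    refine ae_all_iff.2 fun m => ?_
    obtain ⟨c, hc, hm⟩ := h (m + 2)
    filter_upwards [ae_lt_top (measurable_dyadicSum hY m)
      (lintegral_dyadicSum_lt_top hY hc hm).ne] with ω hω using hω.ne
  have hγ : ∀ m : ℕ, 0 < m → (0 : ℝ) < (m : ℝ) / (2 * (m + 2)) := fun m hm => by positivity
  have hpath : ∀ ω ∈ G, ∀ m : ℕ, 0 < m → ∃ b : ℝ → ℝ, (∀ t ∈ Icc (0 : ℝ) 1,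
      Filter.Tendsto (fun n => Y (dyadicFloor n t) ω) Filter.atTop (nhds (b t))) ∧
      ∃ M, ∀ s ∈ Icc (0 : ℝ) 1, ∀ r ∈ Icc (0 : ℝ) 1,
        |b r - b s| ≤ M * |r - s| ^ ((m : ℝ) / (2 * (m + 2))) := by
    intro ω hω m hm
    obtain ⟨C, hC0, hC⟩ := dyadic_bound_of_dyadicSum (hω m)
    exact holder_of_dyadic (y := fun t => Y t ω) (hγ m hm) hC0 hC
  have hex : ∀ ω, ∃ b : ℝ → ℝ, ∀ t ∈ Icc (0 : ℝ) 1,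
      Filter.Tendsto (fun n => G.indicator (Y (dyadicFloor n t)) ω) Filter.atTop (nhds (b t)) := by
    intro ω
    by_cases hω : ω ∈ G
    · obtain ⟨b, hb, -⟩ := hpath ω hω 1 one_pos
      exact ⟨b, fun t ht => by simpa [hω] using hb t ht⟩
    · exact ⟨0, fun t ht => by simp [hω]⟩
  choose b hb using hex
  -- Clamping time to $[0,1]$ is a contraction, so the Hölder bound extends to all real times.
  set cl : ℝ → ℝ := fun t => max 0 (min t 1) with hcl
  have hclm : ∀ t, cl t ∈ Icc (0 : ℝ) 1 := fun t =>
    ⟨le_max_left _ _, max_le zero_le_one (min_le_right _ _)⟩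
  have hcl1 : ∀ t ∈ Icc (0 : ℝ) 1, cl t = t := fun t ht => by
    simp [hcl, ht.1, ht.2]
  have hcll : ∀ s t, |cl t - cl s| ≤ |t - s| := by
    intro s t
    refine (abs_max_sub_max_le_max 0 (min t 1) 0 (min s 1)).trans ?_
    rw [sub_self, abs_zero]
    refine max_le (abs_nonneg _) ((abs_min_sub_min_le_max t 1 s 1).trans ?_)
    rw [sub_self, abs_zero]
    exact max_le le_rfl (abs_nonneg _)
  refine ⟨fun t ω => b ω (cl t), fun t => ?_, fun t ht => ?_, fun ω γ hγ0 hγ1 => ?_⟩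
  · refine measurable_of_tendsto_metrizable (f := fun n => G.indicator (Y (dyadicFloor n (cl t))))
      (fun n => (hY _).indicator hGm) ?_
    rw [tendsto_pi_nhds]
    exact fun ω => hb ω (cl t) (hclm t)
  · obtain ⟨c, hc, hm⟩ := h 1
    have h1 := ae_tendsto_dyadicFloor (P := P) hY hc (by simpa using hm) ht.1
    filter_upwards [hGae, h1] with ω hω h1
    have h2 := hb ω t ht
    simp only [indicator_of_mem hω] at h2
    simp only [hcl1 t ht]
    exact tendsto_nhds_unique h2 h1
  · by_cases hω : ω ∈ G
    swap
    · refine ⟨0, le_rfl, fun s r => ?_⟩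
      have hz : ∀ t ∈ Icc (0 : ℝ) 1, b ω t = 0 := fun t ht => by
        have := hb ω t ht
        simp only [indicator_of_notMem hω] at this
        exact tendsto_nhds_unique this tendsto_const_nhds
      simp [hz _ (hclm r), hz _ (hclm s)]
    -- The threshold solves $\gamma=m/(2(m+2))$ for $m$.
    obtain ⟨m, hm⟩ := exists_nat_gt (4 * γ / (1 - 2 * γ))
    have hm' : 4 * γ < m * (1 - 2 * γ) := by
      rwa [div_lt_iff₀ (by linarith)] at hm
    have hm0 : 0 < m := by
      rcases Nat.eq_zero_or_pos m with h0 | h0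
      · subst h0; simp only [CharP.cast_eq_zero, zero_mul] at hm'; linarith
      · exact h0
    obtain ⟨b', hb', M, hM⟩ := hpath ω hω m hm0
    -- The paths obtained for different `m` are limits of the same sequence, hence equal.
    have heq : ∀ t ∈ Icc (0 : ℝ) 1, b ω t = b' t := fun t ht => by
      have := hb ω t ht
      simp only [indicator_of_mem hω] at this
      exact tendsto_nhds_unique this (hb' t ht)
    have hM0 : 0 ≤ M := by
      have := (abs_nonneg _).trans (hM 0 ⟨le_rfl, zero_le_one⟩ 1 ⟨zero_le_one, le_rfl⟩)
      simpa using this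
    refine ⟨M, hM0, fun s r => ?_⟩
    simp only [heq _ (hclm r), heq _ (hclm s)]
    refine (hM _ (hclm s) _ (hclm r)).trans (mul_le_mul_of_nonneg_left ?_ hM0)
    have hle1 : |cl r - cl s| ≤ 1 := by
      rw [abs_le]; constructor <;> linarith [(hclm r).1, (hclm r).2, (hclm s).1, (hclm s).2]
    have hγle : γ ≤ (m : ℝ) / (2 * (m + 2)) := by
      rw [le_div_iff₀ (by positivity)]; nlinarith
    refine le_trans ?_ (Real.rpow_le_rpow (abs_nonneg _) (hcll s r) hγ0.le)
    rcases (abs_nonneg (cl r - cl s)).eq_or_lt with h0 | h0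
    · rw [← h0, Real.zero_rpow hγ0.ne', Real.zero_rpow (by linarith)]
    · exact Real.rpow_le_rpow_of_exponent_ge h0 hle1 hγle

/-- The Kolmogorov continuity theorem on the interval `[0,T]`. -/
theorem exists_holder_modification {T : ℝ} (hT : 0 < T) (hY : ∀ t, Measurable (Y t))
    (h : ∀ m : ℕ, ∃ c : ENNReal, c ≠ ⊤ ∧ ∀ s t,
      ∫⁻ ω, ‖Y t ω - Y s ω‖ₑ ^ (2 * m) ∂P ≤ c * ENNReal.ofReal |t - s| ^ m) :
    ∃ B : ℝ → Ω → ℝ, (∀ t, Measurable (B t)) ∧ (∀ t ∈ Icc 0 T, B t =ᵐ[P] Y t) ∧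
      (∀ ω, ∀ γ : ℝ, 0 < γ → γ < 1 / 2 → ∃ M, 0 ≤ M ∧ ∀ s r, |B r ω - B s ω| ≤ M * |r - s| ^ γ) := by
  obtain ⟨B, hBm, hBY, hB⟩ := exists_holder_modification_unit (P := P) (Y := fun x => Y (T * x))
    (fun t => hY _) (fun m => by
      obtain ⟨c, hc, hm⟩ := h m
      refine ⟨c * ENNReal.ofReal T ^ m, ENNReal.mul_ne_top hc (by simp), fun s t => ?_⟩
      refine (hm _ _).trans (le_of_eq ?_)
      rw [← mul_sub, abs_mul, abs_of_pos hT, ENNReal.ofReal_mul hT.le, mul_pow, mul_assoc])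
  refine ⟨fun t => B (t / T), fun t => hBm _, fun t ht => ?_, fun ω γ h0 h1 => ?_⟩
  · have := hBY (t / T) ⟨div_nonneg ht.1 hT.le, (div_le_one hT).2 ht.2⟩
    simpa [mul_div_cancel₀ _ hT.ne'] using this
  · obtain ⟨M, hM0, hM⟩ := hB ω γ h0 h1
    refine ⟨M * (1 / T) ^ γ, by positivity, fun s r => (hM _ _).trans (le_of_eq ?_)⟩
    rw [← sub_div, abs_div, abs_of_pos hT, div_eq_mul_one_div,
      Real.mul_rpow (abs_nonneg _) (by positivity)]
    ring

end Modification

end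

/-! ### Isometries with Gaussian values. -/

noncomputable section

/-- Two families of vectors with the same Gram matrix, the first of which is total, are related by
a linear isometry. -/
theorem exists_linearIsometry_of_gram {ι W V : Type*}
    [NormedAddCommGroup W] [InnerProductSpace ℝ W] [CompleteSpace W]
    [NormedAddCommGroup V] [InnerProductSpace ℝ V] [CompleteSpace V] {k : ι → W} {x : ι → V}
    (hgram : ∀ i j, inner ℝ (k i) (k j) = inner ℝ (x i) (x j))
    (hdense : DenseRange (Finsupp.linearCombination ℝ k)) :
    ∃ I : W →ₗᵢ[ℝ] V, ∀ i, I (k i) = x i := by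
  -- Norms of linear combinations depend only on the Gram matrix, so the assignment is well defined
  -- and isometric on the span and extends by density.
  have hnorm : ∀ c, ‖Finsupp.linearCombination ℝ x c‖ = ‖Finsupp.linearCombination ℝ k c‖ := by
    intro c
    rw [← sq_eq_sq₀ (norm_nonneg _) (norm_nonneg _), ← real_inner_self_eq_norm_sq,
      ← real_inner_self_eq_norm_sq]
    simp only [Finsupp.linearCombination_apply, Finsupp.sum, sum_inner, inner_sum,
      real_inner_smul_left, real_inner_smul_right, hgram]
  have hle : ∃ C, ∀ c, ‖Finsupp.linearCombination ℝ x c‖ ≤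
      C * ‖Finsupp.linearCombination ℝ k c‖ := ⟨1, fun c => by rw [hnorm, one_mul]⟩
  set J := (Finsupp.linearCombination ℝ x).extendOfNorm (Finsupp.linearCombination ℝ k) with hJ
  have hJe : ∀ c, J (Finsupp.linearCombination ℝ k c) = Finsupp.linearCombination ℝ x c :=
    fun c => LinearMap.extendOfNorm_eq hdense hle c
  have hJn : ∀ w, ‖J w‖ = ‖w‖ := by
    intro w
    refine hdense.induction_on (p := fun w => ‖J w‖ = ‖w‖) w ?_ ?_
    · exact isClosed_eq J.continuous.norm continuous_norm
    · intro c
      rw [hJe, hnorm]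
  refine ⟨⟨J.toLinearMap, hJn⟩, fun i => ?_⟩
  have := hJe (Finsupp.single i 1)
  simpa using this

variable {Ω : Type*} [MeasurableSpace Ω] {P : Measure Ω}

/-- Finite families of images under an isonormal isometry are jointly Gaussian. -/
theorem hasGaussianLaw_pi_of_isonormal {W : Type*} [NormedAddCommGroup W]
    [InnerProductSpace ℝ W] {I : W →ₗᵢ[ℝ] Lp ℝ 2 P}
    (h : ∀ w, HasLaw (I w) (gaussianReal 0 (‖w‖ ^ 2).toNNReal) P)
    {ι : Type*} [Fintype ι] (w : ι → W) : HasGaussianLaw (fun ω i => I (w i) ω) P := by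
  classical
  have hm : ∀ w, Measurable (I w) := fun w => (Lp.stronglyMeasurable (I w)).measurable
  have hmp : Measurable (fun ω i => I (w i) ω) := measurable_pi_lambda _ fun i => hm _
  refine ⟨isGaussian_of_isGaussian_map fun L => ?_⟩
  rw [Measure.map_map (by fun_prop) hmp]
  -- Every linear functional of the vector is almost surely the image of one vector `v`, hence
  -- Gaussian.
  set v : W := ∑ i, L (Pi.single i 1) • w i with hv
  have hae : (L ∘ fun ω i => I (w i) ω) =ᵐ[P] I v := by
    have h1 : I v = ∑ i, L (Pi.single i 1) • I (w i) := by
      rw [hv, map_sum]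
      exact Finset.sum_congr rfl fun i _ => map_smul _ _ _
    have h2 : ∀ᵐ ω ∂P, ∀ i, (L (Pi.single i 1) • I (w i) : Lp ℝ 2 P) ω =
        L (Pi.single i 1) * I (w i) ω := by
      rw [ae_all_iff]
      intro i
      filter_upwards [Lp.coeFn_smul (L (Pi.single i 1)) (I (w i))] with ω hω
      rw [hω]
      rfl
    rw [h1]
    filter_upwards [Lp.coeFn_finsetSum Finset.univ (fun i => L (Pi.single i 1) • I (w i)), h2]
      with ω hω hω2
    rw [hω]
    simp only [hω2, Finset.sum_apply, Function.comp_apply]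
    conv_lhs => rw [pi_eq_sum_univ' (fun i => I (w i) ω)]
    rw [map_sum]
    refine Finset.sum_congr rfl fun i _ => ?_
    rw [map_smul, smul_eq_mul, mul_comm]
  rw [Measure.map_congr hae, (h v).map_eq]
  infer_instance

variable [IsProbabilityMeasure P]

theorem integral_abs_le_norm_Lp (Z : Lp ℝ 2 P) : ∫ ω, |Z ω| ∂P ≤ ‖Z‖ := by
  have hZ : MemLp Z 2 P := Lp.memLp Z
  have h1 : ∫ ω, |Z ω| ∂P = (eLpNorm Z 1 P).toReal := by
    rw [eLpNorm_one_eq_lintegral_enorm, ← integral_norm_eq_lintegral_enorm hZ.1]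
    rfl
  rw [h1, Lp.norm_def]
  exact ENNReal.toReal_mono hZ.2.ne
    (eLpNorm_le_eLpNorm_of_exponent_le (by norm_num) hZ.1)

/-- From $|e^{itx}-e^{ity}|\le|t||x-y|$, the characteristic function at $t$ is $|t|$-Lipschitz in
the $L^1$ distance, hence in the $L^2$ distance. -/
theorem continuous_charFun_map_Lp (t : ℝ) :
    Continuous (fun Z : Lp ℝ 2 P => charFun (P.map Z) t) := by
  have hint : ∀ Z : Lp ℝ 2 P, Integrable (fun ω => Complex.exp (t * Z ω * Complex.I)) P := by
    intro Z
    refine Integrable.of_bound (C := 1) ?_ ?_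
    · have := (Lp.stronglyMeasurable Z).measurable
      exact Measurable.aestronglyMeasurable (by fun_prop)
    · refine Filter.Eventually.of_forall fun ω => ?_
      have := Complex.norm_exp_ofReal_mul_I (t * Z ω)
      push_cast at this
      exact this.le
  have hlip : LipschitzWith (Real.nnabs t) (fun Z : Lp ℝ 2 P => charFun (P.map Z) t) := by
    refine LipschitzWith.of_dist_le_mul fun Z Z' => ?_
    have hcf : ∀ Z : Lp ℝ 2 P, charFun (P.map Z) t =
        ∫ ω, Complex.exp (t * Z ω * Complex.I) ∂P := by
      intro Z
      rw [charFun_apply_real, integral_map (Lp.stronglyMeasurable Z).measurable.aemeasurable]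
      exact Measurable.aestronglyMeasurable (by fun_prop)
    rw [hcf, hcf, dist_eq_norm, ← integral_sub (hint Z) (hint Z'), dist_eq_norm]
    have hbound : ∀ᵐ ω ∂P, ‖Complex.exp (t * Z ω * Complex.I) -
        Complex.exp (t * Z' ω * Complex.I)‖ ≤ |t| * |(Z - Z' : Lp ℝ 2 P) ω| := by
      filter_upwards [Lp.coeFn_sub Z Z'] with ω hω
      rw [hω]
      have h2 : Complex.exp (t * Z ω * Complex.I) - Complex.exp (t * Z' ω * Complex.I) =
          Complex.exp ((t * Z' ω : ℝ) * Complex.I) *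
            (Complex.exp (Complex.I * (t * (Z ω - Z' ω) : ℝ)) - 1) := by
        rw [mul_sub, ← Complex.exp_add, mul_one]
        push_cast
        congr 2
        ring
      rw [h2, norm_mul, Complex.norm_exp_ofReal_mul_I, one_mul]
      refine (Real.norm_exp_I_mul_ofReal_sub_one_le).trans ?_
      rw [Real.norm_eq_abs, abs_mul]
      rfl
    have hI : Integrable (fun ω => |t| * |(Z - Z' : Lp ℝ 2 P) ω|) P :=
      (((Lp.memLp (Z - Z')).integrable (by norm_num)).abs).const_mul _
    refine (norm_integral_le_of_norm_le hI hbound).trans ?_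
    rw [integral_const_mul]
    exact mul_le_mul_of_nonneg_left (integral_abs_le_norm_Lp _) (abs_nonneg _)
  exact hlip.continuous

/-- An isometry into `L²(P)` which is isonormal on a dense set is isonormal. -/
theorem hasLaw_gaussianReal_of_dense {W : Type*} [NormedAddCommGroup W] [InnerProductSpace ℝ W]
    (I : W →ₗᵢ[ℝ] Lp ℝ 2 P) {D : Set W} (hD : Dense D)
    (h : ∀ w ∈ D, HasLaw (I w) (gaussianReal 0 (‖w‖ ^ 2).toNNReal) P) (w : W) :
    HasLaw (I w) (gaussianReal 0 (‖w‖ ^ 2).toNNReal) P := by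
  have hm : ∀ w, AEMeasurable (I w) P := fun w =>
    (Lp.stronglyMeasurable (I w)).measurable.aemeasurable
  refine ⟨hm w, ?_⟩
  have : IsProbabilityMeasure (P.map (I w)) := Measure.isProbabilityMeasure_map (hm w)
  apply Measure.ext_of_charFun
  funext t
  have hg : ∀ w : W, charFun (gaussianReal 0 (‖w‖ ^ 2).toNNReal) t =
      Complex.exp (-((‖w‖ ^ 2 * t ^ 2 / 2 : ℝ) : ℂ)) := by
    intro w
    rw [charFun_gaussianReal]
    congr 1
    rw [Real.coe_toNNReal _ (sq_nonneg _)]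
    push_cast
    ring
  rw [hg]
  -- Both characteristic functions are continuous in `w`, so their equality is a closed condition
  -- and passes from the dense set to the whole space.
  refine hD.induction (P := fun w => charFun (P.map (I w)) t =
    Complex.exp (-((‖w‖ ^ 2 * t ^ 2 / 2 : ℝ) : ℂ))) ?_ ?_ w
  · intro w hw
    rw [(h w hw).map_eq, hg]
  · exact isClosed_eq ((continuous_charFun_map_Lp t).comp I.continuous) (by fun_prop)

/-- Images of pairwise orthogonal vectors under an isonormal isometry are independent. -/
theorem iIndepFun_of_isonormal {W : Type*} [NormedAddCommGroup W]
    [InnerProductSpace ℝ W] {I : W →ₗᵢ[ℝ] Lp ℝ 2 P}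
    (h : ∀ w, HasLaw (I w) (gaussianReal 0 (‖w‖ ^ 2).toNNReal) P)
    {ι : Type*} [Fintype ι] {w : ι → W} (hw : ∀ i j, i ≠ j → inner ℝ (w i) (w j) = 0) :
    iIndepFun (fun i => (I (w i) : Ω → ℝ)) P := by
  refine (hasGaussianLaw_pi_of_isonormal h w).iIndepFun_of_covariance_eq_zero fun i j hij => ?_
  have h0 : ∀ v, ∫ ω, I v ω ∂P = 0 := fun v => by
    rw [(h v).integral_eq, integral_id_gaussianReal]
  rw [covariance_eq_sub (Lp.memLp _) (Lp.memLp _), h0, zero_mul, sub_zero]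
  have h1 := hw i j hij
  rw [← I.inner_map_map, L2.inner_def] at h1
  rw [← h1]
  refine integral_congr_ae (Filter.Eventually.of_forall fun ω => ?_)
  simp [mul_comm]

end

/-! ### The isonormal process carried by a fractional Brownian motion. -/

noncomputable section

variable {Ω : Type*} [MeasurableSpace Ω] {P : Measure Ω} [IsProbabilityMeasure P]

theorem volterraK_eq_zero_of_notMem {H t T : ℝ} (htT : t ≤ T) {s : ℝ} (hs : s ∉ Ioo 0 T) :
    volterraK H t s = 0 := by
  rw [volterraK, if_neg]
  exact fun h => hs ⟨h.1, h.2.trans_le htT⟩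

theorem setIntegral_volterraK_mul {H t T : ℝ} (htT : t ≤ T) (g : ℝ → ℝ) :
    ∫ u in Ioo 0 T, volterraK H t u * g u = ∫ u, volterraK H t u * g u := by
  refine setIntegral_eq_integral_of_forall_compl_eq_zero fun u hu => ?_
  rw [volterraK_eq_zero_of_notMem htT hu, zero_mul]

/-- The Volterra kernel `K(t, ·)` as an element of `L²(0, T)`. -/
def volterraLp {H : ℝ} (hH0 : 0 < H) (hH1 : H < 1 / 2) (T : ℝ) (t : Icc 0 T) :
    Lp ℝ 2 (volume.restrict (Ioo 0 T)) :=
  ((memLp_volterraK hH0 hH1 t.2.1).restrict (Ioo 0 T)).toLp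

theorem volterraLp_coeFn {H : ℝ} (hH0 : 0 < H) (hH1 : H < 1 / 2) (T : ℝ) (t : Icc 0 T) :
    volterraLp hH0 hH1 T t =ᵐ[volume.restrict (Ioo 0 T)] volterraK H t :=
  MemLp.coeFn_toLp _

theorem inner_volterraLp_left {H : ℝ} (hH0 : 0 < H) (hH1 : H < 1 / 2) (T : ℝ) (t : Icc 0 T)
    (g : Lp ℝ 2 (volume.restrict (Ioo 0 T))) :
    inner ℝ (volterraLp hH0 hH1 T t) g = ∫ u, volterraK H t u * g u := by
  rw [L2.inner_def, ← setIntegral_volterraK_mul t.2.2]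
  refine integral_congr_ae ?_
  filter_upwards [volterraLp_coeFn hH0 hH1 T t] with u hu
  simp [hu, mul_comm]

theorem inner_volterraLp {H : ℝ} (hH0 : 0 < H) (hH1 : H < 1 / 2) (T : ℝ) (s t : Icc 0 T) :
    inner ℝ (volterraLp hH0 hH1 T s) (volterraLp hH0 hH1 T t) =
      ((s : ℝ) ^ (2 * H) + (t : ℝ) ^ (2 * H) - |(t : ℝ) - s| ^ (2 * H)) / 2 := by
  rw [real_inner_comm, inner_volterraLp_left, ← integral_volterraK_mul hH0 hH1 s.2.1 t.2.1,
    ← setIntegral_volterraK_mul t.2.2, ← setIntegral_volterraK_mul t.2.2]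
  refine integral_congr_ae ?_
  filter_upwards [volterraLp_coeFn hH0 hH1 T s] with u hu
  rw [hu]

/-- The span is dense because its orthogonal complement is trivial, which is the Abel inversion
result `ae_eq_zero_of_forall_integral_volterraK`. -/
theorem denseRange_linearCombination_volterraLp {H : ℝ} (hH0 : 0 < H) (hH1 : H < 1 / 2) (T : ℝ) :
    DenseRange (Finsupp.linearCombination ℝ (volterraLp hH0 hH1 T)) := by
  have hr : range (Finsupp.linearCombination ℝ (volterraLp hH0 hH1 T)) =
      (Submodule.span ℝ (range (volterraLp hH0 hH1 T)) : Set _) := by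
    rw [← Finsupp.range_linearCombination]
    rfl
  rw [DenseRange, hr, Submodule.dense_iff_topologicalClosure_eq_top,
    Submodule.topologicalClosure_eq_top_iff, Submodule.eq_bot_iff]
  intro g hg
  have hgm : Measurable g := (Lp.stronglyMeasurable g).measurable
  have hzero : (Ioo 0 T).indicator g =ᵐ[volume] 0 := by
    refine ae_eq_zero_of_forall_integral_volterraK hH0 hH1 (T := T)
      (hgm.indicator measurableSet_Ioo) ((memLp_indicator_iff_restrict measurableSet_Ioo).2
        (Lp.memLp g)) (fun s hs => indicator_of_notMem hs _) fun t ht => ?_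
    have h1 := (Submodule.mem_orthogonal _ _).1 hg (volterraLp hH0 hH1 T ⟨t, ht.1.le, ht.2.le⟩)
      (Submodule.subset_span (mem_range_self _))
    rw [inner_volterraLp_left] at h1
    refine Eq.trans (integral_congr_ae (Filter.Eventually.of_forall fun s => ?_)) h1
    by_cases hs : s ∈ Ioo 0 T
    · simp only [indicator_of_mem hs]
    · simp only [indicator_of_notMem hs, volterraK_eq_zero_of_notMem ht.2.le hs, zero_mul,
        mul_zero]
  rw [Lp.eq_zero_iff_ae_eq_zero]
  have h2 := ae_restrict_of_ae (s := Ioo 0 T) hzero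
  filter_upwards [h2, ae_restrict_mem measurableSet_Ioo] with s hs hmem
  rwa [indicator_of_mem hmem] at hs

/-- Every fractional Brownian motion comes from an isonormal Gaussian process over `L²(0, T)`. -/
theorem exists_isonormal_of_fracBrownian {H T : ℝ} (hH0 : 0 < H) (hH1 : H < 1 / 2)
    {X : ℝ → Ω → ℝ} (hX : IsFracBrownianOn H T X P) :
    ∃ I : Lp ℝ 2 (volume.restrict (Ioo 0 T)) →ₗᵢ[ℝ] Lp ℝ 2 P,
      (∀ w, HasLaw (I w) (gaussianReal 0 (‖w‖ ^ 2).toNNReal) P) ∧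
      ∀ t : Icc 0 T, I (volterraLp hH0 hH1 T t) =ᵐ[P] X t := by
  have hL2 : ∀ t : Icc 0 T, MemLp (X t) 2 P := fun t =>
    (hX.gaussian.hasGaussianLaw_eval t).memLp_two
  have hcoe : ∀ t : Icc 0 T, (hL2 t).toLp =ᵐ[P] X t := fun t => MemLp.coeFn_toLp _
  have hgram : ∀ s t : Icc 0 T, inner ℝ (volterraLp hH0 hH1 T s) (volterraLp hH0 hH1 T t) =
      inner ℝ (hL2 s).toLp (hL2 t).toLp := by
    intro s t
    rw [inner_volterraLp, ← hX.covariance s s.2 t t.2, covariance_eq_sub (hL2 s) (hL2 t),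
      hX.centered s s.2, zero_mul, sub_zero, L2.inner_def]
    refine integral_congr_ae ?_
    filter_upwards [hcoe s, hcoe t] with ω h1 h2
    simp [h1, h2, mul_comm]
  have hdense := denseRange_linearCombination_volterraLp hH0 hH1 T
  obtain ⟨I, hI⟩ := exists_linearIsometry_of_gram hgram hdense
  refine ⟨I, hasLaw_gaussianReal_of_dense I hdense ?_, fun t => ?_⟩
  -- On the span, `I w` is a finite combination of values of the Gaussian process: centered
  -- Gaussian, with variance $\|w\|^2$ by isometry.
  · rintro _ ⟨c, rfl⟩
    set w := Finsupp.linearCombination ℝ (volterraLp hH0 hH1 T) c with hw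
    have hIw : I w = ∑ i ∈ c.support, c i • (hL2 i).toLp := by
      simp only [hw, Finsupp.linearCombination_apply, Finsupp.sum, map_sum, map_smul, hI]
    have hae : (fun ω => ∑ i ∈ c.support, c i * X i ω) =ᵐ[P] I w := by
      have h2 : ∀ᵐ ω ∂P, ∀ i ∈ c.support, (c i • (hL2 i).toLp : Lp ℝ 2 P) ω = c i * X i ω := by
        rw [Filter.eventually_all_finset]
        intro i _
        filter_upwards [Lp.coeFn_smul (c i) (hL2 i).toLp, hcoe i] with ω h1 h2
        rw [h1, Pi.smul_apply, h2, smul_eq_mul]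
      rw [hIw]
      filter_upwards [Lp.coeFn_finsetSum c.support (fun i => c i • (hL2 i).toLp), h2] with ω h1 h2
      rw [h1, Finset.sum_apply]
      exact Finset.sum_congr rfl fun i hi => (h2 i hi).symm
    have hgauss : HasGaussianLaw (I w) P := by
      refine HasGaussianLaw.congr ?_ hae
      have := (hX.gaussian.hasGaussianLaw c.support).map
        (∑ i : c.support, c i • ContinuousLinearMap.proj (R := ℝ) (φ := fun _ => ℝ) i)
      refine this.congr (Filter.Eventually.of_forall fun ω => ?_)
      simp only [Function.comp_apply, FunLike.coe_sum, Finset.sum_apply,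
        FunLike.coe_smul, Pi.smul_apply, ContinuousLinearMap.proj_apply, smul_eq_mul,
        Finset.restrict]
      exact Finset.sum_coe_sort c.support (fun i => c i * X i ω)
    refine ⟨hgauss.aemeasurable, ?_⟩
    have hmean : ∫ ω, I w ω ∂P = 0 := by
      rw [← integral_congr_ae hae, integral_finsetSum]
      · refine Finset.sum_eq_zero fun i _ => ?_
        rw [integral_const_mul, hX.centered i i.2, mul_zero]
      · exact fun i _ => ((hL2 i).integrable (by norm_num)).const_mul _
    have hvar : Var[I w; P] = ‖w‖ ^ 2 := by
      rw [variance_eq_sub (Lp.memLp _), hmean, ← I.norm_map, ← real_inner_self_eq_norm_sq,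
        L2.inner_def]
      simp [sq]
    rw [hgauss.map_eq_gaussianReal, hvar, hmean]
  · rw [hI]
    exact hcoe t

end

/-! ### Brownian motion from the isonormal process. -/

noncomputable section

variable {Ω : Type*} [MeasurableSpace Ω] {P : Measure Ω} [IsProbabilityMeasure P]

/-- The indicator function of `(-∞, t]` as an element of `L²(0, T)`. -/
def stepLp (T t : ℝ) : Lp ℝ 2 (volume.restrict (Ioo 0 T)) :=
  indicatorConstLp 2 (measurableSet_Iic (a := t)) (measure_ne_top _ _) 1

theorem inner_stepLp_left (T t : ℝ) (g : Lp ℝ 2 (volume.restrict (Ioo 0 T))) :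
    inner ℝ (stepLp T t) g = ∫ u in Iic t, g u ∂(volume.restrict (Ioo 0 T)) := by
  rw [stepLp, L2.inner_indicatorConstLp_one]

theorem inner_stepLp (T s t : ℝ) :
    inner ℝ (stepLp T s) (stepLp T t) = (volume.restrict (Ioo 0 T)).real (Iic (min s t)) := by
  rw [stepLp, stepLp, L2.inner_indicatorConstLp_indicatorConstLp, Iic_inter_Iic]
  simp

theorem norm_stepLp_sub_sq (T : ℝ) {s t : ℝ} (hst : s ≤ t) :
    ‖stepLp T t - stepLp T s‖ ^ 2 = (volume.restrict (Ioo 0 T)).real (Ioc s t) := by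
  have hdiff : Ioc s t = Iic t \ Iic s := by
    ext x
    simp only [mem_Ioc, mem_sdiff, mem_Iic, not_le, and_comm]
  rw [norm_sub_sq_real, ← real_inner_self_eq_norm_sq, ← real_inner_self_eq_norm_sq, inner_stepLp,
    inner_stepLp, inner_stepLp, min_self, min_self, min_eq_right hst, hdiff,
    measureReal_sdiff (Iic_subset_Iic.2 hst) measurableSet_Iic]
  ring

/-- Restricting Lebesgue measure to $(0,T)$ only shrinks it. The inequality covers all real times,
as the Kolmogorov hypothesis requires; on $[0,T]$ it is an equality. -/
theorem norm_stepLp_sub_sq_le (T s t : ℝ) : ‖stepLp T t - stepLp T s‖ ^ 2 ≤ |t - s| := by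
  wlog hst : s ≤ t generalizing s t
  · rw [norm_sub_rev, abs_sub_comm]
    exact this t s (le_of_not_ge hst)
  rw [norm_stepLp_sub_sq T hst, abs_of_nonneg (sub_nonneg.2 hst)]
  have h : (volume.restrict (Ioo 0 T)).real (Ioc s t) ≤ volume.real (Ioc s t) :=
    ENNReal.toReal_mono measure_Ioc_lt_top.ne (Measure.restrict_apply_le _ _)
  rwa [Real.volume_real_Ioc_of_le hst] at h

theorem norm_stepLp_sub_sq_of_mem {T s t : ℝ} (hs : s ∈ Icc 0 T) (ht : t ∈ Icc 0 T)
    (hst : s ≤ t) : ‖stepLp T t - stepLp T s‖ ^ 2 = t - s := by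
  rw [norm_stepLp_sub_sq T hst, measureReal_restrict_apply measurableSet_Ioc]
  have : (Ioc s t ∩ Ioo 0 T : Set ℝ) =ᵐ[volume] (Ioc s t : Set ℝ) := by
    have h1 : (Ioo 0 T : Set ℝ) =ᵐ[volume] (Ioc 0 T : Set ℝ) := Ioo_ae_eq_Ioc
    have h2 := (ae_eq_refl (Ioc s t : Set ℝ)).inter h1
    rwa [inter_eq_left.2 (Ioc_subset_Ioc hs.1 ht.2)] at h2
  rw [measureReal_congr this, Real.volume_real_Ioc_of_le hst]

theorem stepLp_zero (T : ℝ) : stepLp T 0 = 0 := by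
  have : ‖stepLp T 0‖ ^ 2 = 0 := by
    rw [← real_inner_self_eq_norm_sq, inner_stepLp, min_self,
      measureReal_restrict_apply measurableSet_Iic]
    have : (Iic 0 ∩ Ioo 0 T : Set ℝ) = ∅ := by
      ext x
      simp only [mem_inter_iff, mem_Iic, mem_Ioo, mem_empty_iff_false, iff_false]
      exact fun h => absurd h.1 (not_le.2 h.2.1)
    simp [this]
  simpa using this

theorem inner_stepLp_sub_stepLp_sub (T : ℝ) {a b c d : ℝ} (hab : a ≤ b) (hbc : b ≤ c)
    (hcd : c ≤ d) : inner ℝ (stepLp T b - stepLp T a) (stepLp T d - stepLp T c) = 0 := by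
  simp only [inner_sub_left, inner_sub_right, inner_stepLp]
  rw [min_eq_left (hbc.trans hcd), min_eq_left (hab.trans (hbc.trans hcd)), min_eq_left hbc,
    min_eq_left (hab.trans hbc)]
  ring

theorem lintegral_gaussianReal_even_moment (m : ℕ) {v : ℝ} (hv : 0 ≤ v) :
    ∫⁻ x, ‖x‖ₑ ^ (2 * m) ∂(gaussianReal 0 v.toNNReal) =
      ENNReal.ofReal v ^ m * ∫⁻ x, ‖x‖ₑ ^ (2 * m) ∂(gaussianReal 0 1) := by
  have h : gaussianReal 0 v.toNNReal = (gaussianReal 0 1).map (fun x => √v * x) := by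
    rw [gaussianReal_map_const_mul]
    congr 1
    · simp
    · ext
      simp [Real.sq_sqrt hv, hv]
  rw [h, lintegral_map (by fun_prop) (by fun_prop), ← lintegral_const_mul _ (by fun_prop)]
  refine lintegral_congr fun x => ?_
  rw [enorm_mul, mul_pow, pow_mul ‖√v‖ₑ, Real.enorm_of_nonneg (Real.sqrt_nonneg v),
    ← ENNReal.ofReal_pow (Real.sqrt_nonneg v), Real.sq_sqrt hv]

theorem lintegral_gaussianReal_pow_ne_top (m : ℕ) :
    ∫⁻ x, ‖x‖ₑ ^ m ∂(gaussianReal 0 1) ≠ ⊤ := by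
  rcases Nat.eq_zero_or_pos m with rfl | hm
  · simp
  · have h := (memLp_id_gaussianReal (μ := 0) (v := 1) (m : NNReal)).2
    have h2 := lintegral_rpow_enorm_lt_top_of_eLpNorm_lt_top (p := (m : NNReal))
      (by simpa using hm.ne') (by simp) h
    simpa using h2.ne

/-- An isonormal process over `L²(0, T)` yields a Brownian motion with Hölder continuous paths. -/
theorem exists_brownian_of_isonormal {T : ℝ} (hT : 0 < T)
    {I : Lp ℝ 2 (volume.restrict (Ioo 0 T)) →ₗᵢ[ℝ] Lp ℝ 2 P}
    (h : ∀ w, HasLaw (I w) (gaussianReal 0 (‖w‖ ^ 2).toNNReal) P) :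
    ∃ B : ℝ → Ω → ℝ, (∀ t, Measurable (B t)) ∧ (∀ ω, Continuous fun t => B t ω) ∧
      IsBrownianOn T B P ∧
      (∀ᵐ ω ∂P, ∀ lam : ℝ, 0 < lam → lam < 1 / 2 → MemHolderZero lam T (fun t => B t ω)) ∧
      ∀ t ∈ Icc 0 T, B t =ᵐ[P] I (stepLp T t) := by
  have hsub : ∀ s t, (fun ω => I (stepLp T t) ω - I (stepLp T s) ω) =ᵐ[P]
      I (stepLp T t - stepLp T s) := by
    intro s t
    rw [map_sub]
    exact (Lp.coeFn_sub _ _).symm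
  obtain ⟨B, hBm, hBY, hBh⟩ := exists_holder_modification (P := P) hT
    (Y := fun t => I (stepLp T t)) (fun t => (Lp.stronglyMeasurable _).measurable) (by
      intro m
      refine ⟨∫⁻ x, ‖x‖ₑ ^ (2 * m) ∂(gaussianReal 0 1),
        lintegral_gaussianReal_pow_ne_top _, fun s t => ?_⟩
      have h1 : ∫⁻ ω, ‖I (stepLp T t) ω - I (stepLp T s) ω‖ₑ ^ (2 * m) ∂P =
          ∫⁻ ω, ‖I (stepLp T t - stepLp T s) ω‖ₑ ^ (2 * m) ∂P := by
        refine lintegral_congr_ae ?_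
        filter_upwards [hsub s t] with ω hω
        rw [hω]
      rw [h1, (h _).lintegral_comp (f := fun x => ‖x‖ₑ ^ (2 * m)) (by fun_prop),
        lintegral_gaussianReal_even_moment m (sq_nonneg _), mul_comm]
      gcongr
      exact norm_stepLp_sub_sq_le T s t)
  have hcont : ∀ ω, Continuous fun t => B t ω := by
    intro ω
    obtain ⟨M, hM0, hM⟩ := hBh ω (1 / 4) (by norm_num) (by norm_num)
    rw [continuous_iff_continuousAt]
    intro s
    rw [ContinuousAt, tendsto_iff_dist_tendsto_zero]
    refine squeeze_zero (g := fun r => M * |r - s| ^ (1 / 4 : ℝ)) (fun r => dist_nonneg)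
      (fun r => hM s r) ?_
    have hc : Continuous fun r : ℝ => M * |r - s| ^ (1 / 4 : ℝ) :=
      continuous_const.mul (((continuous_id.sub continuous_const).abs).rpow_const
        fun _ => Or.inr (by norm_num))
    simpa using hc.tendsto s
  have hzero : ∀ᵐ ω ∂P, B 0 ω = 0 := by
    have h0 := hBY 0 ⟨le_rfl, hT.le⟩
    simp only [stepLp_zero, map_zero] at h0
    filter_upwards [h0, Lp.coeFn_zero ℝ 2 P] with ω h1 h2
    rw [h1, h2, Pi.zero_apply]
  have hinc : ∀ s ∈ Icc 0 T, ∀ t ∈ Icc 0 T, (fun ω => B t ω - B s ω) =ᵐ[P]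
      I (stepLp T t - stepLp T s) := by
    intro s hs t ht
    filter_upwards [hBY s hs, hBY t ht, hsub s t] with ω h1 h2 h3
    rw [h1, h2, h3]
  refine ⟨B, hBm, hcont, ⟨hzero, ?_, ?_, ?_⟩, ?_, hBY⟩
  -- Increments over successive intervals are images of orthogonal step functions, hence
  -- independent.
  · intro n t ht
    refine iIndepFun.congr ?_ (iIndepFun_of_isonormal h
      (w := fun i : Fin n => stepLp T (t i.succ) - stepLp T (t i.castSucc)) ?_)
    · exact fun i => (hinc _ (t i.castSucc).2 _ (t i.succ).2).symm
    · intro i j hij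
      wlog hlt : i < j generalizing i j
      · rw [real_inner_comm]
        exact this j i hij.symm (lt_of_le_of_ne (not_lt.1 hlt) hij.symm)
      exact inner_stepLp_sub_stepLp_sub T (ht (Fin.castSucc_le_succ i))
        (ht (Fin.succ_le_castSucc_iff.2 hlt)) (ht (Fin.castSucc_le_succ j))
  · intro s hs t ht hst
    refine HasLaw.congr ?_ (hinc s hs t ht)
    rw [← norm_stepLp_sub_sq_of_mem hs ht hst]
    exact h _
  · exact Filter.Eventually.of_forall fun ω => (hcont ω).continuousOn
  · filter_upwards [hzero] with ω hω lam hlam0 hlam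
    obtain ⟨M, -, hM⟩ := hBh ω lam hlam0 hlam
    exact ⟨hω, M, fun s _ r _ => hM s r⟩

end

/-! ### The deterministic identity behind the representation. -/

noncomputable section

/-- Fubini's theorem for a region `S` whose sections integrate the weight `D` to `K`. -/
theorem integral_mul_setIntegral_section {μ ν : Measure ℝ} [SFinite μ] [SFinite ν]
    {S : Set (ℝ × ℝ)} (hS : MeasurableSet S) {D K g : ℝ → ℝ} (hD : Measurable D)
    (hD0 : ∀ᵐ s ∂μ, 0 ≤ D s) (hg : Measurable g)
    (hK : ∀ᵐ u ∂ν, IntegrableOn D {s | (s, u) ∈ S} μ ∧ ∫ s in {s | (s, u) ∈ S}, D s ∂μ = K u)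
    (hKg : Integrable (fun u => K u * g u) ν) :
    ∫ s, (∫ u in {u | (s, u) ∈ S}, g u ∂ν) * D s ∂μ = ∫ u, K u * g u ∂ν := by
  have hSs : ∀ u, MeasurableSet {s | (s, u) ∈ S} := fun u => measurable_prodMk_right hS
  have hSu : ∀ s, MeasurableSet {u | (s, u) ∈ S} := fun s => measurable_prodMk_left hS
  set F : ℝ → ℝ → ℝ := fun s u => {s | (s, u) ∈ S}.indicator D s * g u with hF
  have hFS : Function.uncurry F = fun p => S.indicator (fun p => D p.1 * g p.2) p := by
    funext p
    by_cases hp : p ∈ S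
    · have : p.1 ∈ {s | (s, p.2) ∈ S} := hp
      simp only [Function.uncurry, hF, indicator_of_mem hp, indicator_of_mem this]
    · have : p.1 ∉ {s | (s, p.2) ∈ S} := hp
      simp only [Function.uncurry, hF, indicator_of_notMem hp, indicator_of_notMem this, zero_mul]
  have hFm : AEStronglyMeasurable (Function.uncurry F) (μ.prod ν) := by
    rw [hFS]
    exact (((hD.comp measurable_fst).mul (hg.comp measurable_snd)).indicator
      hS).aestronglyMeasurable
  have hint : Integrable (Function.uncurry F) (μ.prod ν) := by
    rw [integrable_prod_iff' hFm]
    constructor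
    · filter_upwards [hK] with u hu
      exact ((integrable_indicator_iff (hSs u)).2 hu.1).mul_const (g u)
    -- Since the weight is nonnegative, integrating the absolute value over a section gives exactly
    -- $K|g|$.
    · refine hKg.norm.congr ?_
      filter_upwards [hK] with u hu
      have h1 : ∀ᵐ s ∂μ, ‖F s u‖ = {s | (s, u) ∈ S}.indicator D s * ‖g u‖ := by
        filter_upwards [hD0] with s hs
        rw [hF, norm_mul, Real.norm_of_nonneg (indicator_apply_nonneg fun _ => hs)]
      have h2 : 0 ≤ K u := by
        rw [← hu.2]
        exact integral_nonneg_of_ae (ae_restrict_of_ae hD0)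
      simp only [Function.uncurry]
      rw [integral_congr_ae h1, integral_mul_const, integral_indicator (hSs u), hu.2, norm_mul,
        Real.norm_of_nonneg h2]
  have hswap := integral_integral_swap hint
  have hl : ∀ s, ∫ u, F s u ∂ν = (∫ u in {u | (s, u) ∈ S}, g u ∂ν) * D s := by
    intro s
    rw [← integral_indicator (hSu s), ← integral_mul_const]
    refine integral_congr_ae (Filter.Eventually.of_forall fun u => ?_)
    by_cases hp : (s, u) ∈ S
    · have h1 : s ∈ {s | (s, u) ∈ S} := hp
      have h2 : u ∈ {u | (s, u) ∈ S} := hp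
      simp only [hF, indicator_of_mem h1, indicator_of_mem h2, mul_comm]
    · have h1 : s ∉ {s | (s, u) ∈ S} := hp
      have h2 : u ∉ {u | (s, u) ∈ S} := hp
      simp only [hF, indicator_of_notMem h1, indicator_of_notMem h2, zero_mul]
  simp only [hl] at hswap
  rw [hswap]
  refine integral_congr_ae ?_
  filter_upwards [hK] with u hu
  rw [integral_mul_const, integral_indicator (hSs u), hu.2]

/-- The fundamental theorem of calculus with $K_{H,1}(t,0)=0$; the derivative is singular at $0$,
and its sign supplies integrability there. -/
theorem integral_kernelOneDeriv {H t u : ℝ} (hH1 : H < 1 / 2) (hu : 0 < u) (hut : u < t) :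
    IntegrableOn (kernelOneDeriv H t) (Ioc 0 u) ∧
      ∫ s in Ioc 0 u, kernelOneDeriv H t s = kernelOne H t u := by
  have hc : ContinuousOn (kernelOne H t) (Icc 0 u) := by
    intro s hs
    refine ContinuousAt.continuousWithinAt ?_
    have h1 : ContinuousAt (fun s : ℝ => s ^ (1 / 2 - H)) s :=
      Real.continuousAt_rpow_const _ _ (Or.inr (by linarith))
    have h2 : ContinuousAt (fun s : ℝ => (t - s) ^ (H - 1 / 2)) s :=
      ContinuousAt.rpow_const (by fun_prop) (Or.inl (by linarith [hs.2]))
    exact (continuousAt_const.mul h1).mul h2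
  have hd : ∀ s ∈ Ioo 0 u, HasDerivAt (kernelOne H t) (kernelOneDeriv H t s) s := fun s hs =>
    hasDerivAt_kernelOne hs.1 (hs.2.trans hut)
  have hi := intervalIntegral.integrableOn_deriv_of_nonneg hc hd
    fun s hs => kernelOneDeriv_nonneg hH1 hs.1 (hs.2.trans hut)
  refine ⟨hi, ?_⟩
  rw [← intervalIntegral.integral_of_le hu.le,
    intervalIntegral.integral_eq_sub_of_hasDerivAt_of_le hu.le hc hd
      ((intervalIntegrable_iff_integrableOn_Ioc_of_le hu.le).2 hi)]
  have : kernelOne H t 0 = 0 := by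
    rw [kernelOne, Real.zero_rpow (by linarith), mul_zero, zero_mul]
  rw [this, sub_zero]

/-- The mirror case, with $K_{H,2}(t,t)=0$; continuity up to $s=t$ comes from the homogeneous form.
-/
theorem integral_kernelTwoNegDeriv {H t u : ℝ} (hH0 : 0 < H) (hH1 : H < 1 / 2) (hu : 0 < u)
    (hut : u < t) : IntegrableOn (kernelTwoNegDeriv H t) (Ioc u t) ∧
      ∫ s in Ioc u t, kernelTwoNegDeriv H t s = kernelTwo H t u := by
  have hc : ContinuousOn (fun s => -kernelTwo H t s) (Icc u t) := by
    refine ContinuousOn.neg ?_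
    refine ContinuousOn.congr (f := fun s => volterraConst H * (1 / 2 - H) *
      (s ^ (H - 1 / 2) * incBeta H (s / t))) ?_ fun s hs => kernelTwo_eq (hu.trans_le hs.1) hs.2
    refine continuousOn_const.mul (ContinuousOn.mul ?_ ?_)
    · exact fun s hs => (Real.continuousAt_rpow_const _ _
        (Or.inl (hu.trans_le hs.1).ne')).continuousWithinAt
    · exact ((continuous_incBeta hH0 hH1).comp (continuous_id.div_const t)).continuousOn
  have hd : ∀ s ∈ Ioo u t, HasDerivAt (fun s => -kernelTwo H t s) (kernelTwoNegDeriv H t s) s :=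
    fun s hs => by
      have := (hasDerivAt_kernelTwo hH0 hH1 (hu.trans hs.1) hs.2).neg
      rwa [neg_neg] at this
  have hi := intervalIntegral.integrableOn_deriv_of_nonneg hc hd
    fun s hs => kernelTwoNegDeriv_nonneg hH1 (hu.trans hs.1) hs.2
  refine ⟨hi, ?_⟩
  rw [← intervalIntegral.integral_of_le hut.le,
    intervalIntegral.integral_eq_sub_of_hasDerivAt_of_le hut.le hc hd
      ((intervalIntegrable_iff_integrableOn_Ioc_of_le hut.le).2 hi)]
  have : kernelTwo H t t = 0 := by
    rw [kernelTwo, intervalIntegral.integral_same, mul_zero]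
  rw [this]
  ring

/-- Integration by parts in the guise of Fubini. With $\langle 1_{(-\infty,s]},g\rangle=\int_0^sg$,
the first term integrates over $s<u\le t$ and the second over $u\le s$; doing $s$ first restores
$K_{H,1}(t,u)$ and $K_{H,2}(t,u)$. -/
theorem integral_step_kernelDeriv {H t T : ℝ} (hH0 : 0 < H) (hH1 : H < 1 / 2) (ht : 0 < t)
    (htT : t ≤ T) (g : Lp ℝ 2 (volume.restrict (Ioo 0 T))) :
    (∫ s in Ioo 0 t, inner ℝ (stepLp T t - stepLp T s) g * kernelOneDeriv H t s) +
      ∫ s in Ioo 0 t, inner ℝ (stepLp T s) g * kernelTwoNegDeriv H t s =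
    inner ℝ (volterraLp hH0 hH1 T ⟨t, ht.le, htT⟩) g := by
  have hgm : Measurable g := (Lp.stronglyMeasurable g).measurable
  have hg2 : MemLp g 2 (volume.restrict (Ioo 0 T)) := Lp.memLp g
  have hgi : Integrable g (volume.restrict (Ioo 0 T)) := hg2.integrable (by norm_num)
  have hL2 : MemLp (volterraK H t) 2 (volume.restrict (Ioo 0 T)) :=
    (memLp_volterraK hH0 hH1 ht.le).restrict _
  set K₁ : ℝ → ℝ := (Ioo 0 t).indicator (kernelOne H t) with hK₁
  set K₂ : ℝ → ℝ := fun u => volterraK H t u - K₁ u with hK₂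
  have hK₁m : Measurable K₁ := by
    refine Measurable.indicator ?_ measurableSet_Ioo
    unfold kernelOne
    fun_prop
  have hK₁v : ∀ u, K₁ u = if u ∈ Ioo 0 t then kernelOne H t u else 0 := fun u => by
    rw [hK₁, indicator_apply]
  have hK₂v : ∀ u, K₂ u = if u ∈ Ioo 0 t then kernelTwo H t u else 0 := fun u => by
    simp only [hK₂, hK₁v, volterraK]
    split_ifs <;> ring
  have hK₁0 : ∀ u, 0 ≤ K₁ u := fun u => by
    rw [hK₁v]
    split_ifs with h
    · exact kernelOne_nonneg h.1.le h.2.le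
    · exact le_rfl
  have hK₂0 : ∀ u, 0 ≤ K₂ u := fun u => by
    rw [hK₂v]
    split_ifs with h
    · exact kernelTwo_nonneg hH1 h.1.le h.2.le
    · exact le_rfl
  -- Square integrability is known for the full kernel only; each part inherits it because both
  -- parts are nonnegative.
  have hK₁L : MemLp K₁ 2 (volume.restrict (Ioo 0 T)) := by
    refine hL2.mono hK₁m.aestronglyMeasurable (Filter.Eventually.of_forall fun u => ?_)
    rw [Real.norm_of_nonneg (hK₁0 u), Real.norm_of_nonneg (volterraK_nonneg hH1 t u)]
    have := hK₂0 u
    simp only [hK₂] at this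
    linarith
  have hK₂L : MemLp K₂ 2 (volume.restrict (Ioo 0 T)) := hL2.sub hK₁L
  have hi₁ : Integrable (fun u => K₁ u * g u) (volume.restrict (Ioo 0 T)) := hK₁L.integrable_mul hg2
  have hi₂ : Integrable (fun u => K₂ u * g u) (volume.restrict (Ioo 0 T)) := hK₂L.integrable_mul hg2
  have hne : ∀ᵐ u ∂(volume.restrict (Ioo 0 T)), u ≠ t := ae_restrict_of_ae (ae_ne_real t)
  have e₁ : ∫ s in Ioo 0 t, inner ℝ (stepLp T t - stepLp T s) g * kernelOneDeriv H t s =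
      ∫ u in Ioo 0 T, K₁ u * g u := by
    rw [← integral_mul_setIntegral_section (S := {p : ℝ × ℝ | p.1 < p.2 ∧ p.2 ≤ t})
      (D := kernelOneDeriv H t) (μ := volume.restrict (Ioo 0 t)) ?_ (measurable_kernelOneDeriv H t)
      ?_ hgm ?_ hi₁]
    · refine setIntegral_congr_fun measurableSet_Ioo fun s hs => ?_
      congr 1
      rw [inner_sub_left, inner_stepLp_left, inner_stepLp_left,
        ← setIntegral_sdiff measurableSet_Iic hgi.integrableOn (Iic_subset_Iic.2 hs.2.le)]
      congr 2
      ext u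
      simp [and_comm]
    · exact (measurableSet_lt measurable_fst measurable_snd).inter
        (measurableSet_le measurable_snd measurable_const)
    · filter_upwards [ae_restrict_mem measurableSet_Ioo] with s hs
      exact kernelOneDeriv_nonneg hH1 hs.1 hs.2
    · filter_upwards [ae_restrict_mem measurableSet_Ioo, hne] with u hu hut
      rcases lt_or_gt_of_ne hut with h | h
      · have hset : {s : ℝ | s < u ∧ u ≤ t} = Iio u := by
          ext s
          simp [h.le]
        have hset2 : Iio u ∩ Ioo 0 t = Ioo 0 u := by
          ext s
          simp only [mem_inter_iff, mem_Iio, mem_Ioo]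
          constructor
          · exact fun h => ⟨h.2.1, h.1⟩
          · exact fun h' => ⟨h'.2, h'.1, h'.2.trans h⟩
        rw [hset, IntegrableOn, Measure.restrict_restrict measurableSet_Iio, hset2, hK₁v,
          if_pos ⟨hu.1, h⟩, restrict_Ioo_eq_restrict_Ioc]
        exact integral_kernelOneDeriv hH1 hu.1 h
      · have hset : {s : ℝ | s < u ∧ u ≤ t} = ∅ := by
          ext s
          simp [h]
        rw [hset, hK₁v, if_neg fun h' => absurd h'.2 h.le.not_gt]
        simp
  have e₂ : ∫ s in Ioo 0 t, inner ℝ (stepLp T s) g * kernelTwoNegDeriv H t s =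
      ∫ u in Ioo 0 T, K₂ u * g u := by
    rw [← integral_mul_setIntegral_section (S := {p : ℝ × ℝ | p.2 ≤ p.1})
      (D := kernelTwoNegDeriv H t) (μ := volume.restrict (Ioo 0 t)) ?_
      (measurable_kernelTwoNegDeriv hH0 hH1 t) ?_ hgm ?_ hi₂]
    · refine setIntegral_congr_fun measurableSet_Ioo fun s hs => ?_
      rw [inner_stepLp_left]
      rfl
    · exact measurableSet_le measurable_snd measurable_fst
    · filter_upwards [ae_restrict_mem measurableSet_Ioo] with s hs
      exact kernelTwoNegDeriv_nonneg hH1 hs.1 hs.2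
    · filter_upwards [ae_restrict_mem measurableSet_Ioo, hne] with u hu hut
      have hset : {s : ℝ | u ≤ s} = Ici u := rfl
      rw [hset, IntegrableOn, Measure.restrict_restrict measurableSet_Ici]
      rcases lt_or_gt_of_ne hut with h | h
      · have hset2 : Ici u ∩ Ioo 0 t = Ico u t := by
          ext s
          simp only [mem_inter_iff, mem_Ici, mem_Ioo, mem_Ico]
          constructor
          · exact fun h => ⟨h.1, h.2.2⟩
          · exact fun h' => ⟨h'.1, hu.1.trans_le h'.1, h'.2⟩
        rw [hset2, hK₂v, if_pos ⟨hu.1, h⟩, restrict_Ico_eq_restrict_Ioc]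
        exact integral_kernelTwoNegDeriv hH0 hH1 hu.1 h
      · have hset2 : Ici u ∩ Ioo 0 t = ∅ := by
          ext s
          simp only [mem_inter_iff, mem_Ici, mem_Ioo, mem_empty_iff_false, iff_false]
          exact fun h' => absurd (h'.1.trans_lt h'.2.2) h.le.not_gt
        rw [hset2, hK₂v, if_neg fun h' => absurd h'.2 h.le.not_gt]
        simp
  rw [e₁, e₂, ← integral_add hi₁ hi₂, inner_volterraLp_left, ← setIntegral_volterraK_mul htT]
  refine integral_congr_ae (Filter.Eventually.of_forall fun u => ?_)
  simp only [hK₂]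
  ring

end

/-! ### The operator applied to Brownian motion. -/

noncomputable section

variable {Ω : Type*} [MeasurableSpace Ω] {P : Measure Ω}

/-- Integrating over $\Omega$ first reduces joint integrability to a bound on first absolute
moments. -/
theorem integrable_prod_mul_weight {μ : Measure ℝ} [SFinite μ] [SFinite P] {Z : ℝ → Ω → ℝ}
    {b D : ℝ → ℝ} (hZm : Measurable (Function.uncurry Z)) (hD : Measurable D)
    (hD0 : ∀ᵐ s ∂μ, 0 ≤ D s)
    (hZ : ∀ᵐ s ∂μ, Integrable (Z s) P ∧ ∫ ω, |Z s ω| ∂P ≤ b s)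
    (hb : Integrable (fun s => b s * D s) μ) :
    Integrable (fun p : ℝ × Ω => Z p.1 p.2 * D p.1) (μ.prod P) := by
  have hm : AEStronglyMeasurable (fun p : ℝ × Ω => Z p.1 p.2 * D p.1) (μ.prod P) :=
    (hZm.mul (hD.comp measurable_fst)).aestronglyMeasurable
  rw [integrable_prod_iff hm]
  constructor
  · filter_upwards [hZ] with s hs
    exact hs.1.mul_const _
  · refine hb.mono' hm.norm.integral_prod_right' ?_
    filter_upwards [hZ, hD0] with s hs hs0
    rw [Real.norm_of_nonneg (integral_nonneg fun _ => norm_nonneg _)]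
    simp only [norm_mul, Real.norm_eq_abs, abs_of_nonneg hs0]
    rw [integral_mul_const]
    exact mul_le_mul_of_nonneg_right hs.2 hs0

theorem setIntegral_integral_mul_weight {μ : Measure ℝ} [SFinite μ] [SFinite P] {Z : ℝ → Ω → ℝ}
    {D : ℝ → ℝ} (h : Integrable (fun p : ℝ × Ω => Z p.1 p.2 * D p.1) (μ.prod P)) (A : Set Ω) :
    ∫ ω in A, ∫ s, Z s ω * D s ∂μ ∂P = ∫ s, (∫ ω in A, Z s ω ∂P) * D s ∂μ := by
  have hA : Integrable (fun p : ℝ × Ω => Z p.1 p.2 * D p.1) (μ.prod (P.restrict A)) := by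
    have : μ.prod (P.restrict A) = (μ.prod P).restrict (univ ×ˢ A) := by
      rw [← Measure.prod_restrict, Measure.restrict_univ]
    rw [this]
    exact h.restrict
  rw [← integral_integral_swap (f := fun s ω => Z s ω * D s) hA]
  simp only [integral_mul_const]

variable [IsProbabilityMeasure P]

/-- The fractional operator applied to the Brownian motion of an isonormal process is the value
of that process at the Volterra kernel. -/
theorem fracOp_ae_eq_isonormal {H T : ℝ} (hH0 : 0 < H) (hH1 : H < 1 / 2)
    {I : Lp ℝ 2 (volume.restrict (Ioo 0 T)) →ₗᵢ[ℝ] Lp ℝ 2 P} {B : ℝ → Ω → ℝ}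
    (hBm : ∀ t, Measurable (B t)) (hBc : ∀ ω, Continuous fun t => B t ω)
    (hBI : ∀ t ∈ Icc 0 T, B t =ᵐ[P] I (stepLp T t)) {t : ℝ} (ht : 0 < t) (htT : t ≤ T) :
    (fun ω => fracOp H (fun s => B s ω) t) =ᵐ[P] I (volterraLp hH0 hH1 T ⟨t, ht.le, htT⟩) := by
  have hBu : Measurable (Function.uncurry B) :=
    measurable_uncurry_of_continuous_of_measurable hBc hBm
  have hsI : ∀ s ∈ Ioo 0 t, s ∈ Icc 0 T := fun s hs => ⟨hs.1.le, hs.2.le.trans htT⟩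
  have hinc : ∀ s ∈ Ioo 0 t, (fun ω => B t ω - B s ω) =ᵐ[P] I (stepLp T t - stepLp T s) := by
    intro s hs
    rw [map_sub]
    filter_upwards [hBI t ⟨ht.le, htT⟩, hBI s (hsI s hs),
      Lp.coeFn_sub (I (stepLp T t)) (I (stepLp T s))] with ω h1 h2 h3
    rw [h1, h2, h3, Pi.sub_apply]
  -- First moments of the increments are of order $|b-a|^{1/2}$, so the weighted kernels are needed
  -- with exponent $\frac12$, which exceeds $\frac12-H$.
  have hroot : ∀ a b : ℝ, ‖stepLp T b - stepLp T a‖ ≤ |b - a| ^ (1 / 2 : ℝ) := fun a b => by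
    rw [← Real.sqrt_eq_rpow]
    exact Real.le_sqrt_of_sq_le (norm_stepLp_sub_sq_le T a b)
  have hIint : ∀ w, Integrable (I w) P := fun w => (Lp.memLp (I w)).integrable (by norm_num)
  have habs : ∀ w, ∫ ω, |I w ω| ∂P ≤ ‖w‖ := fun w =>
    (integral_abs_le_norm_Lp (I w)).trans_eq (I.norm_map w)
  have hF₁ : Integrable (fun p : ℝ × Ω => (B t p.2 - B p.1 p.2) * kernelOneDeriv H t p.1)
      ((volume.restrict (Ioo 0 t)).prod P) := by
    refine integrable_prod_mul_weight (Z := fun s ω => B t ω - B s ω)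
      (b := fun s => (t - s) ^ (1 / 2 : ℝ))
      (((hBm t).comp measurable_snd).sub hBu) (measurable_kernelOneDeriv H t) ?_ ?_
      (integrableOn_kernelOneDeriv hH0 hH1 (by linarith) ht)
    · filter_upwards [ae_restrict_mem measurableSet_Ioo] with s hs
      exact kernelOneDeriv_nonneg hH1 hs.1 hs.2
    · filter_upwards [ae_restrict_mem measurableSet_Ioo] with s hs
      refine ⟨(hIint _).congr (hinc s hs).symm, ?_⟩
      have h1 : ∫ ω, |B t ω - B s ω| ∂P = ∫ ω, |I (stepLp T t - stepLp T s) ω| ∂P := by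
        refine integral_congr_ae ?_
        filter_upwards [hinc s hs] with ω hω
        rw [hω]
      rw [h1]
      have h2 := (habs _).trans (hroot s t)
      rwa [abs_of_pos (sub_pos.2 hs.2)] at h2
  have hF₂ : Integrable (fun p : ℝ × Ω => B p.1 p.2 * kernelTwoNegDeriv H t p.1)
      ((volume.restrict (Ioo 0 t)).prod P) := by
    refine integrable_prod_mul_weight (Z := B)
      (b := fun s => s ^ (1 / 2 : ℝ)) hBu (measurable_kernelTwoNegDeriv hH0 hH1 t) ?_ ?_
      (integrableOn_kernelTwoNegDeriv hH0 hH1 (by linarith) ht)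
    · filter_upwards [ae_restrict_mem measurableSet_Ioo] with s hs
      exact kernelTwoNegDeriv_nonneg hH1 hs.1 hs.2
    · filter_upwards [ae_restrict_mem measurableSet_Ioo] with s hs
      refine ⟨(hIint _).congr (hBI s (hsI s hs)).symm, ?_⟩
      have h1 : ∫ ω, |B s ω| ∂P = ∫ ω, |I (stepLp T s) ω| ∂P := by
        refine integral_congr_ae ?_
        filter_upwards [hBI s (hsI s hs)] with ω hω
        rw [hω]
      rw [h1]
      have h2 := hroot 0 s
      rw [stepLp_zero, sub_zero, sub_zero, abs_of_pos hs.1] at h2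
      exact (habs _).trans h2
  have hJ₁ := hF₁.integral_prod_right
  have hJ₂ := hF₂.integral_prod_right
  have hfrac : (fun ω => fracOp H (fun s => B s ω) t) = fun ω =>
      (∫ s in Ioo 0 t, (B t ω - B s ω) * kernelOneDeriv H t s) +
        ∫ s in Ioo 0 t, B s ω * kernelTwoNegDeriv H t s := by
    funext ω
    rw [fracOp_eq hH0 hH1 ht]
    simp only [mul_comm (kernelTwoNegDeriv H t _)]
  rw [hfrac]
  refine Integrable.ae_eq_of_forall_setIntegral_eq _ _ (hJ₁.add hJ₂) (hIint _) fun A hA _ => ?_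
  set a : Lp ℝ 2 P := indicatorConstLp 2 hA (measure_ne_top P A) 1 with ha
  -- The adjoint converts expectations over $A$ into inner products with the single function `g`,
  -- after which `integral_step_kernelDeriv` finishes.
  set g := I.toContinuousLinearMap.adjoint a with hg
  have hadj : ∀ w, ∫ ω in A, I w ω ∂P = inner ℝ w g := by
    intro w
    rw [hg, ContinuousLinearMap.adjoint_inner_right, real_inner_comm, ha,
      L2.inner_indicatorConstLp_one]
    rfl
  rw [integral_add hJ₁.integrableOn hJ₂.integrableOn, hadj,
    ← integral_step_kernelDeriv hH0 hH1 ht htT g,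
    setIntegral_integral_mul_weight (Z := fun s ω => B t ω - B s ω) hF₁ A,
    setIntegral_integral_mul_weight (Z := B) hF₂ A]
  congr 1
  · refine setIntegral_congr_fun measurableSet_Ioo fun s hs => ?_
    rw [← hadj, setIntegral_congr_ae hA ((hinc s hs).mono fun ω h _ => h)]
  · refine setIntegral_congr_fun measurableSet_Ioo fun s hs => ?_
    rw [← hadj, setIntegral_congr_ae hA ((hBI s (hsI s hs)).mono fun ω h _ => h)]

/-- The variance at time $0$ vanishes. This covers $t=0$, which the kernel argument excludes. -/
theorem IsFracBrownianOn.ae_eq_zero {H T : ℝ} (hH0 : 0 < H) (hT : 0 < T) {X : ℝ → Ω → ℝ}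
    (hX : IsFracBrownianOn H T X P) : ∀ᵐ ω ∂P, X 0 ω = 0 := by
  have h0 : (0 : ℝ) ∈ Icc 0 T := ⟨le_rfl, hT.le⟩
  have hm : MemLp (X 0) 2 P := (hX.gaussian.hasGaussianLaw_eval ⟨0, h0⟩).memLp_two
  have hv : Var[X 0; P] = 0 := by
    rw [← covariance_self hm.1.aemeasurable, hX.covariance 0 h0 0 h0]
    simp [Real.zero_rpow (by positivity : 2 * H ≠ 0)]
  have h1 : Var[X 0; P] = ∫ ω, X 0 ω ^ 2 ∂P := by
    rw [variance_eq_sub hm, hX.centered 0 h0]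
    simp
  rw [hv] at h1
  have h2 := (integral_eq_zero_iff_of_nonneg (fun ω => sq_nonneg (X 0 ω)) hm.integrable_sq).1
    h1.symm
  filter_upwards [h2] with ω hω
  simpa using hω

/-- Two functions on `[0, T]` continuous there and equal at a dense set of times agree. -/
theorem eqOn_Icc_of_eqOn_dense {T : ℝ} (hT : 0 < T) {D : Set ℝ} (hD : Dense D) {f g : ℝ → ℝ}
    (hf : ContinuousOn f (Icc 0 T)) (hg : ContinuousOn g (Icc 0 T))
    (h : ∀ t ∈ D ∩ Ioo 0 T, f t = g t) : EqOn f g (Icc 0 T) := by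
  have hcl : Icc 0 T ⊆ closure (D ∩ Ioo 0 T) := by
    rw [inter_comm, ← closure_Ioo hT.ne]
    exact closure_minimal (hD.open_subset_closure_inter isOpen_Ioo) isClosed_closure
  exact EqOn.of_subset_closure h hf hg (inter_subset_right.trans Ioo_subset_Icc_self) hcl

end

theorem theorem2p1 (H : ℝ) (hH0 : 0 < H) (hH1 : H < 1 / 2) :
    -- `Λ_H` is a bounded linear operator from `C_0^lam` to the continuous functions on `[0,T]`
    (∀ lam : ℝ, 1 / 2 - H < lam → lam < 1 / 2 →
      ∃ C : ℝ, ∀ T : ℝ, 0 < T → ∀ f : ℝ → ℝ, MemHolderZero lam T f →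
        (∀ t ∈ Icc 0 T, FracOpConverges H f t) ∧
        ContinuousOn (fracOp H f) (Icc 0 T) ∧
        (∀ t ∈ Icc 0 T, |fracOp H f t| ≤ C * T ^ (H - 1 / 2 + lam) * holderNorm lam T f) ∧
        (∀ g : ℝ → ℝ, MemHolderZero lam T g → ∀ a b : ℝ, ∀ t ∈ Icc 0 T,
          fracOp H (fun s => a * f s + b * g s) t = a * fracOp H f t + b * fracOp H g t)) ∧
    -- every fractional Brownian motion on `[0,T]` is the image under `Λ_H` of a Brownian motion
    (∀ T : ℝ, 0 < T → ∀ (Ω : Type*) [MeasurableSpace Ω] (P : Measure Ω) [IsProbabilityMeasure P]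
      (X : ℝ → Ω → ℝ), IsFracBrownianOn H T X P →
      ∃ B : ℝ → Ω → ℝ, IsBrownianOn T B P ∧
        (∀ᵐ ω ∂P, ∀ lam : ℝ, 1 / 2 - H < lam → lam < 1 / 2 →
          MemHolderZero lam T (fun t => B t ω)) ∧
        (∀ t ∈ Icc 0 T, ∀ᵐ ω ∂P, X t ω = fracOp H (fun s => B s ω) t) ∧
        ((∀ᵐ ω ∂P, ContinuousOn (fun t => X t ω) (Icc 0 T)) →
          ∀ᵐ ω ∂P, ∀ t ∈ Icc 0 T, X t ω = fracOp H (fun s => B s ω) t)) := by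
  refine ⟨fun lam hlam _ => fracOp_bounded_linear hH0 hH1 hlam, ?_⟩
  intro T hT Ω _ P _ X hX
  obtain ⟨I, hI, hIX⟩ := exists_isonormal_of_fracBrownian hH0 hH1 hX
  obtain ⟨B, hBm, hBc, hB, hBh, hBI⟩ := exists_brownian_of_isonormal hT hI
  have hrep : ∀ t ∈ Icc 0 T, ∀ᵐ ω ∂P, X t ω = fracOp H (fun s => B s ω) t := by
    intro t ht
    rcases ht.1.eq_or_lt with rfl | ht0
    · filter_upwards [hX.ae_eq_zero hH0 hT] with ω hω
      rw [hω, fracOp_zero]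
    · filter_upwards [fracOp_ae_eq_isonormal hH0 hH1 hBm hBc hBI ht0 ht.2, hIX ⟨t, ht⟩]
        with ω h1 h2
      rw [h1, h2]
  refine ⟨B, hB, ?_, hrep, fun hXc => ?_⟩
  · filter_upwards [hBh] with ω hω lam hlam hlam'
    exact hω lam (by linarith) hlam'
  · obtain ⟨D, hDc, hDd⟩ := TopologicalSpace.exists_countable_dense ℝ
    have hall : ∀ᵐ ω ∂P, ∀ t ∈ D, t ∈ Icc 0 T → X t ω = fracOp H (fun s => B s ω) t := by
      rw [ae_ball_iff hDc]
      intro t _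
      by_cases ht : t ∈ Icc 0 T
      · filter_upwards [hrep t ht] with ω hω _ using hω
      · exact Filter.Eventually.of_forall fun ω h => absurd h ht
    -- Any admissible exponent will do: it serves only to make the path of $\Lambda_HB$ continuous,
    -- so that agreement on the countable dense set propagates.
    obtain ⟨lam, hlam, hlam'⟩ := exists_between (show 1 / 2 - H < 1 / 2 by linarith)
    obtain ⟨C, hC⟩ := fracOp_bounded_linear hH0 hH1 hlam
    filter_upwards [hXc, hall, hBh] with ω h1 h2 h3
    exact eqOn_Icc_of_eqOn_dense hT hDd h1 (hC T hT _ (h3 lam (by linarith) hlam')).2.1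
      fun t ht => h2 t ht.1 (Ioo_subset_Icc_self ht.2)
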